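/- **Setup.** Let $a\ge b\ge -1/2$ be real, $\epsilon=(a+b+1)/2$, and let $z,z'\in\mathbb C$ satisfy $(z-k)(z'-k)>0$ for all $k\in\mathbb Z$, $(z+k+2\epsilon)(z'+k+2\epsilon)>0$ for all integers $k\ge1$, and $z+z'>-(1+b)$ (in particular these numbers are real). For $N\ge1$ let $\mathbb{GT}^+_N$ be the set of tuples of integers $\lambda=(\lambda_1\ge\dots\ge\lambda_N\ge0)$; put $l_i=\lambda_i+N-i$, $\widehat l_i=(l_i+\epsilon)^2$, and $\Delta_N(x)=\prod_{i<j}(x_i-x_j)$. *Links.* Let $\mathfrak P_k$ $(k\ge0)$ be the polynomials obtained by orthogonalizing $1,x,x^2,\dots$ in $L^2([-1,1],(1-x)^a(1+x)^b\,dx)$. For $\lambda\in\mathbb{GT}^+_N$ let $\mathfrak P_\lambda(x_1,\dots,x_N)=\det[\mathfrak P_{\lambda_i+N-i}(x_j)]_{i,j=1}^N/\Delta_N(x)$ and $\Phi_\lambda=\mathfrak P_\lambda/\mathfrak P_\lambda(1,\dots,1)$. The matrix $\Lambda^{N+1}_N(\lambda,\mu)$, $\lambda\in\mathbb{GT}^+_{N+1}$,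 $\mu\in\mathbb{GT}^+_N$, with finitely supported rows, is defined by $$\Phi_\lambda(x_1,\dots,x_N,1)=\sum_{\mu\in\mathbb{GT}^+_N}\Lambda^{N+1}_N(\lambda,\mu)\,\Phi_\mu(x_1,\dots,x_N).$$ *Semigroups.* For complex $u,u'$ and integers $x\geq 0$ put $$\beta(x)=\frac{(x+2\epsilon)(x+a+1)(x-u)(x-u')}{2(x+\epsilon)(2x+2\epsilon+1)},\qquad \delta(x)=\frac{x(x+b)(x+u+2\epsilon)(x+u'+2\epsilon)}{2(x+\epsilon)(2x+2\epsilon-1)}\ (x\ge1),\qquad \delta(0)=0,$$ where for $x=0$ the factor $(x+2\epsilon)/(2(x+\epsilon))$ is read as $1$ (also when $\epsilon=0$). Let $R$ be the tridiagonal matrix on $\mathbb Z_{\ge0}$ with $R(x,x+1)=\beta(x)$, $R(x,x-1)=\delta(x)$, $R(x,x)=-\beta(x)-\delta(x)$. For $\lambda,\nu\in\mathbb{GT}^+_N$, with $n_i=\nu_i+N-i$ and $\widehat n_i=(n_i+\epsilon)^2$, put $$R^{(N)}_{u,u'}(\lambda,\nu)=\frac{\Delta_N(\widehat n)}{\Delta_N(\widehat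 l)}\sum_{i=1}^N R(l_i,n_i)\mathbf 1_{\{l_j=n_j\ \forall j\ne i\}}-c_N\mathbf 1_{\{\lambda=\nu\}},\qquad c_N=\frac{N(N-1)(N-2)}3-\frac{N(N-1)}2(u+u'+b).$$ Let $(P_N(t))_{t\ge0}$ be the unique standard Markov semigroup on $\mathbb{GT}^+_N$ (stochastic matrices with $P_N(0)=I$, $P_N(s+t)=P_N(s)P_N(t)$, and $P_N(t)\to I$ entrywise as $t\downarrow 0$) whose $q$-matrix $\lim_{h\downarrow0}(P_N(h)-I)/h$ (entrywise limit) is $R^{(N)}_{u,u'}$ with $(u,u')=(z+N-1,z'+N-1)$. **Theorem.** For every $N\ge1$ the matrix $\Lambda^{N+1}_N$ and the semigroup $(P_N(t))_{t\ge0}$ are well defined (each exists and is unique), and for all $N\ge2$ and $t\ge0$ the master relation $$P_{N+1}(t)\,\Lambda^{N+1}_N=\Lambda^{N+1}_N\,P_N(t)$$ holds, i.e. for all $\lambda\in\mathbb{GT}^+_{N+1}$ and $\mu\in\mathbb{GT}^+_N$ $$\sum_{\kappa\in\mathbb{GT}^+_{N+1}}P_{N+1}(t;\lambda,\kappa)\Lambda^{N+1}_N(\kappa,\mu)=\sum_{\kappa\in\mathbb{GT}^+_N}\Lambda^{N+1}_N(\lambda,\kappa)P_N(t;\kappa,\mu),$$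 where the sum on the left converges absolutely and the sum on the right is finite. -/

import Mathlib

open scoped ComplexOrder NNReal

noncomputable section

/-! ### Positive signatures -/

/-- Positive `N`-signatures: weakly decreasing `N`-tuples of nonnegative integers. -/
abbrev PosSignature (N : ℕ) : Type := {lam : Fin N → ℕ // Antitone lam}

/-- The strictly decreasing tuple `l` attached to `lam`. With the usual indices `1, …, N` it is
`l_i = lam_i + N - i`; here the indices are `0, …, N - 1`. -/
def PosSignature.shifted {N : ℕ} (lam : PosSignature N) (i : Fin N) : ℕ :=
  lam.1 i + (N - 1 - (i : ℕ))

/-- The parameter `ε = (a + b + 1) / 2`. -/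
def epsParam (a b : ℝ) : ℝ := (a + b + 1) / 2

/-- The points `(l_i + ε)²` of the quadratic half-lattice attached to a signature. -/
def PosSignature.hat (a b : ℝ) {N : ℕ} (lam : PosSignature N) (i : Fin N) : ℝ :=
  ((lam.shifted i : ℝ) + epsParam a b) ^ 2

/-- The Vandermonde product `∏_{i < j} (x_i - x_j)`. -/
def vandermondeProd {R : Type*} [CommRing R] {N : ℕ} (x : Fin N → R) : R :=
  ∏ i : Fin N, ∏ j ∈ Finset.Ioi i, (x i - x j)

/-! ### Jacobi polynomials -/

/-- The inner product of two polynomials in `L²([-1, 1], (1 - x)^a (1 + x)^b dx)`. -/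
def jacobiInner (a b : ℝ) (p q : Polynomial ℝ) : ℝ :=
  ∫ x in (-1 : ℝ)..1, p.eval x * q.eval x * ((1 - x) ^ a * (1 + x) ^ b)

/-- The univariate Jacobi polynomials: the orthogonalization (Gram-Schmidt, monic normalization)
of `1, x, x², …` with respect to `jacobiInner a b`. -/
def jacobiPoly (a b : ℝ) (n : ℕ) : Polynomial ℝ :=
  Polynomial.X ^ n - ∑ k : Fin n,
    Polynomial.C (jacobiInner a b (Polynomial.X ^ n) (jacobiPoly a b k) /
      jacobiInner a b (jacobiPoly a b k) (jacobiPoly a b k)) * jacobiPoly a b k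
termination_by n
decreasing_by all_goals exact k.2

/-- The numerator `det [p_i(x_j)]` of a multivariate polynomial given by a bialternant formula. -/
def alternantDet {N : ℕ} (p : Fin N → Polynomial ℝ) : MvPolynomial (Fin N) ℝ :=
  (Matrix.of fun i j : Fin N => Polynomial.aeval (MvPolynomial.X j) (p i)).det

theorem X_sub_X_irreducible {N : ℕ} {i j : Fin N} (h : i ≠ j) :
    Irreducible (MvPolynomial.X i - MvPolynomial.X j : MvPolynomial (Fin N) ℝ) := by
  have hc : MvPolynomial.coeff (Finsupp.single i 1)
      (MvPolynomial.X i - MvPolynomial.X j : MvPolynomial (Fin N) ℝ) = 1 := by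
    simp [MvPolynomial.coeff_X, Finsupp.single_left_inj, h.symm]
  refine MvPolynomial.irreducible_of_totalDegree_eq_one (le_antisymm ?_ ?_) ?_
  · refine (MvPolynomial.totalDegree_sub _ _).trans ?_
    simp
  · have := MvPolynomial.le_totalDegree (p := (MvPolynomial.X i - MvPolynomial.X j :
      MvPolynomial (Fin N) ℝ)) (s := Finsupp.single i 1)
      (by rw [MvPolynomial.mem_support_iff, hc]; exact one_ne_zero)
    simpa using this
  · intro x hx
    exact isUnit_of_dvd_one (hc ▸ hx (Finsupp.single i 1))

theorem X_sub_X_dvd_alternantDet {N : ℕ} (p : Fin N → Polynomial ℝ) {i j : Fin N} (h : i ≠ j) :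
    (MvPolynomial.X i - MvPolynomial.X j : MvPolynomial (Fin N) ℝ) ∣ alternantDet p := by
  rw [← Ideal.mem_span_singleton, ← Ideal.Quotient.eq_zero_iff_mem]
  set I := Ideal.span {(MvPolynomial.X i - MvPolynomial.X j : MvPolynomial (Fin N) ℝ)}
  have hX : Ideal.Quotient.mkₐ ℝ I (MvPolynomial.X i) =
      Ideal.Quotient.mkₐ ℝ I (MvPolynomial.X j) :=
    (Ideal.Quotient.mk_eq_mk_iff_sub_mem _ _).2 (Ideal.mem_span_singleton_self _)
  change Ideal.Quotient.mkₐ ℝ I _ = 0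
  rw [alternantDet, AlgHom.map_det]
  refine Matrix.det_zero_of_column_eq h fun k => ?_
  simp only [AlgHom.mapMatrix_apply, Matrix.map_apply, Matrix.of_apply,
    ← Polynomial.aeval_algHom_apply, hX]

theorem vandermondeProd_dvd_alternantDet {N : ℕ} (p : Fin N → Polynomial ℝ) :
    vandermondeProd (fun i : Fin N => (MvPolynomial.X i : MvPolynomial (Fin N) ℝ)) ∣
      alternantDet p := by
  rw [vandermondeProd, Finset.prod_sigma']
  refine Finset.prod_dvd_of_isRelPrime ?_ fun x hx => X_sub_X_dvd_alternantDet p ?_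
  · rintro ⟨i, j⟩ hij ⟨k, l⟩ hkl hne
    simp only [Finset.coe_sigma, Set.mem_sigma_iff, Finset.mem_coe, Finset.mem_univ, true_and,
      Finset.mem_Ioi] at hij hkl
    refine (X_sub_X_irreducible hij.ne).isRelPrime_iff_not_dvd.2 fun hd => ?_
    have := map_dvd (MvPolynomial.eval fun m : Fin N => if m = j then (i : ℝ) else (m : ℝ)) hd
    simp only [map_sub, MvPolynomial.eval_X, hij.ne, if_true, if_false, sub_self,
      zero_dvd_iff, sub_eq_zero] at this
    apply hne
    have e : ∀ p q : Fin N, ((p : ℕ) : ℝ) = ((q : ℕ) : ℝ) → p = q := fun p q h =>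
      Fin.ext (by exact_mod_cast h)
    split_ifs at this with h1 h2 h2
    · exact absurd (h1.trans h2.symm) hkl.ne
    · have := e _ _ this
      subst h1 this
      exact absurd (hij.trans hkl) (lt_irrefl _)
    · have := e _ _ this
      subst h2 this
      rfl
    · exact absurd (e _ _ this) hkl.ne
  · have := Finset.mem_Ioi.1 (Finset.mem_sigma.1 hx).2
    exact this.ne

/-- The multivariate Jacobi polynomial of `lam`, i.e. the polynomial
`det [P_{lam_i + N - i}(x_j)] / ∏_{i < j} (x_i - x_j)`; the quotient of the (exact) division is
unique because polynomial rings over `ℝ` are integral domains. -/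
def multiJacobi (a b : ℝ) {N : ℕ} (lam : PosSignature N) : MvPolynomial (Fin N) ℝ :=
  (vandermondeProd_dvd_alternantDet fun i => jacobiPoly a b (lam.shifted i)).choose

/-- The Jacobi polynomial of `lam` normalized to take the value `1` at `(1, …, 1)`. -/
def normJacobi (a b : ℝ) {N : ℕ} (lam : PosSignature N) : MvPolynomial (Fin N) ℝ :=
  (MvPolynomial.eval (fun _ => (1 : ℝ)) (multiJacobi a b lam))⁻¹ • multiJacobi a b lam

/-! ### The links -/

/-- `f(x_1, …, x_N, 1)` for a polynomial `f` in `N + 1` variables. -/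
def lastVarOne {N : ℕ} (f : MvPolynomial (Fin (N + 1)) ℝ) : MvPolynomial (Fin N) ℝ :=
  MvPolynomial.aeval
    (Fin.snoc (α := fun _ => MvPolynomial (Fin N) ℝ) (fun i => MvPolynomial.X i) 1) f

/-- `L` is the matrix of coefficients of the branching rule
`Φ_lam(x_1, …, x_N, 1) = ∑_mu L(lam, mu) Φ_mu(x_1, …, x_N)` (finite sums). -/
def IsBranchingMatrix (a b : ℝ) (N : ℕ) (L : PosSignature (N + 1) → PosSignature N →₀ ℝ) : Prop :=
  ∀ lam : PosSignature (N + 1),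
    lastVarOne (normJacobi a b lam) = (L lam).sum fun mu c => c • normJacobi a b mu

/-- The link from level `N + 1` to level `N`: the matrix of coefficients of the branching rule of
normalized Jacobi polynomials. -/
def link (a b : ℝ) (N : ℕ) : PosSignature (N + 1) → PosSignature N →₀ ℝ :=
  Classical.epsilon (IsBranchingMatrix a b N)

/-! ### Markov semigroups and their `q`-matrices -/

/-- Standard Markov semigroups on a discrete space `I`, given by their matrices. -/
structure IsMarkovSemigroup {I : Type*} [DecidableEq I] (P : ℝ≥0 → Matrix I I ℝ) : Prop where
  nonneg : ∀ t i j, 0 ≤ P t i j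
  row_sum : ∀ t i, HasSum (fun j => P t i j) 1
  zero : P 0 = 1
  chapman_kolmogorov : ∀ s t i j, HasSum (fun k => P s i k * P t k j) (P (s + t) i j)
  standard : ∀ i j,
    Filter.Tendsto (fun t => P t i j) (nhdsWithin 0 (Set.Ioi 0)) (nhds ((1 : Matrix I I ℝ) i j))

/-- `Q` is the `q`-matrix of `P`: entrywise, `Q = lim_{h ↓ 0} (P(h) - 1) / h`. -/
def HasQMatrix {I : Type*} [DecidableEq I] (P : ℝ≥0 → Matrix I I ℝ) (Q : Matrix I I ℝ) : Prop :=
  ∀ i j, Filter.Tendsto (fun h : ℝ≥0 => (P h i j - (1 : Matrix I I ℝ) i j) / (h : ℝ))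
    (nhdsWithin 0 (Set.Ioi 0)) (nhds (Q i j))

/-! ### The rates and the semigroups on the levels -/

/-- The birth rates
`β(x) = (x + 2ε)(x + a + 1)(x - u)(x - u') / (2 (x + ε)(2x + 2ε + 1))`.
At `x = 0` the factor `(x + 2ε) / (2 (x + ε))` is `2ε / (2ε)`, cancelled to `1` so that the formula
also makes sense for `ε = 0`. The products `(x - u)(x - u')` are real for the parameters of
interest. -/
def birthRate (a b : ℝ) (u u' : ℂ) (x : ℕ) : ℝ :=
  (if x = 0 then 1 else ((x : ℝ) + 2 * epsParam a b) / (2 * ((x : ℝ) + epsParam a b))) *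
    ((x : ℝ) + a + 1) * (((x : ℂ) - u) * ((x : ℂ) - u')).re / (2 * (x : ℝ) + 2 * epsParam a b + 1)

/-- The death rates
`δ(x) = x (x + b)(x + u + 2ε)(x + u' + 2ε) / (2 (x + ε)(2x + 2ε - 1))` for `x ≥ 1`, `δ(0) = 0`. -/
def deathRate (a b : ℝ) (u u' : ℂ) (x : ℕ) : ℝ :=
  if x = 0 then 0 else
    (x : ℝ) * ((x : ℝ) + b) *
      (((x : ℂ) + u + 2 * (epsParam a b : ℂ)) * ((x : ℂ) + u' + 2 * (epsParam a b : ℂ))).re /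
        (2 * ((x : ℝ) + epsParam a b) * (2 * (x : ℝ) + 2 * epsParam a b - 1))

/-- The tridiagonal birth-and-death matrix on `{0, 1, 2, …}`. -/
def birthDeathMatrix (a b : ℝ) (u u' : ℂ) : Matrix ℕ ℕ ℝ := fun x y =>
  if y = x + 1 then birthRate a b u u' x
  else if y + 1 = x then deathRate a b u u' x
  else if y = x then -(birthRate a b u u' x + deathRate a b u u' x)
  else 0

/-- The constant `c_N = N(N-1)(N-2)/3 - N(N-1)/2 · (u + u' + b)`. -/
def rateConst (b : ℝ) (u u' : ℂ) (N : ℕ) : ℝ :=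
  (N : ℝ) * ((N : ℝ) - 1) * ((N : ℝ) - 2) / 3 -
    (N : ℝ) * ((N : ℝ) - 1) / 2 * ((u + u').re + b)

/-- The matrix of transition rates on positive `N`-signatures: the Doob transform of `N`
independent birth-and-death processes by the Vandermonde product. -/
def levelRates (a b : ℝ) (u u' : ℂ) (N : ℕ) : Matrix (PosSignature N) (PosSignature N) ℝ :=
  fun lam nu =>
    vandermondeProd (nu.hat a b) / vandermondeProd (lam.hat a b) *
        (∑ i : Fin N, if ∀ j, j ≠ i → lam.shifted j = nu.shifted j
          then birthDeathMatrix a b u u' (lam.shifted i) (nu.shifted i) else 0) -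
      if lam = nu then rateConst b u u' N else 0

/-- `P` is a standard Markov semigroup on positive `N`-signatures whose `q`-matrix is the matrix
`levelRates a b u u' N`. -/
def IsLevelSemigroup (a b : ℝ) (u u' : ℂ) (N : ℕ)
    (P : ℝ≥0 → Matrix (PosSignature N) (PosSignature N) ℝ) : Prop :=
  IsMarkovSemigroup P ∧ HasQMatrix P (levelRates a b u u' N)

/-- The level-`N` semigroup with parameters `(u, u')`: the Markov semigroup with `q`-matrix
`levelRates a b u u' N`. -/
def levelSemigroup (a b : ℝ) (u u' : ℂ) (N : ℕ) :
    ℝ≥0 → Matrix (PosSignature N) (PosSignature N) ℝ :=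
  Classical.epsilon (IsLevelSemigroup a b u u' N)

/-- The level-`N` semigroup attached to `(z, z')`, i.e. with `(u, u') = (z + N - 1, z' + N - 1)`. -/
def zSemigroup (a b : ℝ) (z z' : ℂ) (N : ℕ) :
    ℝ≥0 → Matrix (PosSignature N) (PosSignature N) ℝ :=
  levelSemigroup a b (z + N - 1) (z' + N - 1) N

/-- The conditions on `(z, z')`. The order on `ℂ` is the usual partial order, so that `w < w'`
means that `w' - w` is a positive real number. -/
structure IsAdmissiblePair (a b : ℝ) (z z' : ℂ) : Prop where
  pos_int : ∀ k : ℤ, 0 < (z - k) * (z' - k)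
  pos_shift : ∀ k : ℕ, 1 ≤ k →
    0 < (z + k + 2 * (epsParam a b : ℂ)) * (z' + k + 2 * (epsParam a b : ℂ))
  sum_gt : (-(1 + b : ℝ) : ℂ) < z + z'

end

/-!
The `q`-matrix on level `N` is the Doob transform, by the Vandermonde product, of `N` independent
birth-and-death processes on the quadratic half-lattice `(l + ε)²`. Its rates may grow faster than
linearly, but it maps `∑ (l_i + ε)²` to a function of at most the same growth
(`isLyapunovQMatrix_levelRates`). A Lyapunov function excludes explosion. Existence of the semigroup
comes from Feller's minimal construction, while a maximum principle for the backward equation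
(`IsBackwardSolution.nonpos`) gives its uniqueness (`existsUnique_isMarkovSemigroup`). The same
principle shows that stochastic matrices which intertwine two such `q`-matrices also intertwine the
semigroups (`IsMarkovSemigroup.hasSum_intertwining`): both sides of the master relation are bounded
solutions of one backward equation with the same initial value.

Three facts about the links are therefore needed, and all come from the expansion of Jacobi
polynomials at the point `1`. The polynomial with value `1` at `1` is
`∑ c_k q_k(n) (x - 1)^k`, where `q_k(n) = ∏_{j < k} ((n + ε)² - (j + ε)²)` and `c_k > 0` does not
depend on `n`. Consequently `normJacobi` is a generating function of the quantities
`multiQuad k lam = det [q_{k_j}(l_i)] / Δ(l)`, and these separate finitely supported measures on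
signatures (`eq_zero_of_multiQuad`), whence the uniqueness of the links.

* The links exist and are nonnegative. Christoffel–Darboux summation expands the quotients
  `(P_n - P_m) / (x - 1)` of differences of Jacobi polynomials with nonnegative coefficients, and
  the Cauchy–Binet formula turns this into determinants that are nonnegative because of interlacing
  (`isBranchingMatrix_branchingCoeff`, `branchingCoeff_nonneg`). Their rows sum to `1`, as one sees
  by setting all variables equal to `1`.
* A link sends `multiQuad k` to a multiple of `multiQuad (k_1 + 1, …, k_N + 1, 0)`
  (`branchingCoeff_sum_multiQuad`).
* The generators act on `multiQuad k` triangularly: `multiQuad k` goes to a combination of itself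
  and of the functions with one exponent lowered by `1` (`sum_levelRates_multiQuad`).

Comparing coefficients in the last two items, the shift `(u, u') ↦ (u + 1, u' + 1)` from level `N`
to level `N + 1` is exactly what makes the generators commute with the links
(`sum_levelRates_mul_branchingCoeff`).
-/

/-! ### Backward equations on a countable space -/

section Markov

open Filter Topology MeasureTheory

variable {I : Type*}

/-- Conservative `q`-matrices with finitely supported rows that admit a Lyapunov function: `S i`
is a finite set containing `i` and the support of row `i`. The Lyapunov function `V` has finite
sublevel sets and satisfies `Q V ≤ C V`, which excludes explosion. -/
structure IsLyapunovQMatrix (Q : Matrix I I ℝ) (S : I → Finset I) : Prop where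
  offdiag_nonneg : ∀ i j, i ≠ j → 0 ≤ Q i j
  self_mem : ∀ i, i ∈ S i
  eq_zero : ∀ i j, j ∉ S i → Q i j = 0
  row_sum : ∀ i, ∑ j ∈ S i, Q i j = 0
  lyapunov : ∃ (V : I → ℝ) (C : ℝ), (∀ i, 0 < V i) ∧ (∀ B, {i | V i ≤ B}.Finite) ∧
    ∀ i, ∑ j ∈ S i, Q i j * V j ≤ C * V i

/-- Bounded solutions of the backward equation `∂u/∂t = Q u`, in integrated form. The argument of
`u` under the integral is the nonnegative part of the real integration variable. -/
structure IsBackwardSolution (Q : Matrix I I ℝ) (S : I → Finset I) (u : ℝ≥0 → I → ℝ) : Prop where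
  bounded : ∃ B, ∀ t i, |u t i| ≤ B
  continuous : ∀ i, Continuous fun t => u t i
  integral_eq : ∀ (t : ℝ≥0) i,
    u t i = u 0 i + ∫ s in (0 : ℝ)..t, ∑ j ∈ S i, Q i j * u s.toNNReal j

variable {Q : Matrix I I ℝ} {S : I → Finset I}

theorem IsBackwardSolution.continuous_rhs {u : ℝ≥0 → I → ℝ} (hu : IsBackwardSolution Q S u)
    (i : I) : Continuous fun s : ℝ => ∑ j ∈ S i, Q i j * u s.toNNReal j :=
  continuous_finsetSum _ fun j _ =>
    continuous_const.mul ((hu.continuous j).comp continuous_real_toNNReal)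

theorem IsLyapunovQMatrix.sum_erase (hQ : IsLyapunovQMatrix Q S) [DecidableEq I] (i : I) :
    ∑ j ∈ (S i).erase i, Q i j = -Q i i := by
  have := Finset.add_sum_erase (S i) (Q i) (hQ.self_mem i)
  have h0 := hQ.row_sum i
  linarith

/-- A function with negative derivative at `t₀` cannot have a maximum over `[0, t₀]` there. -/
theorem nonneg_of_hasDerivAt_of_isMaxOn {W : ℝ → ℝ} {d t₀ : ℝ} (hd : HasDerivAt W d t₀)
    (h0 : 0 < t₀) (hmax : ∀ t ∈ Set.Icc 0 t₀, W t ≤ W t₀) : 0 ≤ d := by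
  have h1 : Tendsto (slope W t₀) (𝓝[<] t₀) (𝓝 d) :=
    hd.tendsto_slope.mono_left (nhdsWithin_mono _ fun x hx => ne_of_lt hx)
  refine ge_of_tendsto h1 ?_
  have h2 : Set.Ioo 0 t₀ ∈ 𝓝[<] t₀ := Ioo_mem_nhdsLT h0
  filter_upwards [h2] with t ht
  rw [slope_def_field]
  exact div_nonneg_of_nonpos (sub_nonpos.2 (hmax t ⟨ht.1.le, ht.2.le⟩)) (sub_nonpos.2 ht.2.le)

/-- The maximum principle: the Lyapunov function confines the supremum of `u` minus a small
multiple of `e^{Kt} V` to a finite set of states, where the generator is nonpositive at a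
maximum. -/
theorem IsBackwardSolution.nonpos (hQ : IsLyapunovQMatrix Q S) {u : ℝ≥0 → I → ℝ}
    (hu : IsBackwardSolution Q S u) (h0 : ∀ i, u 0 i ≤ 0) (t : ℝ≥0) (i : I) : u t i ≤ 0 := by
  obtain ⟨V, C, hV, hfin, hC⟩ := hQ.lyapunov
  obtain ⟨B, hB⟩ := hu.bounded
  set K : ℝ := max C 0 + 1 with hK
  have hK0 : 0 ≤ K := by positivity
  have hCK : C < K := by have := le_max_left C 0; linarith
  have key : ∀ δ > 0, u t i ≤ δ * Real.exp (K * t) * V i := by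
    intro δ hδ
    by_contra! hcon
    -- the extension of `u` to negative times that solves the integrated equation everywhere
    let U : I → ℝ → ℝ := fun j s => u 0 j + ∫ r in (0 : ℝ)..s, ∑ k ∈ S j, Q j k * u r.toNNReal k
    have hU : ∀ j (s : ℝ), 0 ≤ s → U j s = u s.toNNReal j := by
      intro j s hs
      have := hu.integral_eq s.toNNReal j
      rw [Real.coe_toNNReal s hs] at this
      exact this.symm
    let W : I → ℝ → ℝ := fun j s => U j s - δ * Real.exp (K * s) * V j
    have hUd : ∀ j s, HasDerivAt (U j) (∑ k ∈ S j, Q j k * u s.toNNReal k) s := fun j s =>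
      (((hu.continuous_rhs j).integral_hasStrictDerivAt 0 s).hasDerivAt).const_add _
    have hWd : ∀ j s, HasDerivAt (W j) (∑ k ∈ S j, Q j k * u s.toNNReal k -
        δ * (Real.exp (K * s) * K) * V j) s := by
      intro j s
      refine (hUd j s).sub ?_
      have h1 : HasDerivAt (fun s : ℝ => Real.exp (K * s)) (Real.exp (K * s) * K) s := by
        simpa using ((hasDerivAt_id s).const_mul K).exp
      exact (h1.const_mul δ).mul_const (V j)
    have hexp : ∀ s : ℝ, 0 ≤ s → 1 ≤ Real.exp (K * s) := fun s hs =>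
      Real.one_le_exp (mul_nonneg hK0 hs)
    have hout : ∀ j s, 0 ≤ s → 0 < W j s → V j ≤ B / δ := by
      intro j s hs hW
      rw [le_div_iff₀ hδ]
      have h1 : δ * Real.exp (K * s) * V j < B := by
        have := (abs_le.1 (hB s.toNNReal j)).2
        have h2 : W j s = u s.toNNReal j - δ * Real.exp (K * s) * V j := by simp only [W, hU j s hs]
        linarith
      have h2 : δ * 1 * V j ≤ δ * Real.exp (K * s) * V j := by
        have := hexp s hs
        have := (hV j).le
        gcongr
      linarith
    have hWt : 0 < W i t := by
      have : W i t = u t i - δ * Real.exp (K * t) * V i := by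
        simp only [W, hU i t t.coe_nonneg, Real.toNNReal_coe]
      linarith
    set F := (hfin (B / δ)).toFinset with hF
    have hmemF : ∀ j, j ∈ F ↔ V j ≤ B / δ := fun j => by simp [hF]
    have hmax : ∀ j, ∃ s ∈ Set.Icc (0 : ℝ) t, ∀ r ∈ Set.Icc (0 : ℝ) t, W j r ≤ W j s := by
      intro j
      have hc : Continuous (W j) :=
        continuous_iff_continuousAt.2 fun s => (hWd j s).continuousAt
      obtain ⟨s, hs, h⟩ := isCompact_Icc.exists_isMaxOn
        (Set.nonempty_Icc.2 t.coe_nonneg) hc.continuousOn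
      exact ⟨s, hs, fun r hr => h hr⟩
    choose τ hτ hτmax using hmax
    obtain ⟨i₀, hi₀, himax⟩ := F.exists_max_image (fun j => W j (τ j))
      ⟨i, (hmemF i).2 (hout i t t.coe_nonneg hWt)⟩
    have hpos : 0 < W i₀ (τ i₀) := by
      refine hWt.trans_le (le_trans (hτmax i t ⟨t.coe_nonneg, le_rfl⟩) ?_)
      exact himax i ((hmemF i).2 (hout i t t.coe_nonneg hWt))
    have hglob : ∀ j, W j (τ i₀) ≤ W i₀ (τ i₀) := by
      intro j
      by_cases hj : j ∈ F
      · exact (hτmax j _ (hτ i₀)).trans (himax j hj)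
      · refine le_trans ?_ hpos.le
        by_contra! h
        exact hj ((hmemF j).2 (hout j _ (hτ i₀).1 h))
    have ht0 : 0 < τ i₀ := by
      rcases (hτ i₀).1.eq_or_lt with h | h
      · exfalso
        rw [← h] at hpos
        have : W i₀ 0 = u 0 i₀ - δ * Real.exp (K * 0) * V i₀ := by
          simp only [W, hU i₀ 0 le_rfl, Real.toNNReal_zero]
        rw [this] at hpos
        have h3 : 0 < δ * Real.exp (K * 0) * V i₀ := by have := hV i₀; positivity
        have := h0 i₀
        linarith
      · exact h
    have hd := nonneg_of_hasDerivAt_of_isMaxOn (hWd i₀ (τ i₀)) ht0 fun r hr =>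
      hτmax i₀ r ⟨hr.1, hr.2.trans (hτ i₀).2⟩
    set E := Real.exp (K * τ i₀) with hE
    have hEpos : 0 < E := Real.exp_pos _
    have hle : ∑ j ∈ S i₀, Q i₀ j * W j (τ i₀) ≤ 0 := by
      have h1 : ∑ j ∈ S i₀, Q i₀ j * W j (τ i₀) =
          ∑ j ∈ S i₀, Q i₀ j * (W j (τ i₀) - W i₀ (τ i₀)) := by
        simp only [mul_sub, Finset.sum_sub_distrib, ← Finset.sum_mul, hQ.row_sum, zero_mul,
          sub_zero]
      rw [h1]
      refine Finset.sum_nonpos fun j _ => ?_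
      by_cases hj : i₀ = j
      · subst hj; simp
      · exact mul_nonpos_of_nonneg_of_nonpos (hQ.offdiag_nonneg _ _ hj) (sub_nonpos.2 (hglob j))
    have hsum : ∑ j ∈ S i₀, Q i₀ j * W j (τ i₀) =
        ∑ k ∈ S i₀, Q i₀ k * u (τ i₀).toNNReal k - δ * E * ∑ j ∈ S i₀, Q i₀ j * V j := by
      rw [Finset.mul_sum, ← Finset.sum_sub_distrib]
      refine Finset.sum_congr rfl fun j _ => ?_
      simp only [W, hU j _ (hτ i₀).1, hE]
      ring
    have hC' : δ * E * ∑ j ∈ S i₀, Q i₀ j * V j ≤ δ * E * (C * V i₀) :=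
      mul_le_mul_of_nonneg_left (hC i₀) (by positivity)
    have hfinal : 0 < δ * E * V i₀ * (K - C) := by
      have := hV i₀
      have := sub_pos.2 hCK
      positivity
    nlinarith
  by_contra! hpos
  have h1 := key (u t i / (2 * (Real.exp (K * t) * V i))) (by have := hV i; positivity)
  have h2 : u t i / (2 * (Real.exp (K * t) * V i)) * Real.exp (K * t) * V i = u t i / 2 := by
    have := (hV i).ne'
    field_simp
  linarith

theorem IsBackwardSolution.finset_sum {ι : Type*} (F : Finset ι) (c : ι → ℝ)
    {u : ι → ℝ≥0 → I → ℝ} (hu : ∀ k, IsBackwardSolution Q S (u k)) :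
    IsBackwardSolution Q S fun t i => ∑ k ∈ F, c k * u k t i where
  bounded := by
    choose B hB using fun k => (hu k).bounded
    refine ⟨∑ k ∈ F, |c k| * B k, fun t i => (Finset.abs_sum_le_sum_abs _ _).trans
      (Finset.sum_le_sum fun k _ => ?_)⟩
    rw [abs_mul]
    exact mul_le_mul_of_nonneg_left (hB k t i) (abs_nonneg _)
  continuous i := continuous_finsetSum _ fun k _ => continuous_const.mul ((hu k).continuous i)
  integral_eq t i := by
    have h1 : ∀ s : ℝ, ∑ j ∈ S i, Q i j * ∑ k ∈ F, c k * u k s.toNNReal j =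
        ∑ k ∈ F, c k * ∑ j ∈ S i, Q i j * u k s.toNNReal j := by
      intro s
      simp only [Finset.mul_sum]
      rw [Finset.sum_comm]
      exact Finset.sum_congr rfl fun k _ => Finset.sum_congr rfl fun j _ => by ring
    simp only [h1]
    rw [intervalIntegral.integral_finsetSum fun k _ =>
      (((hu k).continuous_rhs i).const_mul (c k)).intervalIntegrable _ _, ← Finset.sum_add_distrib]
    refine Finset.sum_congr rfl fun k _ => ?_
    rw [intervalIntegral.integral_const_mul, (hu k).integral_eq t i]
    ring

theorem IsBackwardSolution.sub {u v : ℝ≥0 → I → ℝ} (hu : IsBackwardSolution Q S u)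
    (hv : IsBackwardSolution Q S v) : IsBackwardSolution Q S fun t i => u t i - v t i := by
  have h := IsBackwardSolution.finset_sum Finset.univ (fun k : Bool => if k then 1 else -1)
    (u := fun k : Bool => if k then u else v) (Q := Q) (S := S) (by rintro (_ | _) <;> simpa)
  simpa [sub_eq_add_neg] using h

/-- A bounded solution of the backward equation is determined by its initial value. -/
theorem IsBackwardSolution.ext (hQ : IsLyapunovQMatrix Q S) {u v : ℝ≥0 → I → ℝ}
    (hu : IsBackwardSolution Q S u) (hv : IsBackwardSolution Q S v) (h0 : ∀ i, u 0 i = v 0 i) :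
    u = v := by
  ext t i
  have h1 := (hu.sub hv).nonpos hQ (fun i => by simp [h0]) t i
  have h2 := (hv.sub hu).nonpos hQ (fun i => by simp [h0]) t i
  linarith

theorem IsBackwardSolution.shift {u : ℝ≥0 → I → ℝ} (hu : IsBackwardSolution Q S u) (r : ℝ≥0) :
    IsBackwardSolution Q S fun t i => u (t + r) i where
  bounded := hu.bounded.imp fun B h t i => h _ i
  continuous i := (hu.continuous i).comp (continuous_id.add continuous_const)
  integral_eq t i := by
    have h1 := hu.integral_eq (t + r) i
    have h2 := hu.integral_eq r i
    have hint := fun x y => (hu.continuous_rhs i).intervalIntegrable (μ := volume) x y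
    have h3 := intervalIntegral.integral_add_adjacent_intervals (hint 0 r) (hint r (t + r : ℝ≥0))
    have h4 : ∫ s in (0 : ℝ)..t, ∑ j ∈ S i, Q i j * u (s.toNNReal + r) j =
        ∫ s in (r : ℝ)..(t + r : ℝ≥0), ∑ j ∈ S i, Q i j * u s.toNNReal j := by
      have := intervalIntegral.integral_comp_add_right (a := 0) (b := t)
        (fun s : ℝ => ∑ j ∈ S i, Q i j * u s.toNNReal j) (r : ℝ)
      rw [zero_add] at this
      rw [NNReal.coe_add, ← this]
      refine intervalIntegral.integral_congr fun s hs => ?_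
      rw [Set.uIcc_of_le t.coe_nonneg] at hs
      have h5 : (s + r).toNNReal = s.toNNReal + r := by
        rw [Real.toNNReal_add hs.1 r.coe_nonneg, Real.toNNReal_coe]
      simp only [h5]
    rw [h4, zero_add]
    linarith

theorem isBackwardSolution_const (hQ : IsLyapunovQMatrix Q S) (c : ℝ) :
    IsBackwardSolution Q S fun _ _ => c where
  bounded := ⟨|c|, fun _ _ => le_rfl⟩
  continuous _ := continuous_const
  integral_eq t i := by simp [← Finset.sum_mul, hQ.row_sum]

/-- Passage to the limit in `v(t) = v₀ + ∫₀ᵗ w`, by dominated convergence. -/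
theorem tendsto_integral_equation {ι : Type*} {l : Filter ι} [l.NeBot] [l.IsCountablyGenerated]
    {v : ι → ℝ≥0 → ℝ} {w : ι → ℝ → ℝ} {v' : ℝ≥0 → ℝ} {w' : ℝ → ℝ} {B : ℝ}
    (hw : ∀ n, Continuous (w n)) (hB : ∀ n s, 0 ≤ s → |w n s| ≤ B)
    (hv : ∀ n t, v n t = v n 0 + ∫ s in (0 : ℝ)..t, w n s)
    (hv' : ∀ t, Tendsto (fun n => v n t) l (𝓝 (v' t)))
    (hw' : ∀ s, 0 ≤ s → Tendsto (fun n => w n s) l (𝓝 (w' s))) :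
    Continuous v' ∧ ∀ t, v' t = v' 0 + ∫ s in (0 : ℝ)..t, w' s := by
  constructor
  · have hlip : ∀ n (t s : ℝ≥0), |v n t - v n s| ≤ B * |(t : ℝ) - s| := by
      intro n t s
      have h1 : v n t - v n s = ∫ r in (s : ℝ)..t, w n r := by
        have h2 := intervalIntegral.integral_interval_sub_left (μ := volume)
          ((hw n).intervalIntegrable 0 t) ((hw n).intervalIntegrable 0 s)
        rw [hv n t, hv n s, ← h2]
        ring
      rw [h1, ← Real.norm_eq_abs]
      refine intervalIntegral.norm_integral_le_of_norm_le_const fun x hx => hB n x ?_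
      exact le_trans (le_min s.coe_nonneg t.coe_nonneg) hx.1.le
    have hlip' : ∀ t s : ℝ≥0, |v' t - v' s| ≤ B * |(t : ℝ) - s| := fun t s =>
      le_of_tendsto (((hv' t).sub (hv' s)).abs) (Eventually.of_forall fun n => hlip n t s)
    have : LipschitzWith B.toNNReal v' := LipschitzWith.of_dist_le_mul fun t s => by
      rw [Real.dist_eq, NNReal.dist_eq]
      exact (hlip' t s).trans (mul_le_mul_of_nonneg_right (Real.le_coe_toNNReal B) (abs_nonneg _))
    exact this.continuous
  · intro t
    have h1 : Tendsto (fun n => ∫ s in (0 : ℝ)..t, w n s) l (𝓝 (∫ s in (0 : ℝ)..t, w' s)) := by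
      refine intervalIntegral.tendsto_integral_filter_of_dominated_convergence (fun _ => B)
        (Eventually.of_forall fun n => (hw n).aestronglyMeasurable)
        (Eventually.of_forall fun n => ae_of_all _ fun x hx => ?_) (by simp)
        (ae_of_all _ fun x hx => hw' x ?_)
      · rw [Set.uIoc_of_le t.coe_nonneg] at hx
        exact hB n x hx.1.le
      · rw [Set.uIoc_of_le t.coe_nonneg] at hx
        exact hx.1.le
    refine tendsto_nhds_unique (hv' t) ?_
    simp only [hv _ t]
    exact (hv' 0).add h1

theorem IsBackwardSolution.of_tendsto {ι : Type*} {l : Filter ι} [l.NeBot]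
    [l.IsCountablyGenerated] {u : ι → ℝ≥0 → I → ℝ} {v : ℝ≥0 → I → ℝ} {B : ℝ}
    (hu : ∀ n, IsBackwardSolution Q S (u n)) (hB : ∀ n t i, |u n t i| ≤ B)
    (hv : ∀ t i, Tendsto (fun n => u n t i) l (𝓝 (v t i))) : IsBackwardSolution Q S v := by
  have key := fun i => tendsto_integral_equation (l := l) (v := fun n t => u n t i)
    (w := fun n s => ∑ j ∈ S i, Q i j * u n s.toNNReal j) (v' := fun t => v t i)
    (w' := fun s => ∑ j ∈ S i, Q i j * v s.toNNReal j) (B := ∑ j ∈ S i, |Q i j| * B)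
    (fun n => (hu n).continuous_rhs i)
    (fun n s _ => (Finset.abs_sum_le_sum_abs _ _).trans (Finset.sum_le_sum fun j _ => by
      rw [abs_mul]
      exact mul_le_mul_of_nonneg_left (hB n _ j) (abs_nonneg _)))
    (fun n t => (hu n).integral_eq t i) (fun t => hv t i)
    (fun s _ => tendsto_finsetSum _ fun j _ => (hv _ j).const_mul _)
  exact ⟨⟨B, fun t i => le_of_tendsto (hv t i).abs (Eventually.of_forall fun n => hB n t i)⟩,
    fun i => (key i).1, fun t i => (key i).2 t⟩

end Markov

/-! ### Construction of bounded solutions by iteration -/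

section Markov

open Filter Topology MeasureTheory

variable {I : Type*} {Q : Matrix I I ℝ} {S : I → Finset I}

/-- The approximations of the solution of the backward equation with initial value `f`: the
iterate `n` accounts for the paths with fewer than `n` jumps. -/
noncomputable def fellerIter [DecidableEq I] (Q : Matrix I I ℝ) (S : I → Finset I) (f : I → ℝ) :
    ℕ → ℝ → I → ℝ
  | 0 => fun _ _ => 0
  | n + 1 => fun t i => Real.exp (Q i i * t) *
      (f i + ∫ s in (0 : ℝ)..t, Real.exp (-Q i i * s) *
        ∑ j ∈ (S i).erase i, Q i j * fellerIter Q S f n s j)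

section Iteration

variable [DecidableEq I]

theorem continuous_fellerIter (f : I → ℝ) (n : ℕ) :
    ∀ i, Continuous fun t => fellerIter Q S f n t i := by
  induction n with
  | zero => exact fun i => continuous_const
  | succ n ih =>
    intro i
    have h : Continuous fun s : ℝ => Real.exp (-Q i i * s) *
        ∑ j ∈ (S i).erase i, Q i j * fellerIter Q S f n s j :=
      (by fun_prop : Continuous fun s : ℝ => Real.exp (-Q i i * s)).mul
        (continuous_finsetSum _ fun j _ => continuous_const.mul (ih j))
    exact (by fun_prop : Continuous fun t : ℝ => Real.exp (Q i i * t)).mul (continuous_const.add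
      (intervalIntegral.continuous_primitive (fun a b => h.intervalIntegrable a b) 0))

theorem hasDerivAt_fellerIter (f : I → ℝ) (n : ℕ) (i : I) (t : ℝ) :
    HasDerivAt (fun t => fellerIter Q S f (n + 1) t i)
      (Q i i * fellerIter Q S f (n + 1) t i +
        ∑ j ∈ (S i).erase i, Q i j * fellerIter Q S f n t j) t := by
  have h : Continuous fun s : ℝ => Real.exp (-Q i i * s) *
      ∑ j ∈ (S i).erase i, Q i j * fellerIter Q S f n s j :=
    (by fun_prop : Continuous fun s : ℝ => Real.exp (-Q i i * s)).mul
      (continuous_finsetSum _ fun j _ => continuous_const.mul (continuous_fellerIter f n j))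
  have h1 := ((h.integral_hasStrictDerivAt 0 t).hasDerivAt).const_add (f i)
  have h2 : HasDerivAt (fun s : ℝ => Real.exp (Q i i * s)) (Real.exp (Q i i * t) * Q i i) t := by
    simpa using ((hasDerivAt_id t).const_mul (Q i i)).exp
  refine (h2.mul h1).congr_deriv ?_
  have h3 : Real.exp (Q i i * t) * Real.exp (-Q i i * t) = 1 := by
    rw [← Real.exp_add]; simp
  simp only [fellerIter]
  rw [← mul_assoc (Real.exp (Q i i * t)), h3]
  ring

theorem fellerIter_integral_eq (f : I → ℝ) (n : ℕ) (i : I) (t : ℝ) :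
    fellerIter Q S f (n + 1) t i = f i + ∫ s in (0 : ℝ)..t,
      (Q i i * fellerIter Q S f (n + 1) s i +
        ∑ j ∈ (S i).erase i, Q i j * fellerIter Q S f n s j) := by
  rw [intervalIntegral.integral_eq_sub_of_hasDerivAt
    (fun x _ => hasDerivAt_fellerIter f n i x)]
  · simp [fellerIter]
  · exact ((continuous_const.mul (continuous_fellerIter f (n + 1) i)).add
      (continuous_finsetSum _ fun j _ =>
        continuous_const.mul (continuous_fellerIter f n j))).intervalIntegrable _ _

/-- The iterates increase with `n` and stay between `0` and `1`. -/
theorem fellerIter_bounds (hQ : IsLyapunovQMatrix Q S) {f : I → ℝ} (hf0 : ∀ i, 0 ≤ f i)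
    (hf1 : ∀ i, f i ≤ 1) (n : ℕ) : ∀ (t : ℝ) (i : I), 0 ≤ t → 0 ≤ fellerIter Q S f n t i ∧
      fellerIter Q S f n t i ≤ fellerIter Q S f (n + 1) t i ∧ fellerIter Q S f n t i ≤ 1 := by
  have hoff : ∀ i, ∀ j ∈ (S i).erase i, 0 ≤ Q i j := fun i j hj =>
    hQ.offdiag_nonneg i j (Finset.ne_of_mem_erase hj).symm
  have hcont : ∀ n i, Continuous fun s : ℝ => Real.exp (-Q i i * s) *
      ∑ j ∈ (S i).erase i, Q i j * fellerIter Q S f n s j := fun n i =>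
    (by fun_prop : Continuous fun s : ℝ => Real.exp (-Q i i * s)).mul
      (continuous_finsetSum _ fun j _ => continuous_const.mul (continuous_fellerIter f n j))
  induction n with
  | zero =>
    refine fun t i ht => ⟨le_rfl, ?_, zero_le_one⟩
    simp only [fellerIter, mul_zero, Finset.sum_const_zero, intervalIntegral.integral_zero,
      add_zero]
    exact mul_nonneg (Real.exp_pos _).le (hf0 i)
  | succ n ih =>
    intro t i ht
    refine ⟨(ih t i ht).1.trans (ih t i ht).2.1, ?_, ?_⟩
    · change Real.exp (Q i i * t) * (f i + _) ≤ Real.exp (Q i i * t) * (f i + _)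
      refine mul_le_mul_of_nonneg_left (add_le_add le_rfl ?_) (Real.exp_pos _).le
      refine intervalIntegral.integral_mono_on ht ((hcont n i).intervalIntegrable _ _)
        ((hcont (n + 1) i).intervalIntegrable _ _) fun s hs => ?_
      exact mul_le_mul_of_nonneg_left (Finset.sum_le_sum fun j hj =>
        mul_le_mul_of_nonneg_left (ih s j hs.1).2.1 (hoff i j hj)) (Real.exp_pos _).le
    · change Real.exp (Q i i * t) * (f i + _) ≤ 1
      have h1 : ∫ s in (0 : ℝ)..t, Real.exp (-Q i i * s) *
          ∑ j ∈ (S i).erase i, Q i j * fellerIter Q S f n s j ≤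
          ∫ s in (0 : ℝ)..t, Real.exp (-Q i i * s) * -Q i i := by
        refine intervalIntegral.integral_mono_on ht ((hcont n i).intervalIntegrable _ _)
          ((by fun_prop : Continuous fun s : ℝ =>
            Real.exp (-Q i i * s) * -Q i i).intervalIntegrable _ _) fun s hs => ?_
        refine mul_le_mul_of_nonneg_left ?_ (Real.exp_pos _).le
        rw [← hQ.sum_erase i]
        refine Finset.sum_le_sum fun j hj => ?_
        exact mul_le_of_le_one_right (hoff i j hj) (ih s j hs.1).2.2
      have h2 : ∫ s in (0 : ℝ)..t, Real.exp (-Q i i * s) * -Q i i =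
          Real.exp (-Q i i * t) - 1 := by
        rw [intervalIntegral.integral_eq_sub_of_hasDerivAt
          (f := fun s => Real.exp (-Q i i * s))]
        · simp
        · intro x _
          simpa using ((hasDerivAt_id x).const_mul (-Q i i)).exp
        · exact (by fun_prop : Continuous fun s : ℝ =>
            Real.exp (-Q i i * s) * -Q i i).intervalIntegrable _ _
      have h3 : Real.exp (Q i i * t) * Real.exp (-Q i i * t) = 1 := by
        rw [← Real.exp_add]; simp
      calc _ ≤ Real.exp (Q i i * t) * (1 + (Real.exp (-Q i i * t) - 1)) :=
            mul_le_mul_of_nonneg_left (add_le_add (hf1 i) (h1.trans h2.le)) (Real.exp_pos _).le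
        _ = 1 := by rw [add_sub_cancel, h3]

end Iteration

theorem exists_isBackwardSolution (hQ : IsLyapunovQMatrix Q S) {f : I → ℝ} (hf0 : ∀ i, 0 ≤ f i)
    (hf1 : ∀ i, f i ≤ 1) : ∃ u, IsBackwardSolution Q S u ∧ (∀ i, u 0 i = f i) ∧
      ∀ t i, 0 ≤ u t i ∧ u t i ≤ 1 := by
  classical
  have hb := fellerIter_bounds hQ hf0 hf1
  have hmono : ∀ (t : ℝ≥0) i, Monotone fun n => fellerIter Q S f n t i := fun t i =>
    monotone_nat_of_le_succ fun n => (hb n t i t.coe_nonneg).2.1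
  have hlim : ∀ (t : ℝ≥0) i, ∃ y, Tendsto (fun n => fellerIter Q S f n t i) atTop (𝓝 y) :=
    fun t i => ⟨_, tendsto_atTop_ciSup (hmono t i)
      ⟨1, by rintro _ ⟨n, rfl⟩; exact (hb n t i t.coe_nonneg).2.2⟩⟩
  choose u hu using hlim
  have hu' : ∀ (s : ℝ) i, 0 ≤ s →
      Tendsto (fun n => fellerIter Q S f n s i) atTop (𝓝 (u s.toNNReal i)) := by
    intro s i hs
    simpa [Real.coe_toNNReal s hs] using hu s.toNNReal i
  have h01 : ∀ t i, 0 ≤ u t i ∧ u t i ≤ 1 := fun t i =>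
    ⟨ge_of_tendsto' (hu t i) fun n => (hb n t i t.coe_nonneg).1,
      le_of_tendsto' (hu t i) fun n => (hb n t i t.coe_nonneg).2.2⟩
  have hinit : ∀ i, u 0 i = f i := by
    intro i
    refine tendsto_nhds_unique ((tendsto_add_atTop_iff_nat 1).2 (hu 0 i)) ?_
    simp [fellerIter]
  have hsplit : ∀ (g : I → ℝ) i, ∑ j ∈ S i, Q i j * g j =
      Q i i * g i + ∑ j ∈ (S i).erase i, Q i j * g j := fun g i =>
    (Finset.add_sum_erase (S i) (fun j => Q i j * g j) (hQ.self_mem i)).symm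
  have key := fun i => tendsto_integral_equation (l := atTop)
    (v := fun (n : ℕ) (t : ℝ≥0) => fellerIter Q S f (n + 1) t i)
    (w := fun n s => Q i i * fellerIter Q S f (n + 1) s i +
        ∑ j ∈ (S i).erase i, Q i j * fellerIter Q S f n s j) (v' := fun t => u t i)
    (w' := fun s => Q i i * u s.toNNReal i + ∑ j ∈ (S i).erase i, Q i j * u s.toNNReal j)
    (B := |Q i i| * 1 + ∑ j ∈ (S i).erase i, |Q i j| * 1)
    (fun n => (continuous_const.mul (continuous_fellerIter f (n + 1) i)).add
      (continuous_finsetSum _ fun j _ => continuous_const.mul (continuous_fellerIter f n j)))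
    (fun n s hs => by
      have habs : ∀ n j, |fellerIter Q S f n s j| ≤ 1 := fun n j =>
        abs_le.2 ⟨by linarith [(hb n s j hs).1], (hb n s j hs).2.2⟩
      refine (abs_add_le _ _).trans (add_le_add ?_ ((Finset.abs_sum_le_sum_abs _ _).trans
        (Finset.sum_le_sum fun j _ => ?_)))
      · rw [abs_mul]
        exact mul_le_mul_of_nonneg_left (habs _ _) (abs_nonneg _)
      · rw [abs_mul]
        exact mul_le_mul_of_nonneg_left (habs _ _) (abs_nonneg _))
    (fun n t => by
      rw [fellerIter_integral_eq]
      congr 1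
      simp [fellerIter])
    (fun t => (tendsto_add_atTop_iff_nat 1).2 (hu t i))
    (fun s hs => ((((tendsto_add_atTop_iff_nat 1).2 (hu' s i hs)).const_mul _).add
      (tendsto_finsetSum _ fun j _ => (hu' s j hs).const_mul _)))
  refine ⟨u, ⟨⟨1, fun t i => abs_le.2 ⟨by linarith [(h01 t i).1], (h01 t i).2⟩⟩,
    fun i => (key i).1, fun t i => ?_⟩, hinit, h01⟩
  simp only [hsplit]
  exact (key i).2 t

/-! ### The Markov semigroup of a `q`-matrix with a Lyapunov function -/

/-- If the columns of `P` solve the backward equation, so do the functions `P(t) x` for bounded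
`x`. -/
theorem isBackwardSolution_tsum [Countable I] {P : ℝ≥0 → Matrix I I ℝ}
    (hP : ∀ j, IsBackwardSolution Q S fun t i => P t i j) (h0 : ∀ t i j, 0 ≤ P t i j)
    (h1 : ∀ t i (F : Finset I), ∑ j ∈ F, P t i j ≤ 1) {x : I → ℝ} {B : ℝ} (hx : ∀ j, |x j| ≤ B) :
    IsBackwardSolution Q S (fun t i => ∑' j, P t i j * x j) ∧
      ∀ t i, Summable fun j => P t i j * x j := by
  have habs : ∀ t i (F : Finset I), ∑ j ∈ F, |P t i j * x j| ≤ |B| := by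
    intro t i F
    calc ∑ j ∈ F, |P t i j * x j| ≤ ∑ j ∈ F, P t i j * |B| := by
          refine Finset.sum_le_sum fun j _ => ?_
          rw [abs_mul, abs_of_nonneg (h0 t i j)]
          exact mul_le_mul_of_nonneg_left ((hx j).trans (le_abs_self B)) (h0 t i j)
      _ ≤ |B| := by
          rw [← Finset.sum_mul]
          exact mul_le_of_le_one_left (abs_nonneg _) (h1 t i F)
  have hs : ∀ t i, Summable fun j => P t i j * x j := fun t i =>
    Summable.of_abs (summable_of_sum_le (fun j => abs_nonneg _) (habs t i))
  refine ⟨IsBackwardSolution.of_tendsto (l := atTop)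
    (u := fun (F : Finset I) t i => ∑ j ∈ F, x j * P t i j) (B := |B|)
    (fun F => IsBackwardSolution.finset_sum F x hP) (fun F t i => ?_) (fun t i => ?_), hs⟩
  · simp only [mul_comm (x _)]
    exact (Finset.abs_sum_le_sum_abs _ _).trans (habs t i F)
  · simp only [mul_comm (x _)]
    exact (hs t i).hasSum

theorem exists_isMarkovSemigroup [Countable I] [DecidableEq I] (hQ : IsLyapunovQMatrix Q S) :
    ∃ P : ℝ≥0 → Matrix I I ℝ, IsMarkovSemigroup P ∧ HasQMatrix P Q := by
  have hex : ∀ j : I, ∃ u, IsBackwardSolution Q S u ∧ (∀ i, u 0 i = (1 : Matrix I I ℝ) i j) ∧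
      ∀ t i, 0 ≤ u t i ∧ u t i ≤ 1 := fun j =>
    exists_isBackwardSolution hQ (fun i => by rw [Matrix.one_apply]; split_ifs <;> simp)
      (fun i => by rw [Matrix.one_apply]; split_ifs <;> simp)
  choose p hp hp0 hp01 using hex
  let P : ℝ≥0 → Matrix I I ℝ := fun t i j => p j t i
  have hP : ∀ j, IsBackwardSolution Q S fun t i => P t i j := hp
  have hP0 : P 0 = 1 := by ext i j; exact hp0 j i
  have hnn : ∀ t i j, 0 ≤ P t i j := fun t i j => (hp01 j t i).1
  -- a partial row sum solves the equation with the indicator of `F` as initial value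
  have hF : ∀ t i (F : Finset I), ∑ j ∈ F, P t i j ≤ 1 := by
    intro t i F
    obtain ⟨u, hu, hu0, hu01⟩ := exists_isBackwardSolution hQ
      (f := fun i => if i ∈ F then 1 else 0) (fun i => by split_ifs <;> simp)
      (fun i => by split_ifs <;> simp)
    have h1 := IsBackwardSolution.finset_sum F (fun _ => 1) hP
    have h2 := h1.ext hQ hu fun i => by
      simp [hu0, hP0, Matrix.one_apply]
    have h3 := congrFun (congrFun h2 t) i
    simp only [one_mul] at h3
    rw [h3]
    exact (hu01 t i).2
  refine ⟨P, ⟨hnn, fun t i => ?_, hP0, fun s t i j => ?_, fun i j => ?_⟩, fun i j => ?_⟩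
  -- the row sums and the constant `1` solve the same equation
  · obtain ⟨h1, h2⟩ := isBackwardSolution_tsum hP hnn hF (x := fun _ => 1) (B := 1) (by simp)
    have h3 := h1.ext hQ (isBackwardSolution_const hQ 1) fun i => by
      simp [hP0, Matrix.one_apply]
    have h4 := (h2 t i).hasSum
    rw [congrFun (congrFun h3 t) i] at h4
    simpa using h4
  -- as functions of `s`, both sides of the Chapman-Kolmogorov equation are solutions
  · obtain ⟨h1, h2⟩ := isBackwardSolution_tsum hP hnn hF (x := fun k => P t k j) (B := 1)
      fun k => by rw [abs_of_nonneg (hnn t k j)]; exact (hp01 j t k).2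
    have h3 := h1.ext hQ ((hP j).shift t) fun i => by
      simp [hP0, Matrix.one_apply]
    have h4 := (h2 s i).hasSum
    rwa [congrFun (congrFun h3 s) i] at h4
  · have h := ((hP j).continuous i).tendsto 0
    rw [hP0] at h
    exact h.mono_left nhdsWithin_le_nhds
  · have h1 := (((hP j).continuous_rhs i).integral_hasStrictDerivAt 0 0).hasDerivAt
    have h2 := h1.tendsto_slope
    have h3 : Tendsto (fun h : ℝ≥0 => (h : ℝ)) (𝓝[>] 0) (𝓝[≠] 0) := by
      refine tendsto_nhdsWithin_iff.2 ⟨?_, ?_⟩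
      · exact (NNReal.continuous_coe.tendsto 0).mono_left nhdsWithin_le_nhds
      · filter_upwards [self_mem_nhdsWithin] with h hh
        exact (NNReal.coe_pos.2 hh).ne'
    have h4 := h2.comp h3
    have h5 : ∑ k ∈ S i, Q i k * P (0 : ℝ).toNNReal k j = Q i j := by
      rw [Real.toNNReal_zero, hP0]
      simp only [Matrix.one_apply, mul_ite, mul_one, mul_zero, Finset.sum_ite_eq']
      split_ifs with h
      · rfl
      · exact (hQ.eq_zero i j h).symm
    rw [h5] at h4
    refine h4.congr fun h => ?_
    have h6 := (hP j).integral_eq h i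
    simp only [Function.comp, slope_def_field, intervalIntegral.integral_same, sub_zero]
    rw [h6, hP0]
    simp

/-- Bounds for a `[0, 1]`-valued average from finitely many terms. -/
theorem average_bounds {p x : I → ℝ} {s : ℝ} (hp0 : ∀ k, 0 ≤ p k) (hp : HasSum p 1)
    (hx0 : ∀ k, 0 ≤ x k) (hx1 : ∀ k, x k ≤ 1) (hs : HasSum (fun k => p k * x k) s)
    (F : Finset I) :
    ∑ k ∈ F, p k * x k ≤ s ∧ s ≤ ∑ k ∈ F, p k * x k + (1 - ∑ k ∈ F, p k) := by
  refine ⟨sum_le_hasSum F (fun k _ => mul_nonneg (hp0 k) (hx0 k)) hs, ?_⟩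
  have h := sum_le_hasSum F
    (fun k _ => sub_nonneg.2 (mul_le_of_le_one_right (hp0 k) (hx1 k))) (hp.sub hs)
  rw [Finset.sum_sub_distrib] at h
  linarith

section Semigroup

variable [DecidableEq I] {P : ℝ≥0 → Matrix I I ℝ}

theorem IsMarkovSemigroup.le_one (hP : IsMarkovSemigroup P) (t : ℝ≥0) (i j : I) : P t i j ≤ 1 :=
  le_hasSum (hP.row_sum t i) j fun k _ => hP.nonneg t i k

theorem IsMarkovSemigroup.continuous (hP : IsMarkovSemigroup P) (i j : I) :
    Continuous fun t => P t i j := by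
  have h1 : ∀ h t, |P (h + t) i j - P t i j| ≤ 1 - P h i i := by
    intro h t
    have := average_bounds (hP.nonneg h i) (hP.row_sum h i) (fun k => hP.nonneg t k j)
      (fun k => hP.le_one t k j) (hP.chapman_kolmogorov h t i j) {i}
    simp only [Finset.sum_singleton] at this
    have h2 := hP.le_one h i i
    have h3 := hP.le_one t i j
    have h4 := hP.nonneg t i j
    rw [abs_le]
    constructor <;> nlinarith
  have h2 : Tendsto (fun t => P t i i) (𝓝 0) (𝓝 1) := by
    have h3 := hP.standard i i
    rw [Matrix.one_apply_eq] at h3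
    have h4 : (𝓝 (0 : ℝ≥0)) = 𝓝[>] 0 ⊔ pure 0 := by
      rw [← nhdsNE_sup_pure]
      congr 2
      ext x
      simp [pos_iff_ne_zero]
    rw [h4]
    refine h3.sup ?_
    have : P 0 i i = 1 := by rw [hP.zero, Matrix.one_apply_eq]
    rw [tendsto_pure_left]
    intro s hs
    rw [this]
    exact mem_of_mem_nhds hs
  rw [Metric.continuous_iff]
  intro t ε hε
  obtain ⟨δ, hδ, hd⟩ := Metric.tendsto_nhds_nhds.1 h2 ε hε
  refine ⟨δ, hδ, fun s hs => ?_⟩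
  have h5 : ∀ a b : ℝ≥0, a ≤ b → dist b a < δ → |P b i j - P a i j| < ε := by
    intro a b hab hd'
    have h6 := h1 (b - a) a
    rw [tsub_add_cancel_of_le hab] at h6
    refine h6.trans_lt ?_
    have h7 := hd (x := b - a) (by
      rw [NNReal.dist_eq] at hd' ⊢
      rwa [NNReal.coe_sub hab, NNReal.coe_zero, sub_zero])
    rw [Real.dist_eq, abs_sub_comm] at h7
    exact (le_abs_self _).trans_lt h7
  rw [Real.dist_eq]
  rcases le_total s t with h | h
  · rw [abs_sub_comm]
    exact h5 s t h (by rwa [dist_comm])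
  · exact h5 t s h hs

/-- The columns of a standard Markov semigroup with conservative `q`-matrix `Q` satisfy the backward
equation: since the rows of `P(h)` and of `Q` sum to the same values as those of `1` and `0`, no
mass of order `h` escapes from the support of a row of `Q`. -/
theorem IsMarkovSemigroup.isBackwardSolution (hP : IsMarkovSemigroup P) (hPQ : HasQMatrix P Q)
    (hQ : IsLyapunovQMatrix Q S) (j : I) : IsBackwardSolution Q S fun t i => P t i j where
  bounded := ⟨1, fun t i => by rw [abs_of_nonneg (hP.nonneg t i j)]; exact hP.le_one t i j⟩
  continuous i := hP.continuous i j
  integral_eq t i := by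
    have hone : ∀ f : I → ℝ, ∑ k ∈ S i, (1 : Matrix I I ℝ) i k * f k = f i := by
      intro f
      simp only [Matrix.one_apply, ite_mul, one_mul, zero_mul, Finset.sum_ite_eq, hQ.self_mem i,
        if_true]
    have hderiv : ∀ r : ℝ≥0, Tendsto (fun h : ℝ≥0 => (P (h + r) i j - P r i j) / h) (𝓝[>] 0)
        (𝓝 (∑ k ∈ S i, Q i k * P r k j)) := by
      intro r
      have hlow : Tendsto (fun h : ℝ≥0 => ∑ k ∈ S i, (P h i k - (1 : Matrix I I ℝ) i k) / h *
          P r k j) (𝓝[>] 0) (𝓝 (∑ k ∈ S i, Q i k * P r k j)) :=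
        tendsto_finsetSum _ fun k _ => (hPQ i k).mul_const _
      have hgap : Tendsto (fun h : ℝ≥0 => ∑ k ∈ S i, (P h i k - (1 : Matrix I I ℝ) i k) / h)
          (𝓝[>] 0) (𝓝 0) := by
        have := tendsto_finsetSum (S i) fun k _ => hPQ i k
        rwa [hQ.row_sum i] at this
      have hup := hlow.sub hgap
      rw [sub_zero] at hup
      have hb : ∀ h : ℝ≥0, 0 < h →
          (∑ k ∈ S i, (P h i k - (1 : Matrix I I ℝ) i k) / h * P r k j ≤
            (P (h + r) i j - P r i j) / h) ∧
          (P (h + r) i j - P r i j) / h ≤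
            ∑ k ∈ S i, (P h i k - (1 : Matrix I I ℝ) i k) / h * P r k j -
              ∑ k ∈ S i, (P h i k - (1 : Matrix I I ℝ) i k) / h := by
        intro h hh
        have hh' : (0 : ℝ) < h := hh
        obtain ⟨b1, b2⟩ := average_bounds (hP.nonneg h i) (hP.row_sum h i)
          (fun k => hP.nonneg r k j) (fun k => hP.le_one r k j)
          (hP.chapman_kolmogorov h r i j) (S i)
        have e1 : ∑ k ∈ S i, (P h i k - (1 : Matrix I I ℝ) i k) / h * P r k j =
            (∑ k ∈ S i, P h i k * P r k j - P r i j) / h := by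
          rw [← hone fun k => P r k j, ← Finset.sum_sub_distrib, Finset.sum_div]
          exact Finset.sum_congr rfl fun k _ => by ring
        have e2 : ∑ k ∈ S i, (P h i k - (1 : Matrix I I ℝ) i k) / h =
            (∑ k ∈ S i, P h i k - 1) / h := by
          have := hone fun _ => 1
          simp only [mul_one] at this
          rw [← Finset.sum_div, Finset.sum_sub_distrib, this]
        rw [e1, e2, ← sub_div]
        exact ⟨div_le_div_of_nonneg_right (by linarith) hh'.le,
          div_le_div_of_nonneg_right (by linarith) hh'.le⟩
      refine tendsto_of_tendsto_of_tendsto_of_le_of_le' hlow hup ?_ ?_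
      · filter_upwards [self_mem_nhdsWithin] with h hh using (hb h hh).1
      · filter_upwards [self_mem_nhdsWithin] with h hh using (hb h hh).2
    have hU : ∀ x : ℝ, 0 ≤ x → HasDerivWithinAt (fun s : ℝ => P s.toNNReal i j)
        (∑ k ∈ S i, Q i k * P x.toNNReal k j) (Set.Ioi x) x := by
      intro x hx
      rw [hasDerivWithinAt_iff_tendsto_slope' (by simp)]
      have h1 : Tendsto (fun s : ℝ => (s - x).toNNReal) (𝓝[>] x) (𝓝[>] 0) := by
        refine tendsto_nhdsWithin_iff.2 ⟨?_, ?_⟩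
        · have : Continuous fun s : ℝ => (s - x).toNNReal :=
            continuous_real_toNNReal.comp (continuous_id.sub continuous_const)
          have h := this.tendsto x
          rw [sub_self, Real.toNNReal_zero] at h
          exact h.mono_left nhdsWithin_le_nhds
        · filter_upwards [self_mem_nhdsWithin] with s hs
          exact Real.toNNReal_pos.2 (sub_pos.2 hs)
      refine ((hderiv x.toNNReal).comp h1).congr' ?_
      filter_upwards [self_mem_nhdsWithin] with s hs
      have hs' : x < s := hs
      rw [Function.comp, slope_def_field, ← Real.toNNReal_add (sub_pos.2 hs').le hx,
        sub_add_cancel, Real.coe_toNNReal _ (sub_pos.2 hs').le]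
    have hcont : Continuous fun s : ℝ => ∑ k ∈ S i, Q i k * P s.toNNReal k j :=
      continuous_finsetSum _ fun k _ =>
        continuous_const.mul ((hP.continuous k j).comp continuous_real_toNNReal)
    have := intervalIntegral.integral_eq_sub_of_hasDeriv_right (a := 0) (b := t)
      ((hP.continuous i j).comp continuous_real_toNNReal).continuousOn
      (fun x hx => hU x (by
        rw [min_eq_left t.coe_nonneg] at hx
        exact hx.1.le)) (hcont.intervalIntegrable _ _)
    simp only [Function.comp, Real.toNNReal_coe, Real.toNNReal_zero] at this
    rw [this]
    ring

theorem existsUnique_isMarkovSemigroup [Countable I] (hQ : IsLyapunovQMatrix Q S) :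
    ∃! P : ℝ≥0 → Matrix I I ℝ, IsMarkovSemigroup P ∧ HasQMatrix P Q := by
  obtain ⟨P, hP⟩ := exists_isMarkovSemigroup hQ
  refine ⟨P, hP, fun P' hP' => ?_⟩
  ext t i j
  exact congrFun (congrFun ((hP'.1.isBackwardSolution hP'.2 hQ j).ext hQ
    (hP.1.isBackwardSolution hP.2 hQ j) fun i => by rw [hP'.1.zero, hP.1.zero]) t) i

/-- A finitely supported stochastic matrix that intertwines two `q`-matrices intertwines their
semigroups: both sides of the relation solve the same backward equation with the same initial
value. -/
theorem IsMarkovSemigroup.hasSum_intertwining [Countable I] {J : Type*} [DecidableEq J]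
    {Q' : Matrix J J ℝ} {S' : J → Finset J} {P' : ℝ≥0 → Matrix J J ℝ} {L : I → J →₀ ℝ}
    (hP : IsMarkovSemigroup P) (hPQ : HasQMatrix P Q) (hQ : IsLyapunovQMatrix Q S)
    (hP' : IsMarkovSemigroup P') (hPQ' : HasQMatrix P' Q') (hQ' : IsLyapunovQMatrix Q' S')
    (hL0 : ∀ i j, 0 ≤ L i j) (hL1 : ∀ i, (L i).sum (fun _ c => c) = 1)
    (hcomm : ∀ i j, ∑ k ∈ S i, Q i k * L k j = (L i).sum fun k c => c * Q' k j)
    (t : ℝ≥0) (i : I) (j : J) :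
    HasSum (fun k => P t i k * L k j) ((L i).sum fun k c => c * P' t k j) := by
  have hLle : ∀ i j, L i j ≤ 1 := by
    intro i j
    by_cases h : j ∈ (L i).support
    · rw [← hL1 i]
      exact Finset.single_le_sum (fun k _ => hL0 i k) h
    · rw [Finsupp.notMem_support_iff.1 h]
      exact zero_le_one
  obtain ⟨h1, h2⟩ := isBackwardSolution_tsum (fun j => hP.isBackwardSolution hPQ hQ j) hP.nonneg
    (fun t i F => sum_le_hasSum F (fun k _ => hP.nonneg t i k) (hP.row_sum t i))
    (x := fun k => L k j) (B := 1)
    (fun k => by rw [abs_of_nonneg (hL0 k j)]; exact hLle k j)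
  have hsol := hP'.isBackwardSolution hPQ' hQ' j
  have h3 : IsBackwardSolution Q S fun t i => (L i).sum fun k c => c * P' t k j := by
    refine ⟨⟨1, fun t i => ?_⟩, fun i => ?_, fun t i => ?_⟩
    · have h0 : 0 ≤ (L i).sum fun k c => c * P' t k j :=
        Finset.sum_nonneg fun k _ => mul_nonneg (hL0 i k) (hP'.nonneg t k j)
      rw [abs_of_nonneg h0, ← hL1 i]
      exact Finset.sum_le_sum fun k _ => mul_le_of_le_one_right (hL0 i k) (hP'.le_one t k j)
    · exact continuous_finsetSum _ fun k _ => continuous_const.mul (hP'.continuous k j)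
    · simp only [Finsupp.sum]
      have e1 : ∀ s : ℝ, ∑ m ∈ S i, Q i m * ∑ k ∈ (L m).support, L m k * P' s.toNNReal k j =
          ∑ k ∈ (L i).support, L i k * ∑ n ∈ S' k, Q' k n * P' s.toNNReal n j := by
        intro s
        set x : J → ℝ := fun n => P' s.toNNReal n j
        -- a finite set of states that carries all sums
        set F : Finset J := ((S i).biUnion fun m => (L m).support) ∪
          (L i).support.biUnion S' with hF
        have a1 : ∀ m ∈ S i, ∑ k ∈ (L m).support, L m k * x k = ∑ n ∈ F, L m n * x n := by
          intro m hm
          refine Finset.sum_subset (fun n hn => Finset.mem_union_left _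
            (Finset.mem_biUnion.2 ⟨m, hm, hn⟩)) fun n _ hn => ?_
          rw [Finsupp.notMem_support_iff.1 hn, zero_mul]
        have a2 : ∀ k ∈ (L i).support, ∑ n ∈ S' k, Q' k n * x n = ∑ n ∈ F, Q' k n * x n := by
          intro k hk
          refine Finset.sum_subset (fun n hn => Finset.mem_union_right _
            (Finset.mem_biUnion.2 ⟨k, hk, hn⟩)) fun n _ hn => ?_
          rw [hQ'.eq_zero k n hn, zero_mul]
        have b1 : ∑ m ∈ S i, Q i m * ∑ k ∈ (L m).support, L m k * x k =
            ∑ n ∈ F, ∑ m ∈ S i, Q i m * (L m n * x n) := by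
          rw [Finset.sum_comm]
          exact Finset.sum_congr rfl fun m hm => by rw [a1 m hm, Finset.mul_sum]
        have b2 : ∑ k ∈ (L i).support, L i k * ∑ n ∈ S' k, Q' k n * x n =
            ∑ n ∈ F, ∑ k ∈ (L i).support, L i k * (Q' k n * x n) := by
          rw [Finset.sum_comm]
          exact Finset.sum_congr rfl fun k hk => by rw [a2 k hk, Finset.mul_sum]
        rw [b1, b2]
        refine Finset.sum_congr rfl fun n _ => ?_
        have := congrArg (· * x n) (hcomm i n)
        simpa only [Finsupp.sum, Finset.sum_mul, mul_assoc] using this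
      simp only [e1]
      rw [intervalIntegral.integral_finsetSum fun k _ =>
        ((hsol.continuous_rhs k).const_mul (L i k)).intervalIntegrable _ _,
        ← Finset.sum_add_distrib]
      refine Finset.sum_congr rfl fun k _ => ?_
      rw [intervalIntegral.integral_const_mul, hsol.integral_eq t k]
      ring
  have h4 := h1.ext hQ h3 fun i => by
    rw [hP.zero, hP'.zero]
    simp only [Matrix.one_apply, ite_mul, one_mul, zero_mul, Finsupp.sum, mul_ite,
      mul_one, mul_zero, Finset.sum_ite_eq']
    split_ifs with h
    · simp
    · simp [Finsupp.notMem_support_iff.1 h]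
  have h5 := (h2 t i).hasSum
  rwa [congrFun (congrFun h4 t) i] at h5

end Semigroup

end Markov

/-! ### Signatures and strictly decreasing tuples -/

namespace PosSignature

variable {N : ℕ}

theorem shifted_strictAnti (lam : PosSignature N) : StrictAnti lam.shifted := by
  intro i j hij
  have h1 : lam.1 j ≤ lam.1 i := lam.2 hij.le
  have h2 : (i : ℕ) < j := hij
  have := j.2
  simp only [shifted]
  omega

theorem shifted_injective : Function.Injective (shifted : PosSignature N → Fin N → ℕ) := by
  intro lam mu h
  ext i
  have := congrFun h i
  simp only [shifted] at this
  omega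

theorem le_of_strictAnti {m : Fin N → ℕ} (hm : StrictAnti m) (i : Fin N) :
    N - 1 - (i : ℕ) ≤ m i := by
  obtain ⟨k, hk⟩ : ∃ k, k = N - 1 - (i : ℕ) := ⟨_, rfl⟩
  rw [← hk]
  induction k generalizing i with
  | zero => exact Nat.zero_le _
  | succ k ih =>
    have hi : (i : ℕ) + 1 < N := by omega
    have h1 := ih ⟨i + 1, hi⟩ (by simp only; omega)
    have h2 : m ⟨i + 1, hi⟩ < m i := hm (by rw [Fin.lt_def]; simp)
    omega

/-- The signature `m_i - (N - i)` of a strictly decreasing tuple `m`. -/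
def ofStrictAnti (m : Fin N → ℕ) (hm : StrictAnti m) : PosSignature N :=
  ⟨fun i => m i - (N - 1 - (i : ℕ)), fun i j hij => by
    rcases hij.eq_or_lt with rfl | hlt
    · exact le_rfl
    obtain ⟨d, hd⟩ : ∃ d, (j : ℕ) = i + d := ⟨j - i, by have : (i : ℕ) < j := hlt; omega⟩
    have key : ∀ (d : ℕ) (j : Fin N), (j : ℕ) = i + d → m j + d ≤ m i := by
      intro d
      induction d with
      | zero =>
        intro j hj
        have : j = i := Fin.ext (by simpa using hj)
        simp [this]
      | succ d ih =>
        intro j hj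
        have h1 := ih ⟨i + d, by have := j.2; omega⟩ rfl
        have h2 : m j < m ⟨i + d, by have := j.2; omega⟩ :=
          hm (by rw [Fin.lt_def]; simp only; omega)
        omega
    have := key d j hd
    have := j.2
    simp only
    omega⟩

@[simp]
theorem shifted_ofStrictAnti (m : Fin N → ℕ) (hm : StrictAnti m) :
    (ofStrictAnti m hm).shifted = m := by
  ext i
  have := le_of_strictAnti hm i
  simp only [shifted, ofStrictAnti]
  omega

theorem finite_shifted_lt (M : ℕ) : {lam : PosSignature N | ∀ i, lam.shifted i < M}.Finite := by
  have h := Set.Finite.pi' (fun _ : Fin N => Set.finite_Iio M)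
  exact (h.preimage (shifted_injective.injOn)).subset fun lam h i => h i

/-- The finite set of signatures whose shifted coordinates are smaller than `M`. -/
noncomputable def below (N M : ℕ) : Finset (PosSignature N) := (finite_shifted_lt M).toFinset

@[simp]
theorem mem_below {M : ℕ} {lam : PosSignature N} : lam ∈ below N M ↔ ∀ i, lam.shifted i < M := by
  simp [below]

/-- Every injective tuple is a permutation of a unique strictly decreasing one. -/
theorem exists_shifted_comp {f : Fin N → ℕ} (hf : Function.Injective f) :
    ∃ (lam : PosSignature N) (σ : Equiv.Perm (Fin N)), lam.shifted ∘ σ = f := by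
  have h1 : StrictAnti (f ∘ Tuple.sort f ∘ Fin.rev) := by
    have h2 : StrictMono (f ∘ Tuple.sort f) :=
      (Tuple.monotone_sort f).strictMono_of_injective (hf.comp (Tuple.sort f).injective)
    exact fun i j hij => h2 (Fin.rev_lt_rev.2 hij)
  refine ⟨ofStrictAnti _ h1, (Tuple.sort f).symm.trans Fin.revPerm, ?_⟩
  rw [shifted_ofStrictAnti]
  ext i
  simp

theorem shifted_comp_injective {lam mu : PosSignature N} {σ τ : Equiv.Perm (Fin N)}
    (h : lam.shifted ∘ σ = mu.shifted ∘ τ) : lam = mu ∧ σ = τ := by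
  have h1 : lam = mu := by
    apply shifted_injective
    have hr : Set.range lam.shifted = Set.range mu.shifted := by
      rw [← σ.surjective.range_comp, h, τ.surjective.range_comp]
    have h2 : StrictMono (lam.shifted ∘ Fin.rev) := fun i j hij =>
      lam.shifted_strictAnti (Fin.rev_lt_rev.2 hij)
    have h3 : StrictMono (mu.shifted ∘ Fin.rev) := fun i j hij =>
      mu.shifted_strictAnti (Fin.rev_lt_rev.2 hij)
    have h4 := (h2.range_inj h3).1 (by
      rw [Fin.rev_surjective.range_comp, Fin.rev_surjective.range_comp, hr])
    ext i
    simpa using congrFun h4 (Fin.rev i)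
  subst h1
  refine ⟨rfl, Equiv.ext fun i => lam.shifted_strictAnti.injective (congrFun h i)⟩

end PosSignature

/-! ### Determinants -/

section Determinants

variable {R : Type*} [CommRing R] {N : ℕ}

/-- Expansion of a determinant whose rows are linear combinations. -/
theorem det_sum_rows (s : Fin N → Finset ℕ) (A : Fin N → ℕ → R) (B : ℕ → Fin N → R) :
    (Matrix.of fun i j => ∑ n ∈ s i, A i n * B n j).det =
      ∑ f ∈ Fintype.piFinset s, (∏ i, A i (f i)) * (Matrix.of fun i j => B (f i) j).det := by
  have h1 : (Matrix.of fun i j => ∑ n ∈ s i, A i n * B n j) =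
      fun i => ∑ n ∈ s i, A i n • B n := by
    ext i j
    simp [Finset.sum_apply]
  rw [h1]
  change (Matrix.detRowAlternating (R := R)).toMultilinearMap _ = _
  rw [MultilinearMap.map_sum_finset]
  refine Finset.sum_congr rfl fun f _ => ?_
  rw [MultilinearMap.map_smul_univ, smul_eq_mul]
  rfl

/-- The Cauchy-Binet formula. -/
theorem det_sum_mul_eq (M : ℕ) (A : Fin N → ℕ → R) (B : ℕ → Fin N → R) :
    (Matrix.of fun i j => ∑ n ∈ Finset.range M, A i n * B n j).det =
      ∑ mu ∈ PosSignature.below N M, (Matrix.of fun i j => A i (mu.shifted j)).det *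
        (Matrix.of fun i j => B (mu.shifted i) j).det := by
  classical
  rw [det_sum_rows (fun _ => Finset.range M)]
  rw [← Finset.sum_filter_add_sum_filter_not _ (fun f : Fin N → ℕ => Function.Injective f)]
  rw [Finset.sum_eq_zero (s := Finset.filter (fun f : Fin N → ℕ => ¬ Function.Injective f) _),
    add_zero]
  · have h1 : ∀ mu : PosSignature N, (Matrix.of fun i j => A i (mu.shifted j)).det *
        (Matrix.of fun i j => B (mu.shifted i) j).det =
        ∑ σ : Equiv.Perm (Fin N), (∏ i, A i ((mu.shifted ∘ σ) i)) *
          (Matrix.of fun i j => B ((mu.shifted ∘ σ) i) j).det := by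
      intro mu
      rw [← Matrix.det_transpose, Matrix.det_apply', Finset.sum_mul]
      refine Finset.sum_congr rfl fun σ _ => ?_
      have := Matrix.det_permute σ (Matrix.of fun i j => B (mu.shifted i) j)
      change (Matrix.of fun i j => B ((mu.shifted ∘ σ) i) j).det = _ at this
      rw [this]
      simp only [Matrix.transpose_apply, Matrix.of_apply, Function.comp]
      ring
    simp only [h1]
    rw [← Finset.sum_product']
    symm
    refine Finset.sum_bij (fun p _ => p.1.shifted ∘ p.2) ?_ ?_ ?_ ?_
    · rintro ⟨mu, σ⟩ h
      simp only [Finset.mem_product, PosSignature.mem_below, Finset.mem_univ, and_true] at h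
      simp only [Finset.mem_filter, Fintype.mem_piFinset, Finset.mem_range, Function.comp]
      exact ⟨fun i => h _, mu.shifted_strictAnti.injective.comp σ.injective⟩
    · rintro ⟨mu, σ⟩ _ ⟨nu, τ⟩ _ h
      obtain ⟨rfl, rfl⟩ := PosSignature.shifted_comp_injective h
      rfl
    · intro f hf
      simp only [Finset.mem_filter, Fintype.mem_piFinset, Finset.mem_range] at hf
      obtain ⟨mu, σ, h⟩ := PosSignature.exists_shifted_comp hf.2
      refine ⟨(mu, σ), ?_, h⟩
      simp only [Finset.mem_product, PosSignature.mem_below, Finset.mem_univ, and_true]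
      intro i
      have := hf.1 (σ.symm i)
      rw [← h] at this
      simpa using this
    · rintro ⟨mu, σ⟩ _
      rfl
  · intro f hf
    simp only [Finset.mem_filter, Function.Injective, not_forall] at hf
    obtain ⟨-, i, j, hij, hne⟩ := hf
    rw [Matrix.det_zero_of_row_eq hne (by ext k; simp [hij]), mul_zero]

/-- Subtracting consecutive rows of a matrix whose last column consists of ones. -/
theorem det_of_last_col_one (A : Matrix (Fin (N + 1)) (Fin (N + 1)) R)
    (h : ∀ i, A i (Fin.last N) = 1) :
    A.det = (Matrix.of fun i j : Fin N => A i.castSucc j.castSucc - A i.succ j.castSucc).det := by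
  have h1 : A.det = (Matrix.of fun (i j : Fin (N + 1)) =>
      (Fin.cons (A 0) (fun k : Fin N => A k.succ - A k.castSucc) : Fin (N + 1) → _) i j).det := by
    refine Matrix.det_eq_of_forall_row_eq_smul_add_pred (fun _ => 1) (fun j => by simp)
      fun i j => by simp
  rw [h1, Matrix.det_succ_column _ (Fin.last N), Fin.sum_univ_succ]
  rw [Finset.sum_eq_zero (s := Finset.univ), add_zero]
  · have h2 : (Matrix.of fun i j : Fin N => A i.castSucc j.castSucc - A i.succ j.castSucc) =
        -(Matrix.of fun i j : Fin N => A i.succ j.castSucc - A i.castSucc j.castSucc) := by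
      ext i j; simp
    rw [h2, Matrix.det_neg]
    simp only [Fin.val_zero, Fin.val_last, zero_add, Matrix.of_apply, Fin.cons_zero, h, mul_one,
      Fintype.card_fin]
    congr 2
    ext i j
    simp
  · intro i _
    simp [h]

/-- Both sides are the derivative at `s = 0` of `det (A + s B)`. -/
theorem sum_det_updateRow_eq {n : Type*} [Fintype n] [DecidableEq n] (A B : Matrix n n R) :
    ∑ i, (A.updateRow i (B i)).det = ∑ j, (A.updateCol j fun i => B i j).det := by
  have h1 : ∀ i, (A.updateRow i (B i)).det = ∑ j, A.adjugate j i * B i j := by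
    intro i
    rw [← Matrix.cramer_transpose_apply, Matrix.cramer_eq_adjugate_mulVec]
    simp [Matrix.mulVec, dotProduct, ← Matrix.adjugate_transpose]
  have h2 : ∀ j, (A.updateCol j fun i => B i j).det = ∑ i, A.adjugate j i * B i j := by
    intro j
    rw [← Matrix.cramer_apply, Matrix.cramer_eq_adjugate_mulVec]
    simp [Matrix.mulVec, dotProduct]
  simp only [h1, h2]
  exact Finset.sum_comm

/-- A zero-one matrix whose rows are indicators of final segments, shrinking from top to bottom,
has determinant `0` or `1`. -/
theorem det_indicator_nonneg {n m : Fin N → ℕ} (hn : Antitone n) (hm : Antitone m) :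
    0 ≤ (Matrix.of fun i j => if m j ≤ n i then (1 : ℝ) else 0).det := by
  set A : Matrix (Fin N) (Fin N) ℝ := Matrix.of fun i j => if m j ≤ n i then (1 : ℝ) else 0
  -- row `i` is the indicator of the indices `≥ p i`
  let p : Fin N → ℕ := fun i => (Finset.univ.filter fun j => n i < m j).card
  have hp : ∀ i j, m j ≤ n i ↔ p i ≤ j := by
    intro i j
    constructor
    · intro h
      have : (Finset.univ.filter fun k => n i < m k) ⊆ Finset.Iio j := fun k hk => by
        rw [Finset.mem_Iio]
        by_contra! hjk
        exact absurd ((hm hjk).trans h) (not_le.2 (Finset.mem_filter.1 hk).2)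
      simpa using Finset.card_le_card this
    · intro h
      by_contra! hlt
      have : Finset.Iic j ⊆ Finset.univ.filter fun k => n i < m k := fun k hk => by
        rw [Finset.mem_filter]
        exact ⟨Finset.mem_univ _, hlt.trans_le (hm (Finset.mem_Iic.1 hk))⟩
      have := Finset.card_le_card this
      rw [Fin.card_Iic] at this
      change _ ≤ p i at this
      omega
  have hA : ∀ i j, A i j = if p i ≤ j then 1 else 0 := fun i j => by
    simp only [A, Matrix.of_apply, hp]
  by_cases hinj : Function.Injective p
  · by_cases hN : ∀ i, p i < N
    · have hmono : StrictMono fun i => (⟨p i, hN i⟩ : Fin N) := by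
        refine Monotone.strictMono_of_injective (fun i j hij => ?_) fun i j hij => hinj ?_
        · have : p i ≤ p j := Finset.card_le_card fun k hk => by
            rw [Finset.mem_filter] at hk ⊢
            exact ⟨hk.1, (hn hij).trans_lt hk.2⟩
          exact this
        · simpa using hij
      have htri : A.IsUpperTriangular := fun i j hij => by
        rw [hA, if_neg]
        have h1 : i ≤ ⟨p i, hN i⟩ := hmono.le_apply
        have h2 : (i : ℕ) ≤ p i := h1
        have h3 : (j : ℕ) < i := hij
        omega
      rw [Matrix.det_of_isUpperTriangular htri]
      exact Finset.prod_nonneg fun i _ => by rw [hA]; split_ifs <;> simp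
    · push Not at hN
      obtain ⟨i, hi⟩ := hN
      rw [Matrix.det_eq_zero_of_row_eq_zero i fun j => by
        rw [hA, if_neg]; have := j.2; omega]
  · simp only [Function.Injective, not_forall] at hinj
    obtain ⟨i, j, hij, hne⟩ := hinj
    rw [Matrix.det_zero_of_row_eq hne (by ext k; simp only [hA, hij])]

end Determinants

/-! ### Alternants -/

section Alternants

open Polynomial

variable {N : ℕ}

theorem coeff_prod_aeval_X (f : Fin N → ℝ[X]) (k : Fin N →₀ ℕ) :
    MvPolynomial.coeff k (∏ j, aeval (MvPolynomial.X j : MvPolynomial (Fin N) ℝ) (f j)) =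
      ∏ j, (f j).coeff (k j) := by
  classical
  simp only [aeval_eq_sum_range]
  rw [Finset.prod_univ_sum, MvPolynomial.coeff_sum]
  have h1 : ∀ p : Fin N → ℕ,
      ∏ j, (f j).coeff (p j) • (MvPolynomial.X j : MvPolynomial (Fin N) ℝ) ^ p j =
      MvPolynomial.monomial (Finsupp.equivFunOnFinite.symm p) (∏ j, (f j).coeff (p j)) := by
    intro p
    rw [MvPolynomial.monomial_eq, Finsupp.prod_fintype _ _ (fun i => pow_zero _)]
    simp only [MvPolynomial.smul_eq_C_mul, Finset.prod_mul_distrib, map_prod]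
    simp
  simp only [h1, MvPolynomial.coeff_monomial]
  rw [Finset.sum_eq_single (k : Fin N → ℕ)]
  · simp
  · intro p _ hp
    rw [if_neg]
    rintro rfl
    exact hp (by simp)
  · intro hk
    simp only [Fintype.mem_piFinset, Finset.mem_range, not_forall, not_lt] at hk
    obtain ⟨j, hj⟩ := hk
    rw [Finset.prod_eq_zero (Finset.mem_univ j) (coeff_eq_zero_of_natDegree_lt (by omega))]
    simp

theorem coeff_alternantDet (f : Fin N → ℝ[X]) (k : Fin N →₀ ℕ) :
    MvPolynomial.coeff k (alternantDet f) = (Matrix.of fun i j => (f i).coeff (k j)).det := by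
  rw [alternantDet, Matrix.det_apply', Matrix.det_apply', MvPolynomial.coeff_sum]
  refine Finset.sum_congr rfl fun σ _ => ?_
  have h1 : ((Equiv.Perm.sign σ : ℤ) : MvPolynomial (Fin N) ℝ) =
      MvPolynomial.C ((Equiv.Perm.sign σ : ℤ) : ℝ) := by simp
  rw [h1, MvPolynomial.coeff_C_mul]
  simp only [Matrix.of_apply]
  rw [coeff_prod_aeval_X fun j => f (σ j)]

theorem vandermondeProd_eq_det {R : Type*} [CommRing R] (x : Fin N → R) :
    vandermondeProd x = (Matrix.of fun i j : Fin N => x i ^ (N - 1 - (j : ℕ))).det := by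
  have h := Matrix.det_projVandermonde (fun _ : Fin N => (1 : R)) x
  simp only [one_mul] at h
  rw [vandermondeProd, ← h]
  congr 1
  ext i j
  rw [Matrix.projVandermonde_apply, one_pow, one_mul, Matrix.of_apply, Fin.val_rev]
  congr 1
  omega

theorem vandermondeProd_eq_det_eval {R : Type*} [CommRing R] (x : Fin N → R) (p : ℕ → R[X])
    (hdeg : ∀ k, (p k).natDegree = k) (hmonic : ∀ k, (p k).Monic) :
    (Matrix.of fun i j : Fin N => (p (N - 1 - (j : ℕ))).eval (x i)).det = vandermondeProd x := by
  have h1 := Matrix.det_eval_matrixOfPolynomials_eq_det_vandermonde (x ∘ Fin.rev)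
    (fun k : Fin N => p k) (fun k => hdeg k) (fun k => hmonic k)
  have h2 : (Matrix.of fun i j : Fin N => (p (N - 1 - (j : ℕ))).eval (x i)) =
      (Matrix.of fun i j : Fin N => ((p j).eval ((x ∘ Fin.rev) i))).submatrix
        Fin.revPerm Fin.revPerm := by
    ext i j
    simp only [Matrix.of_apply, Matrix.submatrix_apply, Fin.revPerm_apply, Fin.rev_rev,
      Function.comp, Fin.val_rev]
    congr 2
    omega
  have h3 : (Matrix.of fun i j : Fin N => x i ^ (N - 1 - (j : ℕ))) =
      (Matrix.vandermonde (x ∘ Fin.rev)).submatrix Fin.revPerm Fin.revPerm := by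
    ext i j
    simp only [Matrix.of_apply, Matrix.submatrix_apply, Fin.revPerm_apply, Fin.rev_rev,
      Function.comp, Fin.val_rev, Matrix.vandermonde_apply]
    congr 1
    omega
  rw [vandermondeProd_eq_det, h2, h3, Matrix.det_submatrix_equiv_self,
    Matrix.det_submatrix_equiv_self, h1]

theorem map_vandermondeProd {R R' : Type*} [CommRing R] [CommRing R'] (φ : R →+* R')
    (x : Fin N → R) : φ (vandermondeProd x) = vandermondeProd (φ ∘ x) := by
  simp [vandermondeProd, map_prod]

/-- The Vandermonde product of the variables. -/
noncomputable abbrev vandermondeX (N : ℕ) : MvPolynomial (Fin N) ℝ :=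
  vandermondeProd fun i : Fin N => (MvPolynomial.X i : MvPolynomial (Fin N) ℝ)

theorem vandermondeX_ne_zero : vandermondeX N ≠ 0 := by
  refine Finset.prod_ne_zero_iff.2 fun i _ => Finset.prod_ne_zero_iff.2 fun j hj => ?_
  exact (X_sub_X_irreducible (Finset.mem_Ioi.1 hj).ne).ne_zero

theorem vandermondeX_eq_alternantDet :
    vandermondeX N = alternantDet fun i : Fin N => X ^ (N - 1 - (i : ℕ)) := by
  rw [vandermondeX, vandermondeProd_eq_det, alternantDet, ← Matrix.det_transpose]
  congr 1
  ext i j : 2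
  simp

/-- The exponents `(N - 1, …, 1, 0)`. -/
noncomputable def staircase (N : ℕ) : Fin N →₀ ℕ :=
  Finsupp.equivFunOnFinite.symm fun i => N - 1 - (i : ℕ)

theorem coeff_staircase_vandermondeX :
    MvPolynomial.coeff (staircase N) (vandermondeX N) = 1 := by
  rw [vandermondeX_eq_alternantDet, coeff_alternantDet]
  convert! Matrix.det_one (R := ℝ) (n := Fin N) using 2
  ext i j
  simp only [Matrix.of_apply, coeff_X_pow, staircase, Finsupp.equivFunOnFinite_symm_apply_apply,
    Matrix.one_apply]
  congr 1
  rw [Fin.ext_iff]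
  apply propext
  have := i.2
  have := j.2
  omega

theorem isHomogeneous_vandermondeX :
    (vandermondeX N).IsHomogeneous (∑ i : Fin N, ∑ _j ∈ Finset.Ioi i, 1) :=
  MvPolynomial.IsHomogeneous.prod _ _ _ fun _ _ =>
    MvPolynomial.IsHomogeneous.prod _ _ _ fun _ _ =>
      (MvPolynomial.isHomogeneous_X _ _).sub (MvPolynomial.isHomogeneous_X _ _)

/-- The translation `x ↦ x + 1` of all variables. -/
noncomputable def translateOne (N : ℕ) : MvPolynomial (Fin N) ℝ →ₐ[ℝ] MvPolynomial (Fin N) ℝ :=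
  MvPolynomial.aeval fun j => MvPolynomial.X j + 1

theorem translateOne_vandermondeX : translateOne N (vandermondeX N) = vandermondeX N := by
  simp [vandermondeProd, map_prod, translateOne]

theorem translateOne_alternantDet (f : Fin N → ℝ[X]) :
    translateOne N (alternantDet f) = alternantDet fun i => taylor 1 (f i) := by
  rw [alternantDet, alternantDet, AlgHom.map_det]
  congr 1
  ext i j : 2
  simp only [AlgHom.mapMatrix_apply, Matrix.map_apply, Matrix.of_apply, ← aeval_algHom_apply,
    translateOne, MvPolynomial.aeval_X, taylor_apply, aeval_comp]
  simp

/-- If `Δ G` is the alternant of `f_1, …, f_N`, then `G(1, …, 1)` is a determinant of Taylor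
coefficients: after translation, the lowest homogeneous component of `Δ G` is `G(1, …, 1) Δ`. -/
theorem eval_one_of_vandermondeX_mul {f : Fin N → ℝ[X]} {G : MvPolynomial (Fin N) ℝ}
    (h : vandermondeX N * G = alternantDet f) :
    MvPolynomial.eval (fun _ => (1 : ℝ)) G =
      (Matrix.of fun i j : Fin N => (taylor 1 (f i)).coeff (N - 1 - (j : ℕ))).det := by
  classical
  have h1 := congrArg (translateOne N) h
  rw [map_mul, translateOne_vandermondeX, translateOne_alternantDet] at h1
  have h2 := congrArg (MvPolynomial.coeff (staircase N)) h1
  rw [coeff_alternantDet, MvPolynomial.coeff_mul] at h2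
  have hdeg : (staircase N).degree = ∑ i : Fin N, ∑ _j ∈ Finset.Ioi i, 1 := by
    by_contra hne
    have := isHomogeneous_vandermondeX.coeff_eq_zero hne
    rw [coeff_staircase_vandermondeX] at this
    exact one_ne_zero this
  rw [Finset.sum_eq_single (staircase N, 0)] at h2
  · rw [coeff_staircase_vandermondeX, one_mul] at h2
    have h3 : MvPolynomial.coeff 0 (translateOne N G) =
        MvPolynomial.eval (fun _ => (1 : ℝ)) G := by
      rw [← MvPolynomial.constantCoeff_eq]
      have : (MvPolynomial.constantCoeff.comp (translateOne N : MvPolynomial (Fin N) ℝ →+*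
          MvPolynomial (Fin N) ℝ)) = MvPolynomial.eval (fun _ => (1 : ℝ)) := by
        apply MvPolynomial.ringHom_ext <;> intros <;> simp [translateOne]
      rw [← this]
      rfl
    rw [← h3, h2]
    congr 1
  · rintro ⟨d, e⟩ hde hne
    rw [Finset.HasAntidiagonal.mem_antidiagonal] at hde
    simp only at hde ⊢
    by_cases hd : d.degree = ∑ i : Fin N, ∑ _j ∈ Finset.Ioi i, 1
    · exfalso
      apply hne
      have h4 : e.degree = 0 := by
        have := congrArg Finsupp.degree hde
        rw [map_add, hdeg, hd] at this
        omega
      rw [Finsupp.degree_eq_zero_iff] at h4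
      subst h4
      rw [add_zero] at hde
      rw [hde]
    · rw [isHomogeneous_vandermondeX.coeff_eq_zero hd, zero_mul]
  · intro h4
    simp at h4

/-- Expansion in a family of monic polynomials, one of each degree. -/
theorem exists_eq_sum_of_monic {R : Type*} [CommRing R] {Q : ℕ → R[X]}
    (hmonic : ∀ k, (Q k).Monic) (hdeg : ∀ k, (Q k).natDegree = k) (n : ℕ) :
    ∀ f : R[X], f.degree < n → ∃ d : ℕ → R, f = ∑ k ∈ Finset.range n, C (d k) * Q k ∧
      ∀ m, n = m + 1 → d m = f.coeff m := by
  induction n with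
  | zero =>
    intro f hf
    refine ⟨0, ?_, fun m hm => by omega⟩
    have : f = 0 := by
      rw [← degree_eq_bot]
      exact Nat.WithBot.lt_zero_iff.1 (by simpa using hf)
    simp [this]
  | succ n ih =>
    intro f hf
    have hlt : (f - C (f.coeff n) * Q n).degree < n := by
      rw [degree_lt_iff_coeff_zero]
      intro m hm
      rcases hm.eq_or_lt with rfl | hm
      · have h1 := hmonic n
        rw [Monic, leadingCoeff, hdeg] at h1
        simp [h1]
      · rw [coeff_sub, coeff_C_mul, coeff_eq_zero_of_degree_lt (p := f)
          (hf.trans_le (by exact_mod_cast hm)),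
          coeff_eq_zero_of_natDegree_lt (p := Q n) (by rw [hdeg]; exact hm)]
        simp
    obtain ⟨d, hd, -⟩ := ih _ hlt
    refine ⟨Function.update d n (f.coeff n), ?_, fun m hm => ?_⟩
    · rw [Finset.sum_range_succ, Function.update_self, Finset.sum_congr rfl (fun k hk => by
        rw [Function.update_of_ne (Finset.mem_range.1 hk).ne]), ← hd]
      ring
    · obtain rfl : n = m := by omega
      exact Function.update_self _ _ _

end Alternants

/-! ### Jacobi polynomials in hypergeometric form -/

section Jacobi

open Polynomial

/-- The monic polynomial with roots `ε², (1 + ε)², …, (k - 1 + ε)²`. -/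
noncomputable def quadFactorial (ε : ℝ) (k : ℕ) : ℝ[X] :=
  ∏ j ∈ Finset.range k, (X - C (((j : ℝ) + ε) ^ 2))

/-- The value of `quadFactorial ε k` at the point `(n + ε)²` of the quadratic lattice. -/
noncomputable def quadValue (ε : ℝ) (k n : ℕ) : ℝ := (quadFactorial ε k).eval (((n : ℝ) + ε) ^ 2)

theorem quadFactorial_monic (ε : ℝ) (k : ℕ) : (quadFactorial ε k).Monic :=
  monic_prod_of_monic _ _ fun _ _ => monic_X_sub_C _

theorem natDegree_quadFactorial (ε : ℝ) (k : ℕ) : (quadFactorial ε k).natDegree = k := by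
  rw [quadFactorial, natDegree_prod_of_monic _ _ fun _ _ => monic_X_sub_C _]
  simp only [natDegree_X_sub_C, Finset.sum_const, Finset.card_range, smul_eq_mul, mul_one]

@[simp]
theorem quadValue_zero (ε : ℝ) (n : ℕ) : quadValue ε 0 n = 1 := by simp [quadValue, quadFactorial]

theorem quadValue_succ (ε : ℝ) (k n : ℕ) :
    quadValue ε (k + 1) n = quadValue ε k n * (((n : ℝ) - k) * (n + k + 2 * ε)) := by
  simp only [quadValue, quadFactorial, Finset.prod_range_succ, eval_mul, eval_sub, eval_X, eval_C]
  ring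

theorem quadValue_eq_prod (ε : ℝ) (k n : ℕ) :
    quadValue ε k n = ∏ j ∈ Finset.range k, (((n : ℝ) - j) * (n + j + 2 * ε)) := by
  induction k with
  | zero => simp
  | succ k ih => rw [quadValue_succ, ih, Finset.prod_range_succ]

theorem quadValue_eq_zero (ε : ℝ) {k n : ℕ} (h : n < k) : quadValue ε k n = 0 := by
  rw [quadValue_eq_prod]
  exact Finset.prod_eq_zero (Finset.mem_range.2 h) (by simp)

theorem quadValue_self_pos {ε : ℝ} (hε : 0 ≤ ε) (n : ℕ) : 0 < quadValue ε n n := by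
  rw [quadValue_eq_prod]
  refine Finset.prod_pos fun j hj => ?_
  have h : (j : ℝ) < n := by exact_mod_cast Finset.mem_range.1 hj
  have h0 : (0 : ℝ) ≤ j := Nat.cast_nonneg j
  exact mul_pos (by linarith) (by linarith)

/-- The coefficients `1 / (2^k k! (a + 1)_k)`. -/
noncomputable def jacobiCoeff (a : ℝ) (k : ℕ) : ℝ :=
  ∏ j ∈ Finset.range k, (2 * ((j : ℝ) + 1) * (j + 1 + a))⁻¹

theorem jacobiCoeff_pos {a : ℝ} (ha : -1 / 2 ≤ a) (k : ℕ) : 0 < jacobiCoeff a k :=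
  Finset.prod_pos fun j _ => by
    have h0 : (0 : ℝ) ≤ j := Nat.cast_nonneg j
    have : 0 < (j : ℝ) + 1 + a := by linarith
    positivity

theorem jacobiCoeff_succ {a : ℝ} (ha : -1 / 2 ≤ a) (k : ℕ) :
    jacobiCoeff a (k + 1) * (2 * ((k : ℝ) + 1) * (k + 1 + a)) = jacobiCoeff a k := by
  rw [jacobiCoeff, Finset.prod_range_succ, mul_assoc, inv_mul_cancel₀, mul_one]; · rfl
  have h0 : (0 : ℝ) ≤ k := Nat.cast_nonneg k
  have : 0 < (k : ℝ) + 1 + a := by linarith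
  positivity

/-- The Jacobi polynomial with value `1` at `1`, as a polynomial in `x - 1`. -/
noncomputable def shiftedJacobi (a b : ℝ) (n : ℕ) : ℝ[X] :=
  ∑ k ∈ Finset.range (n + 1), C (jacobiCoeff a k * quadValue (epsParam a b) k n) * X ^ k

/-- The Jacobi polynomial with value `1` at `1`. -/
noncomputable def jacobiOne (a b : ℝ) (n : ℕ) : ℝ[X] := taylor (-1) (shiftedJacobi a b n)

variable {a b : ℝ}

theorem coeff_shiftedJacobi (n k : ℕ) :
    (shiftedJacobi a b n).coeff k = jacobiCoeff a k * quadValue (epsParam a b) k n := by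
  simp only [shiftedJacobi, finsetSum_coeff, coeff_C_mul, coeff_X_pow, mul_ite, mul_one, mul_zero,
    Finset.sum_ite_eq, Finset.mem_range]
  split_ifs with h
  · rfl
  · rw [quadValue_eq_zero _ (by omega), mul_zero]

theorem taylor_jacobiOne (n : ℕ) : taylor 1 (jacobiOne a b n) = shiftedJacobi a b n := by
  rw [jacobiOne, taylor_taylor]
  simp

theorem jacobiOne_eval (n : ℕ) (x : ℝ) :
    (jacobiOne a b n).eval x = (shiftedJacobi a b n).eval (x - 1) := by
  rw [jacobiOne, taylor_eval, sub_eq_add_neg]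

theorem epsParam_nonneg (ha : -1 / 2 ≤ a) (hb : -1 / 2 ≤ b) : 0 ≤ epsParam a b := by
  rw [epsParam]; linarith

theorem natDegree_shiftedJacobi (ha : -1 / 2 ≤ a) (hb : -1 / 2 ≤ b) (n : ℕ) :
    (shiftedJacobi a b n).natDegree = n := by
  refine natDegree_eq_of_le_of_coeff_ne_zero ?_ ?_
  · refine natDegree_sum_le_of_forall_le _ _ fun k hk => ?_
    exact (natDegree_C_mul_X_pow_le _ _).trans (by simpa [Nat.lt_succ_iff] using hk)
  · rw [coeff_shiftedJacobi]
    exact (mul_pos (jacobiCoeff_pos ha n) (quadValue_self_pos (epsParam_nonneg ha hb) n)).ne'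

/-- The Jacobi differential equation, in the variable `y = x - 1`. -/
theorem shiftedJacobi_ode (ha : -1 / 2 ≤ a) (n : ℕ) :
    (X ^ 2 + C 2 * X) * derivative (derivative (shiftedJacobi a b n)) +
      (C (2 * a + 2) + C (a + b + 2) * X) * derivative (shiftedJacobi a b n) =
    C ((n : ℝ) * (n + 2 * epsParam a b)) * shiftedJacobi a b n := by
  have hrec : ∀ k : ℕ, jacobiCoeff a (k + 1) * quadValue (epsParam a b) (k + 1) n *
      (2 * ((k : ℝ) + 1) * (k + 1 + a)) = jacobiCoeff a k * quadValue (epsParam a b) k n *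
        (((n : ℝ) - k) * (n + k + 2 * epsParam a b)) := by
    intro k
    rw [quadValue_succ, ← jacobiCoeff_succ ha k]
    ring
  have hε : a + b + 2 = 2 * epsParam a b + 1 := by rw [epsParam]; ring
  rw [hε]
  ext k
  simp only [add_mul, coeff_add, mul_assoc, coeff_C_mul]
  rcases k with _ | _ | k
  · have := hrec 0
    simp [coeff_derivative, coeff_shiftedJacobi] at this ⊢
    linarith
  · have := hrec 1
    simp [coeff_X_pow_mul', coeff_derivative, coeff_shiftedJacobi, coeff_X_mul] at this ⊢
    linarith
  · have := hrec (k + 2)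
    simp [coeff_X_pow_mul', coeff_derivative, coeff_shiftedJacobi, coeff_X_mul] at this ⊢
    linarith

/-! ### Orthogonality -/

theorem intervalIntegrable_jacobiWeight (ha : -1 / 2 ≤ a) (hb : -1 / 2 ≤ b) :
    IntervalIntegrable (fun x : ℝ => (1 - x) ^ a * (1 + x) ^ b) MeasureTheory.volume (-1) 1 := by
  have h1 : IntervalIntegrable (fun x : ℝ => (1 + x) ^ b) MeasureTheory.volume (-1) 0 := by
    have := (intervalIntegral.intervalIntegrable_rpow' (a := 0) (b := 1) (r := b)
      (by linarith)).comp_add_left 1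
    simpa using this
  have h2 : IntervalIntegrable (fun x : ℝ => (1 - x) ^ a) MeasureTheory.volume 0 1 := by
    have := ((intervalIntegral.intervalIntegrable_rpow' (a := 0) (b := 1) (r := a)
      (by linarith)).comp_sub_left 1).symm
    simpa using this
  refine IntervalIntegrable.trans (b := 0) ?_ ?_
  · refine h1.continuousOn_mul fun x hx => ContinuousAt.continuousWithinAt ?_
    rw [Set.uIcc_of_le (by norm_num)] at hx
    exact (continuousAt_const.sub continuousAt_id).rpow_const (Or.inl
      (show 1 - x ≠ 0 by have := hx.2; intro h; linarith))
  · refine h2.mul_continuousOn fun x hx => ContinuousAt.continuousWithinAt ?_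
    rw [Set.uIcc_of_le (by norm_num)] at hx
    exact (continuousAt_const.add continuousAt_id).rpow_const (Or.inl
      (show 1 + x ≠ 0 by have := hx.1; intro h; linarith))

theorem intervalIntegrable_jacobiInner (ha : -1 / 2 ≤ a) (hb : -1 / 2 ≤ b) (p q : ℝ[X]) :
    IntervalIntegrable (fun x : ℝ => p.eval x * q.eval x * ((1 - x) ^ a * (1 + x) ^ b))
      MeasureTheory.volume (-1) 1 :=
  (intervalIntegrable_jacobiWeight ha hb).continuousOn_mul
    (p.continuous.mul q.continuous).continuousOn

theorem jacobiInner_sum_left (ha : -1 / 2 ≤ a) (hb : -1 / 2 ≤ b) (s : Finset ℕ) (d : ℕ → ℝ)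
    (p : ℕ → ℝ[X]) (q : ℝ[X]) : jacobiInner a b (∑ k ∈ s, C (d k) * p k) q =
      ∑ k ∈ s, d k * jacobiInner a b (p k) q := by
  simp only [jacobiInner]
  have h : ∀ x : ℝ, (∑ k ∈ s, C (d k) * p k).eval x * q.eval x * ((1 - x) ^ a * (1 + x) ^ b) =
      ∑ k ∈ s, d k * ((p k).eval x * q.eval x * ((1 - x) ^ a * (1 + x) ^ b)) := by
    intro x
    rw [eval_finsetSum, Finset.sum_mul, Finset.sum_mul]
    exact Finset.sum_congr rfl fun k _ => by rw [eval_mul, eval_C]; ring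
  simp only [h]
  rw [intervalIntegral.integral_finsetSum fun k _ =>
    (intervalIntegrable_jacobiInner ha hb (p k) q).const_mul (d k)]
  simp only [intervalIntegral.integral_const_mul]

theorem jacobiInner_add_left (ha : -1 / 2 ≤ a) (hb : -1 / 2 ≤ b) (p p' q : ℝ[X]) :
    jacobiInner a b (p + p') q = jacobiInner a b p q + jacobiInner a b p' q := by
  have h := jacobiInner_sum_left ha hb (Finset.range 2) (fun _ => 1)
    (fun k => if k = 0 then p else p') q
  simpa [Finset.sum_range_succ] using h

theorem jacobiInner_C_mul_left (c : ℝ) (p q : ℝ[X]) :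
    jacobiInner a b (C c * p) q = c * jacobiInner a b p q := by
  simp only [jacobiInner, eval_mul, eval_C, mul_assoc, intervalIntegral.integral_const_mul]

theorem jacobiInner_comm (p q : ℝ[X]) : jacobiInner a b p q = jacobiInner a b q p := by
  simp only [jacobiInner, mul_comm (p.eval _)]

theorem jacobiInner_self_pos (ha : -1 / 2 ≤ a) (hb : -1 / 2 ≤ b) {p : ℝ[X]} (hp : p ≠ 0) :
    0 < jacobiInner a b p p := by
  have hw : ∀ x ∈ Set.Ioo (-1 : ℝ) 1, 0 < (1 - x) ^ a * (1 + x) ^ b := fun x hx =>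
    mul_pos (Real.rpow_pos_of_pos (by linarith [hx.2]) _)
      (Real.rpow_pos_of_pos (by linarith [hx.1]) _)
  rw [jacobiInner, intervalIntegral.integral_pos_iff_support_of_nonneg_ae' _
    (intervalIntegrable_jacobiInner ha hb p p)]
  · refine ⟨by norm_num, ?_⟩
    have hsub : Set.Ioo (-1 : ℝ) 1 \ (p.rootSet ℝ) ⊆
        (Function.support fun x => p.eval x * p.eval x * ((1 - x) ^ a * (1 + x) ^ b)) ∩
          Set.Ioc (-1) 1 := by
      rintro x ⟨hx, hroot⟩
      have h1 : p.eval x ≠ 0 := fun h => hroot (by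
        rw [mem_rootSet_of_ne hp]; simpa using h)
      exact ⟨mul_ne_zero (mul_ne_zero h1 h1) (hw x hx).ne', hx.1, hx.2.le⟩
    refine lt_of_lt_of_le ?_ (MeasureTheory.measure_mono hsub)
    rw [MeasureTheory.measure_sdiff_null ((p.rootSet_finite ℝ).measure_zero _), Real.volume_Ioo]
    norm_num
  · rw [Set.uIoc_of_le (by norm_num), Filter.EventuallyLE]
    refine (MeasureTheory.ae_restrict_iff' measurableSet_Ioc).2
      (MeasureTheory.ae_of_all _ fun x hx => ?_)
    exact mul_nonneg (mul_self_nonneg _) (mul_nonneg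
      (Real.rpow_nonneg (by linarith [hx.2]) _) (Real.rpow_nonneg (by linarith [hx.1]) _))

/-- The Jacobi operator is symmetric, so that eigenfunctions with different eigenvalues are
orthogonal. -/
theorem jacobiInner_jacobiOne (ha : -1 / 2 ≤ a) (hb : -1 / 2 ≤ b) {n m : ℕ} (hnm : n ≠ m) :
    jacobiInner a b (jacobiOne a b n) (jacobiOne a b m) = 0 := by
  set ε := epsParam a b with hε
  have hε0 : 0 ≤ ε := epsParam_nonneg ha hb
  set f := shiftedJacobi a b n with hf
  set g := shiftedJacobi a b m with hg
  have hode := fun (k : ℕ) (y : ℝ) => congrArg (eval y) (shiftedJacobi_ode (b := b) ha k)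
  simp only [eval_add, eval_mul, eval_pow, eval_X, eval_C] at hode
  -- the Wronskian of the two polynomials, multiplied by `(1 - x)^(a+1) (1 + x)^(b+1)`
  let W : ℝ → ℝ := fun x => (derivative f).eval (x - 1) * g.eval (x - 1) -
    f.eval (x - 1) * (derivative g).eval (x - 1)
  let F : ℝ → ℝ := fun x => (1 - x) ^ (a + 1) * (1 + x) ^ (b + 1) * W x
  have hcomp : ∀ (p : ℝ[X]) (x : ℝ),
      HasDerivAt (fun x => p.eval (x - 1)) ((derivative p).eval (x - 1)) x := fun p x => by
    simpa using (p.hasDerivAt (x - 1)).comp_sub_const x 1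
  have hFc : Continuous F := by
    refine Continuous.mul (Continuous.mul ?_ ?_) ?_
    · exact (continuous_const.sub continuous_id).rpow_const fun x => Or.inr (by linarith)
    · exact (continuous_const.add continuous_id).rpow_const fun x => Or.inr (by linarith)
    · have := fun p : ℝ[X] =>
        p.continuous.comp (continuous_id.sub (continuous_const (y := (1 : ℝ))))
      exact ((this _).mul (this _)).sub ((this _).mul (this _))
  have hF : ∀ x ∈ Set.Ioo (-1 : ℝ) 1, HasDerivAt F
      (((m : ℝ) * (m + 2 * ε) - n * (n + 2 * ε)) *
        ((jacobiOne a b n).eval x * (jacobiOne a b m).eval x *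
          ((1 - x) ^ a * (1 + x) ^ b))) x := by
    intro x hx
    have h1 : 0 < 1 - x := by linarith [hx.2]
    have h2 : 0 < 1 + x := by linarith [hx.1]
    have d1 : HasDerivAt (fun x : ℝ => (1 - x) ^ (a + 1)) ((-1 + -a) * (1 - x) ^ a) x := by
      have := ((hasDerivAt_id x).const_sub 1).rpow_const (p := a + 1) (Or.inl h1.ne')
      simpa using this
    have d2 : HasDerivAt (fun x : ℝ => (1 + x) ^ (b + 1)) ((b + 1) * (1 + x) ^ b) x := by
      have := ((hasDerivAt_id x).const_add 1).rpow_const (p := b + 1) (Or.inl h2.ne')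
      simpa using this
    have d3 := ((hcomp (derivative f) x).mul (hcomp g x)).sub
      ((hcomp f x).mul (hcomp (derivative g) x))
    refine ((d1.mul d2).mul d3).congr_deriv ?_
    have e1 : (1 - x) ^ (a + 1) = (1 - x) ^ a * (1 - x) := Real.rpow_add_one h1.ne' a
    have e2 : (1 + x) ^ (b + 1) = (1 + x) ^ b * (1 + x) := Real.rpow_add_one h2.ne' b
    have o1 := hode n (x - 1)
    have o2 := hode m (x - 1)
    rw [jacobiOne_eval, jacobiOne_eval]
    simp only [Pi.mul_apply, Pi.sub_apply, e1, e2]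
    rw [← hf] at o1 ⊢
    rw [← hg] at o2 ⊢
    linear_combination ((1 - x) ^ a * (1 + x) ^ b) * (f.eval (x - 1) * o2 - g.eval (x - 1) * o1)
  have hint := intervalIntegral.integral_eq_sub_of_hasDerivAt_of_le (by norm_num : (-1 : ℝ) ≤ 1)
    hFc.continuousOn hF ((intervalIntegrable_jacobiInner ha hb _ _).const_mul _)
  rw [intervalIntegral.integral_const_mul] at hint
  have hF1 : F 1 = 0 := by
    simp only [F]
    rw [sub_self, Real.zero_rpow (by linarith), zero_mul, zero_mul]
  have hF2 : F (-1) = 0 := by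
    simp only [F]
    rw [add_neg_cancel, Real.zero_rpow (by linarith), mul_zero, zero_mul]
  rw [hF1, hF2, sub_zero] at hint
  refine (mul_eq_zero.1 hint).resolve_left ?_
  have h3 : (m : ℝ) * (m + 2 * ε) - n * (n + 2 * ε) = (m - n) * (m + n + 2 * ε) := by ring
  rw [h3]
  refine mul_ne_zero (sub_ne_zero.2 (by exact_mod_cast hnm.symm)) ?_
  have h4 : 0 < (m : ℝ) + n := by
    have : 0 < m + n := by omega
    exact_mod_cast this
  linarith

/-- The leading coefficient of `jacobiOne a b n`. -/
noncomputable def jacobiLead (a b : ℝ) (n : ℕ) : ℝ :=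
  jacobiCoeff a n * quadValue (epsParam a b) n n

theorem jacobiLead_pos (ha : -1 / 2 ≤ a) (hb : -1 / 2 ≤ b) (n : ℕ) : 0 < jacobiLead a b n :=
  mul_pos (jacobiCoeff_pos ha n) (quadValue_self_pos (epsParam_nonneg ha hb) n)

theorem leadingCoeff_jacobiOne (ha : -1 / 2 ≤ a) (hb : -1 / 2 ≤ b) (n : ℕ) :
    (jacobiOne a b n).leadingCoeff = jacobiLead a b n := by
  rw [jacobiOne, leadingCoeff_taylor, leadingCoeff, natDegree_shiftedJacobi ha hb,
    coeff_shiftedJacobi, jacobiLead]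

theorem natDegree_jacobiOne (ha : -1 / 2 ≤ a) (hb : -1 / 2 ≤ b) (n : ℕ) :
    (jacobiOne a b n).natDegree = n := by
  rw [jacobiOne, natDegree_taylor, natDegree_shiftedJacobi ha hb]

theorem monic_C_mul_jacobiOne (ha : -1 / 2 ≤ a) (hb : -1 / 2 ≤ b) (n : ℕ) :
    (C (jacobiLead a b n)⁻¹ * jacobiOne a b n).Monic := by
  rw [Monic, leadingCoeff_mul, leadingCoeff_C, leadingCoeff_jacobiOne ha hb,
    inv_mul_cancel₀ (jacobiLead_pos ha hb n).ne']

theorem jacobiPoly_eq (ha : -1 / 2 ≤ a) (hb : -1 / 2 ≤ b) (n : ℕ) :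
    jacobiPoly a b n = C (jacobiLead a b n)⁻¹ * jacobiOne a b n := by
  set Q : ℕ → ℝ[X] := fun n => C (jacobiLead a b n)⁻¹ * jacobiOne a b n with hQ
  have hmonic : ∀ k, (Q k).Monic := monic_C_mul_jacobiOne ha hb
  have hdeg : ∀ k, (Q k).natDegree = k := fun k => by
    rw [hQ, natDegree_C_mul (inv_ne_zero (jacobiLead_pos ha hb k).ne'), natDegree_jacobiOne ha hb]
  have horth : ∀ k m, k ≠ m → jacobiInner a b (Q k) (Q m) = 0 := fun k m hkm => by
    simp only [hQ]
    rw [jacobiInner_C_mul_left, jacobiInner_comm, jacobiInner_C_mul_left,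
      jacobiInner_jacobiOne ha hb hkm.symm]
    simp
  change jacobiPoly a b n = Q n
  induction n using Nat.strong_induction_on with
  | _ n ih =>
    have hlt : (X ^ n - Q n).degree < (n : WithBot ℕ) := by
      have := degree_sub_lt_left (p := (X : ℝ[X]) ^ n) (q := Q n)
        (by rw [degree_X_pow, degree_eq_natDegree (hmonic n).ne_zero, hdeg])
        (monic_X_pow n).ne_zero (by rw [(monic_X_pow n).leadingCoeff, (hmonic n).leadingCoeff])
      rwa [degree_X_pow] at this
    obtain ⟨d, hd, -⟩ := exists_eq_sum_of_monic hmonic hdeg n _ hlt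
    have hX : (X : ℝ[X]) ^ n = Q n + ∑ k ∈ Finset.range n, C (d k) * Q k := by
      rw [← hd]; ring
    have hd' : ∀ k < n, jacobiInner a b (X ^ n) (Q k) / jacobiInner a b (Q k) (Q k) = d k := by
      intro k hk
      rw [hX, jacobiInner_add_left ha hb, horth n k hk.ne', zero_add, jacobiInner_sum_left ha hb,
        Finset.sum_eq_single k]
      · exact mul_div_cancel_right₀ _ (jacobiInner_self_pos ha hb (hmonic k).ne_zero).ne'
      · intro m _ hm
        rw [horth m k hm, mul_zero]
      · intro h
        exact absurd (Finset.mem_range.2 hk) h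
    rw [jacobiPoly]
    have hsum : ∀ k : Fin n, C (jacobiInner a b (X ^ n) (jacobiPoly a b k) /
        jacobiInner a b (jacobiPoly a b k) (jacobiPoly a b k)) * jacobiPoly a b k =
        C (d k) * Q k := fun k => by rw [ih k k.2, hd' k k.2]
    rw [Finset.sum_congr rfl fun k _ => hsum k, Fin.sum_univ_eq_sum_range fun k => C (d k) * Q k,
      ← hd]
    ring

end Jacobi

/-! ### Birth-and-death rates on the quadratic lattice -/

section Rates

variable {a b : ℝ}

/-- The coefficient of `φ_{n+1} - φ_n` in the three-term recurrence of the Jacobi polynomials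
`φ_n` with value `1` at `1`. -/
noncomputable def jacobiUp (a b : ℝ) (n : ℕ) : ℝ :=
  (if n = 0 then 1 else ((n : ℝ) + 2 * epsParam a b) / (2 * ((n : ℝ) + epsParam a b))) *
    ((n : ℝ) + a + 1) / (2 * (n : ℝ) + 2 * epsParam a b + 1)

/-- The coefficient of `φ_{n-1} - φ_n` in the three-term recurrence. -/
noncomputable def jacobiDown (a b : ℝ) (n : ℕ) : ℝ :=
  if n = 0 then 0 else
    (n : ℝ) * ((n : ℝ) + b) /
      (2 * ((n : ℝ) + epsParam a b) * (2 * (n : ℝ) + 2 * epsParam a b - 1))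

theorem jacobiUp_pos (ha : -1 / 2 ≤ a) (hb : -1 / 2 ≤ b) (n : ℕ) : 0 < jacobiUp a b n := by
  have hε := epsParam_nonneg ha hb
  have hn : (0 : ℝ) ≤ n := Nat.cast_nonneg n
  rw [jacobiUp]
  refine div_pos (mul_pos ?_ (by linarith)) (by positivity)
  split_ifs with h
  · exact one_pos
  · have : (0 : ℝ) < n := by exact_mod_cast Nat.pos_of_ne_zero h
    positivity

theorem jacobiDown_succ_pos (ha : -1 / 2 ≤ a) (hb : -1 / 2 ≤ b) (n : ℕ) :
    0 < jacobiDown a b (n + 1) := by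
  have hε := epsParam_nonneg ha hb
  have hn : (0 : ℝ) ≤ n := Nat.cast_nonneg n
  rw [jacobiDown, if_neg (Nat.succ_ne_zero n)]
  push_cast
  refine div_pos (mul_pos (by positivity) (by linarith)) (mul_pos (by positivity) (by linarith))

theorem quadValue_succ_succ (ε : ℝ) (k n : ℕ) : quadValue ε (k + 1) (n + 1) * (n + 2 * ε) =
    quadValue ε k n * ((n + 1) * (n + k + 2 * ε) * (n + k + 1 + 2 * ε)) := by
  induction k with
  | zero => simp [quadValue_succ]; ring
  | succ k ih =>
    rw [quadValue_succ ε (k + 1) (n + 1), quadValue_succ ε k n]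
    push_cast at ih ⊢
    linear_combination ((n : ℝ) - k) * (n + k + 2 + 2 * ε) * ih

theorem quadValue_succ_pred (ε : ℝ) (k n : ℕ) : quadValue ε (k + 1) n * (n + 1) =
    quadValue ε k (n + 1) * ((n + 1 - k) * (n - k) * (n + 2 * ε)) := by
  induction k with
  | zero => simp [quadValue_succ]; ring
  | succ k ih =>
    rw [quadValue_succ ε (k + 1) n, quadValue_succ ε k (n + 1)]
    push_cast at ih ⊢
    linear_combination ((n : ℝ) - k - 1) * (n + k + 1 + 2 * ε) * ih

/-- The action of a birth-and-death generator with rates `jacobiUp n * g(n)` and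
`jacobiDown n * g(-n - 2ε)`, `g(x) = p x² - σ x + τ`, on the polynomials `quadFactorial`. The case
`p = σ = 0` is the three-term recurrence of the Jacobi polynomials. -/
theorem jacobi_generator_quadValue (ha : -1 / 2 ≤ a) (hb : -1 / 2 ≤ b) (p σ τ : ℝ) (k n : ℕ) :
    jacobiUp a b n * (p * n ^ 2 - σ * n + τ) *
        (quadValue (epsParam a b) (k + 1) (n + 1) - quadValue (epsParam a b) (k + 1) n) +
      jacobiDown a b n * (p * (n + 2 * epsParam a b) ^ 2 + σ * (n + 2 * epsParam a b) + τ) *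
        (quadValue (epsParam a b) (k + 1) (n - 1) - quadValue (epsParam a b) (k + 1) n) =
    (k + 1) * (p * (k - b) - σ) * quadValue (epsParam a b) (k + 1) n +
      (k + 1) * (k + 1 + a) * (p * k ^ 2 - σ * k + τ) * quadValue (epsParam a b) k n := by
  have hε := epsParam_nonneg ha hb
  set ε := epsParam a b with hεd
  have hb' : b = 2 * ε - 1 - a := by rw [hεd, epsParam]; ring
  rcases n with _ | n
  · rcases k with _ | k
    · have : 2 * ε + 1 ≠ 0 := by positivity
      simp only [jacobiUp, jacobiDown, quadValue_succ, quadValue_zero, ← hεd]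
      simp
      field_simp
      ring
    · rw [quadValue_eq_zero ε (show 0 < k + 1 + 1 by omega),
        quadValue_eq_zero ε (show 0 + 1 < k + 1 + 1 by omega),
        quadValue_eq_zero ε (show 0 < k + 1 by omega)]
      simp [jacobiDown]
  · have hn : (0 : ℝ) ≤ n := Nat.cast_nonneg n
    have h1 := quadValue_succ_succ ε k (n + 1)
    have h2 := quadValue_succ_pred ε k n
    have h3 := quadValue_succ ε k (n + 1)
    have d3 : 2 * ((n : ℝ) + 1) + 2 * ε - 1 ≠ 0 := by
      have : 0 < 2 * ((n : ℝ) + 1) + 2 * ε - 1 := by linarith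
      exact this.ne'
    push_cast at h1 h2 h3
    -- the increments of `quadFactorial` cancel the linear factors of the rates
    have e1 : jacobiUp a b (n + 1) * (quadValue ε (k + 1) (n + 1 + 1) -
        quadValue ε (k + 1) (n + 1)) = quadValue ε k (n + 1) * ((k + 1) * (n + 1 + a + 1) *
          (n + 1 + k + 2 * ε) / (2 * (n + 1 + ε))) := by
      simp only [jacobiUp, if_neg (Nat.succ_ne_zero n), ← hεd]
      push_cast
      have e0 : ((n : ℝ) + 1 + 2 * ε) / (2 * (n + 1 + ε)) * (n + 1 + a + 1) /
          (2 * (n + 1) + 2 * ε + 1) = (n + 1 + 2 * ε) * (n + 1 + a + 1) /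
            (2 * (n + 1 + ε) * (2 * (n + 1) + 2 * ε + 1)) := by
        rw [div_mul_eq_mul_div, div_div]
      rw [e0, div_mul_eq_mul_div, ← mul_div_assoc,
        div_eq_div_iff (by positivity) (by positivity)]
      linear_combination (2 * (n + 1 + ε) * (n + 1 + a + 1)) * h1 -
        (n + 1 + 2 * ε) * (n + 1 + a + 1) * (2 * (n + 1 + ε)) * h3
    have e2 : jacobiDown a b (n + 1) * (quadValue ε (k + 1) n -
        quadValue ε (k + 1) (n + 1)) = -(quadValue ε k (n + 1) * ((k + 1) * (n + 1 + b) *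
          (n + 1 - k) / (2 * (n + 1 + ε)))) := by
      simp only [jacobiDown, if_neg (Nat.succ_ne_zero n), ← hεd]
      push_cast
      rw [div_mul_eq_mul_div, ← mul_div_assoc, ← neg_div,
        div_eq_div_iff (mul_ne_zero (by positivity) d3) (by positivity)]
      linear_combination (2 * (n + 1 + ε) * (n + 1 + b)) * h2 -
        (n + 1 : ℝ) * (n + 1 + b) * (2 * (n + 1 + ε)) * h3
    have d4 : 2 * ((n : ℝ) + 1 + ε) ≠ 0 := by positivity
    have e3 : ∀ y : ℝ, y / (2 * ((n : ℝ) + 1 + ε)) * (2 * (n + 1 + ε)) = y := fun y =>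
      div_mul_cancel₀ y d4
    set q := quadValue ε k (n + 1)
    set g := p * (n + 1) ^ 2 - σ * (n + 1) + τ with hg
    set g' := p * (n + 1 + 2 * ε) ^ 2 + σ * (n + 1 + 2 * ε) + τ with hg'
    have e4 : g * (q * ((k + 1) * (n + 1 + a + 1) * (n + 1 + k + 2 * ε) / (2 * (n + 1 + ε)))) -
        g' * (q * ((k + 1) * (n + 1 + b) * (n + 1 - k) / (2 * (n + 1 + ε)))) =
        (k + 1) * (p * (k - b) - σ) * (q * ((n + 1 - k) * (n + 1 + k + 2 * ε))) +
          (k + 1) * (k + 1 + a) * (p * k ^ 2 - σ * k + τ) * q := by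
      refine mul_right_cancel₀ d4 ?_
      rw [sub_mul, mul_assoc g, mul_assoc q, e3, mul_assoc g', mul_assoc q, e3, hg, hg']
      clear_value q ε
      subst hb'
      ring
    rw [Nat.add_sub_cancel]
    push_cast
    rw [← hg, ← hg']
    linear_combination g * e1 + g' * e2 + e4 - (k + 1) * (p * (k - b) - σ) * h3

/-- The weights that symmetrize the birth-and-death process with rates `jacobiUp`, `jacobiDown`;
up to a constant factor they are the inverse squared norms of the Jacobi polynomials. -/
noncomputable def jacobiWeight (a b : ℝ) (n : ℕ) : ℝ :=
  ∏ j ∈ Finset.range n, jacobiUp a b j / jacobiDown a b (j + 1)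

theorem jacobiWeight_pos (ha : -1 / 2 ≤ a) (hb : -1 / 2 ≤ b) (n : ℕ) : 0 < jacobiWeight a b n :=
  Finset.prod_pos fun j _ => div_pos (jacobiUp_pos ha hb j) (jacobiDown_succ_pos ha hb j)

theorem jacobiWeight_succ (ha : -1 / 2 ≤ a) (hb : -1 / 2 ≤ b) (n : ℕ) :
    jacobiWeight a b (n + 1) * jacobiDown a b (n + 1) = jacobiWeight a b n * jacobiUp a b n := by
  rw [jacobiWeight, Finset.prod_range_succ, mul_assoc,
    div_mul_cancel₀ _ (jacobiDown_succ_pos ha hb n).ne', jacobiWeight]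

/-- The Christoffel-Darboux formula at the point `1`, for the coefficients of the Jacobi
polynomials: a summation of the three-term recurrence. -/
theorem jacobi_christoffel_darboux (ha : -1 / 2 ≤ a) (hb : -1 / 2 ≤ b) (k n : ℕ) :
    jacobiWeight a b n * jacobiUp a b n *
        (quadValue (epsParam a b) (k + 1) (n + 1) - quadValue (epsParam a b) (k + 1) n) =
      (k + 1) * (k + 1 + a) *
        ∑ m ∈ Finset.range (n + 1), jacobiWeight a b m * quadValue (epsParam a b) k m := by
  have h3 := fun n => jacobi_generator_quadValue ha hb 0 0 1 k n
  simp only [zero_mul, sub_zero, zero_add, mul_one, mul_zero] at h3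
  induction n with
  | zero =>
    have := h3 0
    simp only [jacobiDown, if_true, zero_mul, add_zero] at this
    simp only [jacobiWeight, Finset.range_zero, Finset.prod_empty, zero_add, Finset.sum_range_one,
      one_mul] at this ⊢
    exact this
  | succ n ih =>
    have h4 := h3 (n + 1)
    have h5 := jacobiWeight_succ ha hb n
    rw [Finset.sum_range_succ, mul_add, ← ih]
    rw [Nat.add_sub_cancel] at h4
    linear_combination jacobiWeight a b (n + 1) * h4 +
      (quadValue (epsParam a b) (k + 1) (n + 1) - quadValue (epsParam a b) (k + 1) n) * h5

/-- The coefficients of `(φ_l - φ_{l'}) / (x - 1)`, `l' ≤ l`, in the Jacobi polynomials `φ_m`. -/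
noncomputable def linkEntry (a b : ℝ) (l l' m : ℕ) : ℝ :=
  ∑ n ∈ Finset.Ico l' l, (2 * jacobiWeight a b n * jacobiUp a b n)⁻¹ *
    (jacobiWeight a b m * if m ≤ n then 1 else 0)

theorem quadValue_sub_eq_sum_linkEntry (ha : -1 / 2 ≤ a) (hb : -1 / 2 ≤ b) (k : ℕ) {l l' M : ℕ}
    (hl : l' ≤ l) (hM : l ≤ M) :
    quadValue (epsParam a b) (k + 1) l - quadValue (epsParam a b) (k + 1) l' =
      2 * ((k : ℝ) + 1) * (k + 1 + a) *
        ∑ m ∈ Finset.range M, linkEntry a b l l' m * quadValue (epsParam a b) k m := by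
  rw [← Finset.sum_Ico_sub (fun n => quadValue (epsParam a b) (k + 1) n) hl]
  simp only [linkEntry, Finset.sum_mul]
  rw [Finset.sum_comm, Finset.mul_sum]
  refine Finset.sum_congr rfl fun n hn => ?_
  have hn' := Finset.mem_Ico.1 hn
  have h1 := jacobi_christoffel_darboux ha hb k n
  have hw := (jacobiWeight_pos ha hb n).ne'
  have hu := (jacobiUp_pos ha hb n).ne'
  have h2 : ∑ m ∈ Finset.range M, (2 * jacobiWeight a b n * jacobiUp a b n)⁻¹ *
      (jacobiWeight a b m * if m ≤ n then 1 else 0) * quadValue (epsParam a b) k m =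
      (2 * jacobiWeight a b n * jacobiUp a b n)⁻¹ *
        ∑ m ∈ Finset.range (n + 1), jacobiWeight a b m * quadValue (epsParam a b) k m := by
    rw [Finset.mul_sum]
    symm
    rw [← Finset.sum_subset (Finset.range_subset_range.2 (show n + 1 ≤ M by omega))]
    · refine Finset.sum_congr rfl fun m hm => ?_
      rw [if_pos (Nat.lt_succ_iff.1 (Finset.mem_range.1 hm))]
      ring
    · intro m _ hm
      rw [Finset.mem_range] at hm
      rw [if_neg (by omega)]
      ring
  rw [h2]
  field_simp
  linarith

theorem jacobiOne_sub_eq_sum_linkEntry (ha : -1 / 2 ≤ a) (hb : -1 / 2 ≤ b) {l l' M : ℕ}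
    (hl : l' ≤ l) (hM : l ≤ M) :
    jacobiOne a b l - jacobiOne a b l' = (Polynomial.X - 1) *
      ∑ m ∈ Finset.range M, Polynomial.C (linkEntry a b l l' m) * jacobiOne a b m := by
  have h : shiftedJacobi a b l - shiftedJacobi a b l' = Polynomial.X *
      ∑ m ∈ Finset.range M, Polynomial.C (linkEntry a b l l' m) * shiftedJacobi a b m := by
    ext k
    rcases k with _ | k
    · simp [coeff_shiftedJacobi]
    · rw [Polynomial.coeff_X_mul, Polynomial.coeff_sub, Polynomial.finsetSum_coeff]
      simp only [Polynomial.coeff_C_mul, coeff_shiftedJacobi]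
      have h1 := quadValue_sub_eq_sum_linkEntry ha hb k hl hM
      have h2 := jacobiCoeff_succ ha k
      have h3 : ∑ m ∈ Finset.range M, linkEntry a b l l' m *
          (jacobiCoeff a k * quadValue (epsParam a b) k m) = jacobiCoeff a k *
          ∑ m ∈ Finset.range M, linkEntry a b l l' m * quadValue (epsParam a b) k m := by
        rw [Finset.mul_sum]
        exact Finset.sum_congr rfl fun m _ => by ring
      rw [h3, ← h2, ← mul_sub, h1]
      ring
  have h1 := congrArg (Polynomial.taylor (-1)) h
  simp only [map_sub, Polynomial.taylor_mul, map_sum, Polynomial.taylor_X, Polynomial.taylor_C]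
    at h1
  simpa [jacobiOne, sub_eq_add_neg] using h1

theorem jacobiOne_eval_one (n : ℕ) : (jacobiOne a b n).eval 1 = 1 := by
  rw [jacobiOne_eval, sub_self, ← Polynomial.coeff_zero_eq_eval_zero, coeff_shiftedJacobi]
  simp [jacobiCoeff]

/-- The determinants of `linkEntry` are nonnegative: row expansion reduces them to determinants of
indicators. -/
theorem det_linkEntry_nonneg (ha : -1 / 2 ≤ a) (hb : -1 / 2 ≤ b) {N : ℕ}
    (lam : PosSignature (N + 1)) (mu : PosSignature N) :
    0 ≤ (Matrix.of fun i j : Fin N => linkEntry a b (lam.shifted i.castSucc)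
      (lam.shifted i.succ) (mu.shifted j)).det := by
  have h1 := det_sum_rows (N := N)
    (fun i => Finset.Ico (lam.shifted i.succ) (lam.shifted i.castSucc))
    (fun _ n => (2 * jacobiWeight a b n * jacobiUp a b n)⁻¹)
    (fun n j => jacobiWeight a b (mu.shifted j) * if mu.shifted j ≤ n then 1 else 0)
  simp only [linkEntry]
  rw [h1]
  refine Finset.sum_nonneg fun f hf => mul_nonneg (Finset.prod_nonneg fun i _ => ?_) ?_
  · have := jacobiWeight_pos ha hb (f i)
    have := jacobiUp_pos ha hb (f i)
    positivity
  · have h2 := Matrix.det_mul_row (fun j => jacobiWeight a b (mu.shifted j))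
      (Matrix.of fun i j : Fin N => if mu.shifted j ≤ f i then (1 : ℝ) else 0)
    simp only [Matrix.of_apply] at h2
    rw [h2]
    refine mul_nonneg (Finset.prod_nonneg fun j _ => (jacobiWeight_pos ha hb _).le)
      (det_indicator_nonneg (fun i j hij => ?_) mu.shifted_strictAnti.antitone)
    simp only [Fintype.mem_piFinset, Finset.mem_Ico] at hf
    rcases hij.eq_or_lt with rfl | hlt
    · exact le_rfl
    · have h3 : i.succ ≤ j.castSucc := by
        rw [Fin.le_def]
        simpa using hlt
      have h4 := lam.shifted_strictAnti.antitone h3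
      exact ((hf j).2.le.trans h4).trans (hf i).1

end Rates

/-! ### Normalized multivariate Jacobi polynomials -/

section Links

open Polynomial

variable {a b : ℝ} {N : ℕ}

theorem PosSignature.hat_strictAnti (ha : -1 / 2 ≤ a) (hb : -1 / 2 ≤ b) (lam : PosSignature N) :
    StrictAnti (lam.hat a b) := by
  intro i j hij
  have hε := epsParam_nonneg ha hb
  have h1 : (lam.shifted j : ℝ) < lam.shifted i := by
    exact_mod_cast lam.shifted_strictAnti hij
  have h2 : (0 : ℝ) ≤ lam.shifted j := Nat.cast_nonneg _
  simp only [PosSignature.hat]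
  exact pow_lt_pow_left₀ (by linarith) (by linarith) two_ne_zero

theorem vandermondeProd_hat_pos (ha : -1 / 2 ≤ a) (hb : -1 / 2 ≤ b) (lam : PosSignature N) :
    0 < vandermondeProd (lam.hat a b) :=
  Finset.prod_pos fun _ _ => Finset.prod_pos fun _ hj =>
    sub_pos.2 (lam.hat_strictAnti ha hb (Finset.mem_Ioi.1 hj))

/-- The product `c_0 ⋯ c_{N-1}` of the coefficients `jacobiCoeff`. -/
noncomputable def jacobiCoeffProd (a : ℝ) (N : ℕ) : ℝ :=
  ∏ j : Fin N, jacobiCoeff a (N - 1 - (j : ℕ))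

theorem jacobiCoeffProd_pos (ha : -1 / 2 ≤ a) : 0 < jacobiCoeffProd a N :=
  Finset.prod_pos fun _ _ => jacobiCoeff_pos ha _

theorem jacobiCoeffProd_succ :
    jacobiCoeffProd a (N + 1) = jacobiCoeff a N * jacobiCoeffProd a N := by
  rw [jacobiCoeffProd, Fin.prod_univ_succ, jacobiCoeffProd]
  congr 1
  refine Finset.prod_congr rfl fun j _ => ?_
  congr 1
  simp only [Fin.val_succ]
  omega

/-- Multivariate analogues of the polynomials `quadFactorial`, evaluated at a signature:
`det [quadFactorial_{k_j}(l_i)] / Δ(l)` on the quadratic lattice. The normalized Jacobi polynomials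
are generating functions of these quantities. -/
noncomputable def multiQuad (a b : ℝ) (k : Fin N → ℕ) (lam : PosSignature N) : ℝ :=
  (Matrix.of fun i j => quadValue (epsParam a b) (k j) (lam.shifted i)).det /
    vandermondeProd (lam.hat a b)

theorem multiQuad_staircase (ha : -1 / 2 ≤ a) (hb : -1 / 2 ≤ b) (lam : PosSignature N) :
    multiQuad a b (fun j => N - 1 - (j : ℕ)) lam = 1 := by
  have h := vandermondeProd_eq_det_eval (lam.hat a b) (quadFactorial (epsParam a b))
    (natDegree_quadFactorial _) (quadFactorial_monic _)
  rw [multiQuad, ← h]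
  exact div_self fun h0 => (vandermondeProd_hat_pos ha hb lam).ne' (h.symm.trans h0)

theorem alternantDet_C_mul (c : Fin N → ℝ) (f : Fin N → ℝ[X]) :
    alternantDet (fun i => C (c i) * f i) = MvPolynomial.C (∏ i, c i) * alternantDet f := by
  have h := Matrix.det_mul_column (fun i => MvPolynomial.C (σ := Fin N) (c i))
    (Matrix.of fun i j : Fin N => aeval (MvPolynomial.X j : MvPolynomial (Fin N) ℝ) (f i))
  rw [map_prod, alternantDet, alternantDet, ← h]
  congr 1
  ext i j : 2
  simp [MvPolynomial.algebraMap_eq]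

theorem coeff_translateOne_alternantDet_jacobiOne (lam : PosSignature N) (k : Fin N →₀ ℕ) :
    MvPolynomial.coeff k (translateOne N (alternantDet fun i => jacobiOne a b (lam.shifted i))) =
      (∏ j, jacobiCoeff a (k j)) *
        (Matrix.of fun i j => quadValue (epsParam a b) (k j) (lam.shifted i)).det := by
  rw [translateOne_alternantDet, coeff_alternantDet, ← Matrix.det_mul_row]
  simp only [taylor_jacobiOne, coeff_shiftedJacobi]
  rfl

theorem vandermondeX_mul_multiJacobi (ha : -1 / 2 ≤ a) (hb : -1 / 2 ≤ b) (lam : PosSignature N) :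
    vandermondeX N * multiJacobi a b lam =
      alternantDet fun i => C (jacobiLead a b (lam.shifted i))⁻¹ *
        jacobiOne a b (lam.shifted i) :=
  (vandermondeProd_dvd_alternantDet fun i =>
    jacobiPoly a b (lam.shifted i)).choose_spec.symm.trans
      (congrArg alternantDet (funext fun _ => jacobiPoly_eq ha hb _))

/-- The value of a multivariate Jacobi polynomial at `(1, …, 1)`. -/
theorem eval_multiJacobi (ha : -1 / 2 ≤ a) (hb : -1 / 2 ≤ b) (lam : PosSignature N) :
    MvPolynomial.eval (fun _ => (1 : ℝ)) (multiJacobi a b lam) =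
      (∏ i, (jacobiLead a b (lam.shifted i))⁻¹) *
        (jacobiCoeffProd a N * vandermondeProd (lam.hat a b)) := by
  rw [eval_one_of_vandermondeX_mul (vandermondeX_mul_multiJacobi ha hb lam)]
  have h1 := Matrix.det_mul_column (fun i => (jacobiLead a b (lam.shifted i))⁻¹)
    (Matrix.of fun i j : Fin N => (shiftedJacobi a b (lam.shifted i)).coeff (N - 1 - (j : ℕ)))
  have h2 := Matrix.det_mul_row (fun j : Fin N => jacobiCoeff a (N - 1 - (j : ℕ)))
    (Matrix.of fun i j : Fin N =>
      quadValue (epsParam a b) (N - 1 - (j : ℕ)) (lam.shifted i))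
  have h3 := multiQuad_staircase ha hb lam
  rw [multiQuad, div_eq_one_iff_eq (vandermondeProd_hat_pos ha hb lam).ne'] at h3
  simp only [taylor_mul, taylor_C, taylor_jacobiOne, coeff_C_mul]
  rw [← h3, jacobiCoeffProd, ← h2]
  simp only [Matrix.of_apply, coeff_shiftedJacobi] at h1 ⊢
  exact h1

theorem eval_normJacobi (ha : -1 / 2 ≤ a) (hb : -1 / 2 ≤ b) (lam : PosSignature N) :
    MvPolynomial.eval (fun _ => (1 : ℝ)) (normJacobi a b lam) = 1 := by
  rw [normJacobi, MvPolynomial.smul_eval]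
  refine inv_mul_cancel₀ ?_
  rw [eval_multiJacobi ha hb]
  refine mul_ne_zero (Finset.prod_ne_zero_iff.2 fun i _ =>
    inv_ne_zero (jacobiLead_pos ha hb _).ne') ?_
  exact (mul_pos (jacobiCoeffProd_pos ha) (vandermondeProd_hat_pos ha hb lam)).ne'

theorem vandermondeX_mul_normJacobi (ha : -1 / 2 ≤ a) (hb : -1 / 2 ≤ b) (lam : PosSignature N) :
    vandermondeX N * normJacobi a b lam =
      MvPolynomial.C (jacobiCoeffProd a N * vandermondeProd (lam.hat a b))⁻¹ *
        alternantDet fun i => jacobiOne a b (lam.shifted i) := by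
  rw [normJacobi, mul_smul_comm, vandermondeX_mul_multiJacobi ha hb, alternantDet_C_mul,
    eval_multiJacobi ha hb, MvPolynomial.smul_eq_C_mul, ← mul_assoc, ← map_mul]
  congr 2
  have h : (∏ i, (jacobiLead a b (lam.shifted i))⁻¹) ≠ 0 :=
    Finset.prod_ne_zero_iff.2 fun i _ => inv_ne_zero (jacobiLead_pos ha hb _).ne'
  rw [mul_inv, mul_right_comm, inv_mul_cancel₀ h, one_mul]

/-- The functions `multiQuad` separate finitely supported signed measures: on the support, the one
attached to a signature `kap` with maximal `∑ l_i` vanishes except at `kap`. -/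
theorem eq_zero_of_multiQuad (ha : -1 / 2 ≤ a) (hb : -1 / 2 ≤ b) {v : PosSignature N →₀ ℝ}
    (h : ∀ k : Fin N → ℕ, (v.sum fun mu c => c * multiQuad a b k mu) = 0) : v = 0 := by
  by_contra hv
  obtain ⟨kap, hkap, hmax⟩ := v.support.exists_max_image (fun mu => ∑ i, mu.shifted i)
    (Finsupp.support_nonempty_iff.2 hv)
  have h1 := h kap.shifted
  rw [Finsupp.sum, Finset.sum_eq_single kap] at h1
  · refine (mul_ne_zero (Finsupp.mem_support_iff.1 hkap) (div_ne_zero ?_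
      (vandermondeProd_hat_pos ha hb kap).ne')) h1
    have htri : (Matrix.of fun i j => quadValue (epsParam a b) (kap.shifted j)
        (kap.shifted i)).IsUpperTriangular := fun i j hij =>
      quadValue_eq_zero _ (kap.shifted_strictAnti hij)
    rw [Matrix.det_of_isUpperTriangular htri]
    exact Finset.prod_ne_zero_iff.2 fun i _ =>
      (quadValue_self_pos (epsParam_nonneg ha hb) _).ne'
  · intro mu hmu hne
    have hdet : (Matrix.of fun i j => quadValue (epsParam a b) (kap.shifted j)
        (mu.shifted i)).det = 0 := by
      rw [Matrix.det_apply']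
      refine Finset.sum_eq_zero fun σ _ => ?_
      by_contra hprod
      have h2 : ∀ j, kap.shifted j ≤ mu.shifted (σ j) := by
        intro j
        by_contra! hlt
        refine hprod (mul_eq_zero_of_right _ (Finset.prod_eq_zero (Finset.mem_univ j) ?_))
        exact quadValue_eq_zero _ hlt
      have h3 : ∑ j, mu.shifted (σ j) = ∑ j, mu.shifted j := Equiv.sum_comp σ _
      have h4 : ∀ j ∈ Finset.univ, kap.shifted j = mu.shifted (σ j) :=
        (Finset.sum_eq_sum_iff_of_le fun j _ => h2 j).1
          (le_antisymm (Finset.sum_le_sum fun j _ => h2 j) (h3.le.trans (hmax mu hmu)))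
      have h5 : kap.shifted ∘ (1 : Equiv.Perm (Fin N)) = mu.shifted ∘ σ :=
        funext fun j => h4 j (Finset.mem_univ j)
      exact hne (PosSignature.shifted_comp_injective h5).1.symm
    rw [multiQuad, hdet, zero_div, mul_zero]
  · exact fun hk => absurd hkap hk

/-- A finite linear relation between normalized Jacobi polynomials, read off from the Taylor
coefficients at `(1, …, 1)`. -/
theorem sum_multiQuad_eq_zero (ha : -1 / 2 ≤ a) (hb : -1 / 2 ≤ b) {v : PosSignature N →₀ ℝ}
    (h : (v.sum fun mu c => c • normJacobi a b mu) = 0) (k : Fin N → ℕ) :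
    (v.sum fun mu c => c * multiQuad a b k mu) = 0 := by
  have h1 := congrArg (fun p => MvPolynomial.coeff (Finsupp.equivFunOnFinite.symm k)
    (translateOne N (vandermondeX N * p))) h
  simp only [Finsupp.sum, Finset.mul_sum, mul_smul_comm, vandermondeX_mul_normJacobi ha hb,
    map_sum, map_smul, map_mul, MvPolynomial.coeff_sum, MvPolynomial.coeff_smul, mul_zero,
    map_zero, MvPolynomial.coeff_zero] at h1
  have hC : ∀ (c : ℝ) (p : MvPolynomial (Fin N) ℝ), MvPolynomial.coeff
      (Finsupp.equivFunOnFinite.symm k) (translateOne N (MvPolynomial.C c) * p) =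
        c * MvPolynomial.coeff (Finsupp.equivFunOnFinite.symm k) p := by
    intro c p
    rw [translateOne, MvPolynomial.aeval_C, MvPolynomial.algebraMap_eq, MvPolynomial.coeff_C_mul]
  simp only [hC, coeff_translateOne_alternantDet_jacobiOne,
    Finsupp.equivFunOnFinite_symm_apply_apply] at h1
  have hP : (∏ j, jacobiCoeff a (k j)) * (jacobiCoeffProd a N)⁻¹ ≠ 0 :=
    mul_ne_zero (Finset.prod_ne_zero_iff.2 fun j _ => (jacobiCoeff_pos ha _).ne')
      (inv_ne_zero (jacobiCoeffProd_pos ha).ne')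
  refine (mul_eq_zero.1 (?_ : (∏ j, jacobiCoeff a (k j)) * (jacobiCoeffProd a N)⁻¹ * _ = 0)
    ).resolve_left hP
  rw [← h1, Finsupp.sum, Finset.mul_sum]
  refine Finset.sum_congr rfl fun mu _ => ?_
  rw [multiQuad, mul_inv, smul_eq_mul, div_eq_mul_inv]
  ring

theorem normJacobi_linearIndependent (ha : -1 / 2 ≤ a) (hb : -1 / 2 ≤ b)
    {v : PosSignature N →₀ ℝ} (h : (v.sum fun mu c => c • normJacobi a b mu) = 0) : v = 0 :=
  eq_zero_of_multiQuad ha hb (sum_multiQuad_eq_zero ha hb h)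

/-! ### The branching rule -/

theorem vandermondeProd_snoc {R : Type*} [CommRing R] (x : Fin N → R) (y : R) :
    vandermondeProd (Fin.snoc x y : Fin (N + 1) → R) = vandermondeProd x * ∏ i, (x i - y) := by
  have h : ∀ {M : ℕ} (x : Fin M → R), vandermondeProd x =
      ∏ i, ∏ j, if i < j then x i - x j else 1 := by
    intro M x
    refine Finset.prod_congr rfl fun i _ => ?_
    rw [← Finset.prod_filter]
    congr 1
    ext j
    simp
  rw [h, h, Fin.prod_univ_castSucc]
  simp only [Fin.prod_univ_castSucc, Fin.snoc_castSucc, Fin.snoc_last, Fin.castSucc_lt_last,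
    if_true, Fin.castSucc_lt_castSucc_iff, lt_irrefl, if_false, Finset.prod_mul_distrib]
  rw [Finset.prod_eq_one (s := Finset.univ) (f := fun i : Fin N =>
    if Fin.last N < i.castSucc then y - x i else 1)]
  · simp
  · intro i _
    rw [if_neg (not_lt.2 (Fin.castSucc_lt_last i).le)]

theorem lastVarOne_vandermondeX :
    lastVarOne (vandermondeX (N + 1)) = vandermondeX N * ∏ i, (MvPolynomial.X i - 1) := by
  rw [← vandermondeProd_snoc, lastVarOne, vandermondeX]
  refine (map_vandermondeProd (MvPolynomial.aeval _ : MvPolynomial (Fin (N + 1)) ℝ →ₐ[ℝ]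
    MvPolynomial (Fin N) ℝ).toRingHom _).trans ?_
  congr 1
  ext i : 1
  simp

theorem lastVarOne_mul (f g : MvPolynomial (Fin (N + 1)) ℝ) :
    lastVarOne (f * g) = lastVarOne f * lastVarOne g := map_mul _ f g

theorem lastVarOne_C (c : ℝ) : lastVarOne (N := N) (MvPolynomial.C c) = MvPolynomial.C c := by
  simp [lastVarOne, MvPolynomial.algebraMap_eq]

theorem lastVarOne_alternantDet (f : Fin (N + 1) → ℝ[X]) (hf : ∀ i, (f i).eval 1 = 1) :
    lastVarOne (alternantDet f) = alternantDet fun i : Fin N => f i.castSucc - f i.succ := by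
  have h0 : lastVarOne (alternantDet f) = (Matrix.of fun i j : Fin (N + 1) =>
      aeval ((Fin.snoc (fun i => MvPolynomial.X i) 1 : Fin (N + 1) → MvPolynomial (Fin N) ℝ) j)
        (f i)).det := by
    rw [alternantDet, lastVarOne, AlgHom.map_det]
    congr 1
    ext i j : 2
    simp only [Matrix.of_apply, AlgHom.mapMatrix_apply, Matrix.map_apply, ← aeval_algHom_apply,
      MvPolynomial.aeval_X]
  rw [h0, det_of_last_col_one, alternantDet]
  · congr 1
    ext i j : 2
    simp only [Matrix.of_apply, Fin.snoc_castSucc, map_sub]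
  · intro i
    rw [Matrix.of_apply, Fin.snoc_last]
    have := aeval_algebraMap_apply (MvPolynomial (Fin N) ℝ) (1 : ℝ) (f i)
    rw [map_one] at this
    rw [this, coe_aeval_eq_eval, hf, map_one]

theorem alternantDet_X_sub_one_mul (f : Fin N → ℝ[X]) :
    alternantDet (fun i => (X - 1) * f i) =
      (∏ i, (MvPolynomial.X i - 1)) * alternantDet f := by
  rw [alternantDet, alternantDet, ← Matrix.det_mul_row]
  congr 1
  ext i j : 2
  simp

theorem alternantDet_sum (M : ℕ) (A : Fin N → ℕ → ℝ) (f : ℕ → ℝ[X]) :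
    alternantDet (fun i => ∑ m ∈ Finset.range M, C (A i m) * f m) =
      ∑ mu ∈ PosSignature.below N M,
        MvPolynomial.C (Matrix.of fun i j => A i (mu.shifted j)).det *
          alternantDet fun i => f (mu.shifted i) := by
  have h := det_sum_mul_eq M (fun i m => (MvPolynomial.C (A i m) : MvPolynomial (Fin N) ℝ))
    (fun m j => aeval (MvPolynomial.X j) (f m))
  have h0 : alternantDet (fun i => ∑ m ∈ Finset.range M, C (A i m) * f m) =
      (Matrix.of fun i j => ∑ m ∈ Finset.range M, (MvPolynomial.C (A i m) :
        MvPolynomial (Fin N) ℝ) * aeval (MvPolynomial.X j) (f m)).det := by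
    rw [alternantDet]
    congr 1
    ext i j : 2
    simp [MvPolynomial.algebraMap_eq]
  rw [h0, h]
  refine Finset.sum_congr rfl fun mu _ => ?_
  rw [RingHom.map_det]
  rfl

theorem lastVarOne_alternantDet_jacobiOne (ha : -1 / 2 ≤ a) (hb : -1 / 2 ≤ b)
    (lam : PosSignature (N + 1)) :
    lastVarOne (alternantDet fun i => jacobiOne a b (lam.shifted i)) =
      (∏ i, (MvPolynomial.X i - 1)) * ∑ mu ∈ PosSignature.below N (lam.shifted 0),
        MvPolynomial.C (Matrix.of fun i j : Fin N => linkEntry a b (lam.shifted i.castSucc)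
          (lam.shifted i.succ) (mu.shifted j)).det *
            alternantDet fun i => jacobiOne a b (mu.shifted i) := by
  rw [lastVarOne_alternantDet _ fun i => jacobiOne_eval_one _, ← alternantDet_sum (lam.shifted 0)
    (fun i m => linkEntry a b (lam.shifted i.castSucc) (lam.shifted i.succ) m),
    ← alternantDet_X_sub_one_mul]
  congr 1
  funext i
  exact jacobiOne_sub_eq_sum_linkEntry ha hb
    (lam.shifted_strictAnti.antitone (Fin.castSucc_lt_succ).le)
    (lam.shifted_strictAnti.antitone (Fin.zero_le _))

open Classical in
/-- The branching coefficients of the normalized Jacobi polynomials in determinantal form. -/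
noncomputable def branchingCoeff (a b : ℝ) (N : ℕ) (lam : PosSignature (N + 1)) :
    PosSignature N →₀ ℝ :=
  Finsupp.onFinset (PosSignature.below N (lam.shifted 0))
    (fun mu => if mu ∈ PosSignature.below N (lam.shifted 0) then
      vandermondeProd (mu.hat a b) / (jacobiCoeff a N * vandermondeProd (lam.hat a b)) *
        (Matrix.of fun i j : Fin N => linkEntry a b (lam.shifted i.castSucc)
          (lam.shifted i.succ) (mu.shifted j)).det else 0)
    fun mu h => by by_contra hmu; exact h (if_neg hmu)

theorem branchingCoeff_sum_eq {R : Type*} [AddCommMonoid R] (lam : PosSignature (N + 1))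
    (g : PosSignature N → ℝ → R) (hg : ∀ mu, g mu 0 = 0) :
    (branchingCoeff a b N lam).sum g = ∑ mu ∈ PosSignature.below N (lam.shifted 0),
      g mu (vandermondeProd (mu.hat a b) / (jacobiCoeff a N * vandermondeProd (lam.hat a b)) *
        (Matrix.of fun i j : Fin N => linkEntry a b (lam.shifted i.castSucc)
          (lam.shifted i.succ) (mu.shifted j)).det) := by
  classical
  rw [branchingCoeff, Finsupp.onFinset_sum _ hg]
  exact Finset.sum_congr rfl fun mu hmu => by rw [if_pos hmu]

theorem branchingCoeff_nonneg (ha : -1 / 2 ≤ a) (hb : -1 / 2 ≤ b) (lam : PosSignature (N + 1))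
    (mu : PosSignature N) : 0 ≤ branchingCoeff a b N lam mu := by
  rw [branchingCoeff, Finsupp.onFinset_apply]
  split_ifs
  · exact mul_nonneg (div_nonneg (vandermondeProd_hat_pos ha hb mu).le
      (mul_pos (jacobiCoeff_pos ha N) (vandermondeProd_hat_pos ha hb lam)).le)
      (det_linkEntry_nonneg ha hb lam mu)
  · exact le_rfl

theorem isBranchingMatrix_branchingCoeff (ha : -1 / 2 ≤ a) (hb : -1 / 2 ≤ b) :
    IsBranchingMatrix a b N (branchingCoeff a b N) := by
  intro lam
  have hP : (∏ i : Fin N, (MvPolynomial.X i - 1 : MvPolynomial (Fin N) ℝ)) ≠ 0 := by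
    refine Finset.prod_ne_zero_iff.2 fun i _ h => ?_
    have := congrArg (MvPolynomial.eval fun _ => (0 : ℝ)) h
    simp at this
  refine mul_left_cancel₀ (mul_ne_zero vandermondeX_ne_zero hP) ?_
  rw [← lastVarOne_vandermondeX, ← lastVarOne_mul, vandermondeX_mul_normJacobi ha hb,
    lastVarOne_mul, lastVarOne_C, lastVarOne_alternantDet_jacobiOne ha hb,
    lastVarOne_vandermondeX, branchingCoeff_sum_eq lam (fun mu c => c • normJacobi a b mu)
      (fun mu => zero_smul _ _),
    Finset.mul_sum, Finset.mul_sum, Finset.mul_sum]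
  refine Finset.sum_congr rfl fun mu _ => ?_
  set D := (Matrix.of fun i j : Fin N => linkEntry a b (lam.shifted i.castSucc)
    (lam.shifted i.succ) (mu.shifted j)).det
  have h1 := vandermondeX_mul_normJacobi ha hb mu
  have hJ := (jacobiCoeffProd_pos (N := N) ha).ne'
  have hV := (vandermondeProd_hat_pos ha hb mu).ne'
  have hV' := (vandermondeProd_hat_pos ha hb lam).ne'
  have hc := (jacobiCoeff_pos ha N).ne'
  have h2 : MvPolynomial.C (vandermondeProd (mu.hat a b) /
      (jacobiCoeff a N * vandermondeProd (lam.hat a b)) * D) *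
      MvPolynomial.C (jacobiCoeffProd a N * vandermondeProd (mu.hat a b))⁻¹ =
      MvPolynomial.C (jacobiCoeffProd a (N + 1) * vandermondeProd (lam.hat a b))⁻¹ *
        (MvPolynomial.C D : MvPolynomial (Fin N) ℝ) := by
    rw [← map_mul, ← map_mul, jacobiCoeffProd_succ]
    congr 1
    field_simp
  rw [MvPolynomial.smul_eq_C_mul]
  linear_combination (-(alternantDet fun i => jacobiOne a b (mu.shifted i)) *
    ∏ i : Fin N, (MvPolynomial.X i - 1 : MvPolynomial (Fin N) ℝ)) * h2 -
    (MvPolynomial.C (vandermondeProd (mu.hat a b) /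
      (jacobiCoeff a N * vandermondeProd (lam.hat a b)) * D) *
      ∏ i : Fin N, (MvPolynomial.X i - 1 : MvPolynomial (Fin N) ℝ)) * h1

theorem IsBranchingMatrix.unique (ha : -1 / 2 ≤ a) (hb : -1 / 2 ≤ b)
    {L L' : PosSignature (N + 1) → PosSignature N →₀ ℝ} (hL : IsBranchingMatrix a b N L)
    (hL' : IsBranchingMatrix a b N L') : L = L' := by
  funext lam
  refine sub_eq_zero.1 (normJacobi_linearIndependent ha hb ?_)
  rw [Finsupp.sum_sub_index fun mu c c' => sub_smul c c' _, ← hL lam, ← hL' lam, sub_self]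

theorem link_eq (ha : -1 / 2 ≤ a) (hb : -1 / 2 ≤ b) : link a b N = branchingCoeff a b N :=
  IsBranchingMatrix.unique ha hb
    (Classical.epsilon_spec ⟨_, isBranchingMatrix_branchingCoeff ha hb⟩)
    (isBranchingMatrix_branchingCoeff ha hb)

theorem branchingCoeff_sum (ha : -1 / 2 ≤ a) (hb : -1 / 2 ≤ b) (lam : PosSignature (N + 1)) :
    ((branchingCoeff a b N lam).sum fun _ c => c) = 1 := by
  have h1 := congrArg (MvPolynomial.eval fun _ => (1 : ℝ))
    (isBranchingMatrix_branchingCoeff (N := N) ha hb lam)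
  have h2 : ∀ f : MvPolynomial (Fin (N + 1)) ℝ, MvPolynomial.eval (fun _ => (1 : ℝ))
      (lastVarOne f) = MvPolynomial.eval (fun _ => (1 : ℝ)) f := by
    intro f
    have : ((MvPolynomial.eval fun _ => (1 : ℝ)).comp (MvPolynomial.aeval (Fin.snoc
        (α := fun _ => MvPolynomial (Fin N) ℝ) (fun i => MvPolynomial.X i) 1) :
          MvPolynomial (Fin (N + 1)) ℝ →ₐ[ℝ] _).toRingHom) =
        MvPolynomial.eval fun _ => (1 : ℝ) := by
      refine MvPolynomial.ringHom_ext (fun r => by simp [MvPolynomial.algebraMap_eq])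
        fun i => ?_
      induction i using Fin.lastCases <;> simp
    exact congrArg (fun φ => φ f) this
  rw [h2, eval_normJacobi ha hb, Finsupp.sum, map_sum] at h1
  rw [h1, Finsupp.sum]
  exact Finset.sum_congr rfl fun mu _ => by
    rw [MvPolynomial.smul_eval, eval_normJacobi ha hb, mul_one]

/-- The links act on the functions `multiQuad` by raising all exponents by `1` and appending the
exponent `0`. -/
theorem branchingCoeff_sum_multiQuad (ha : -1 / 2 ≤ a) (hb : -1 / 2 ≤ b)
    (lam : PosSignature (N + 1)) (k : Fin N → ℕ) :
    multiQuad a b (Fin.snoc (fun j => k j + 1) 0 : Fin (N + 1) → ℕ) lam =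
      jacobiCoeff a N * (∏ j, 2 * ((k j : ℝ) + 1) * (k j + 1 + a)) *
        (branchingCoeff a b N lam).sum fun mu c => c * multiQuad a b k mu := by
  have h1 : (Matrix.of fun i j : Fin (N + 1) => quadValue (epsParam a b)
      ((Fin.snoc (fun j => k j + 1) 0 : Fin (N + 1) → ℕ) j) (lam.shifted i)).det =
      (∏ j, 2 * ((k j : ℝ) + 1) * (k j + 1 + a)) * ∑ mu ∈ PosSignature.below N (lam.shifted 0),
        (Matrix.of fun i j : Fin N => linkEntry a b (lam.shifted i.castSucc)
          (lam.shifted i.succ) (mu.shifted j)).det *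
        (Matrix.of fun i j => quadValue (epsParam a b) (k j) (mu.shifted i)).det := by
    have h2 := det_sum_mul_eq (lam.shifted 0)
      (fun (i : Fin N) m => linkEntry a b (lam.shifted i.castSucc) (lam.shifted i.succ) m)
      (fun m (j : Fin N) => quadValue (epsParam a b) (k j) m)
    rw [det_of_last_col_one _ (fun i => by simp), ← h2, ← Matrix.det_mul_row]
    congr 1
    ext i j : 2
    simp only [Matrix.of_apply, Fin.snoc_castSucc]
    rw [quadValue_sub_eq_sum_linkEntry ha hb (k j)
      (lam.shifted_strictAnti.antitone (Fin.castSucc_lt_succ).le)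
      (lam.shifted_strictAnti.antitone (Fin.zero_le _))]
  rw [multiQuad, h1, branchingCoeff_sum_eq lam (fun mu c => c * multiQuad a b k mu)
    (fun mu => zero_mul _),
    mul_div_assoc, mul_comm (jacobiCoeff a N), mul_assoc]
  congr 1
  rw [Finset.sum_div, Finset.mul_sum]
  refine Finset.sum_congr rfl fun mu _ => ?_
  rw [multiQuad]
  have hV := (vandermondeProd_hat_pos ha hb mu).ne'
  have hV' := (vandermondeProd_hat_pos ha hb lam).ne'
  have hc := (jacobiCoeff_pos ha N).ne'
  field_simp

end Links

/-! ### The generators on signatures -/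

section Levels

variable {a b : ℝ} {N : ℕ}

/-- The rates have the form treated in `jacobi_generator_quadValue`, with
`g(x) = (x - u)(x - u')`; the term `1 * x ^ 2` displays its leading coefficient. -/
theorem birthRate_eq (u u' : ℂ) (x : ℕ) : birthRate a b u u' x =
    jacobiUp a b x * (1 * x ^ 2 - (u + u').re * x + (u * u').re) := by
  have h : (((x : ℂ) - u) * ((x : ℂ) - u')).re =
      1 * (x : ℝ) ^ 2 - (u + u').re * x + (u * u').re := by
    simp only [Complex.mul_re, Complex.sub_re, Complex.sub_im, Complex.natCast_re,
      Complex.natCast_im, Complex.add_re]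
    ring
  rw [birthRate, h, jacobiUp]
  ring

theorem deathRate_eq (u u' : ℂ) (x : ℕ) : deathRate a b u u' x =
    jacobiDown a b x * (1 * (x + 2 * epsParam a b) ^ 2 +
      (u + u').re * (x + 2 * epsParam a b) + (u * u').re) := by
  have h : (((x : ℂ) + u + 2 * (epsParam a b : ℂ)) * ((x : ℂ) + u' + 2 * (epsParam a b : ℂ))).re =
      1 * ((x : ℝ) + 2 * epsParam a b) ^ 2 + (u + u').re * (x + 2 * epsParam a b) +
        (u * u').re := by
    simp only [Complex.mul_re, Complex.add_re, Complex.add_im, Complex.natCast_re,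
      Complex.natCast_im, Complex.mul_im, Complex.ofReal_re, Complex.ofReal_im, Complex.re_ofNat,
      Complex.im_ofNat]
    ring
  rw [deathRate, h, jacobiDown]
  split_ifs
  · simp
  · ring

theorem birthDeathMatrix_eq_zero (u u' : ℂ) {x y : ℕ} (h : x + 1 < y ∨ y + 1 < x) :
    birthDeathMatrix a b u u' x y = 0 := by
  rw [birthDeathMatrix, if_neg (by omega), if_neg (by omega), if_neg (by omega)]

theorem sum_birthDeathMatrix (u u' : ℂ) (x : ℕ) (f : ℕ → ℝ) :
    ∑ y ∈ Finset.range (x + 2), birthDeathMatrix a b u u' x y * f y =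
      birthRate a b u u' x * (f (x + 1) - f x) + deathRate a b u u' x * (f (x - 1) - f x) := by
  rcases x with _ | x
  · simp [Finset.sum_range_succ, birthDeathMatrix, deathRate]
    ring
  · rw [Finset.sum_range_succ, Finset.sum_range_succ, Finset.sum_range_succ,
      Finset.sum_eq_zero fun y hy => by
        rw [birthDeathMatrix_eq_zero u u' (Or.inr (by
          have := Finset.mem_range.1 hy; omega)), zero_mul]]
    have hx : x ≠ x + 1 + 1 := by omega
    simp [birthDeathMatrix, hx]
    ring

/-- The diagonal coefficient of the birth-and-death generator on `quadFactorial`. -/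
noncomputable def rateDiag (b : ℝ) (u u' : ℂ) (k : ℕ) : ℝ :=
  (k : ℝ) * (k - 1) - k * ((u + u').re + b)

/-- The lower diagonal coefficient of the birth-and-death generator on `quadFactorial`. -/
noncomputable def rateLower (a : ℝ) (u u' : ℂ) (k : ℕ) : ℝ :=
  (k : ℝ) * (k + a) * (((k : ℝ) - 1) ^ 2 - (u + u').re * (k - 1) + (u * u').re)

theorem sum_birthDeathMatrix_quadValue (ha : -1 / 2 ≤ a) (hb : -1 / 2 ≤ b) (u u' : ℂ) (k x : ℕ) :
    ∑ y ∈ Finset.range (x + 2), birthDeathMatrix a b u u' x y * quadValue (epsParam a b) k y =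
      rateDiag b u u' k * quadValue (epsParam a b) k x +
        rateLower a u u' k * quadValue (epsParam a b) (k - 1) x := by
  rw [sum_birthDeathMatrix]
  rcases k with _ | k
  · simp [rateDiag, rateLower]
  · rw [birthRate_eq, deathRate_eq, jacobi_generator_quadValue ha hb, rateDiag, rateLower,
      Nat.add_sub_cancel]
    push_cast
    ring

/-- A finite set of signatures that contains those reached from `lam` in one jump. -/
noncomputable def levelNeighbors (lam : PosSignature N) : Finset (PosSignature N) :=
  PosSignature.below N (∑ i, lam.shifted i + 2)

theorem shifted_le_sum (lam : PosSignature N) (i : Fin N) :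
    lam.shifted i ≤ ∑ j, lam.shifted j :=
  Finset.single_le_sum (fun _ _ => Nat.zero_le _) (Finset.mem_univ i)

theorem self_mem_levelNeighbors (lam : PosSignature N) : lam ∈ levelNeighbors lam := by
  rw [levelNeighbors, PosSignature.mem_below]
  intro i
  have := shifted_le_sum lam i
  omega

/-- An injective tuple obtained from a strictly decreasing one by moving one entry by at most `1`
is strictly decreasing. -/
theorem strictAnti_update {l : Fin N → ℕ} (hl : StrictAnti l) {i : Fin N} {y : ℕ}
    (h1 : y ≤ l i + 1) (h2 : l i ≤ y + 1) (hinj : Function.Injective (Function.update l i y)) :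
    StrictAnti (Function.update l i y) := by
  intro j k hjk
  have hne : Function.update l i y j ≠ Function.update l i y k := fun h => hjk.ne (hinj h)
  have h3 := hl hjk
  by_cases hj : j = i
  · subst hj
    rw [Function.update_self, Function.update_of_ne hjk.ne'] at hne ⊢
    omega
  · by_cases hk : k = i
    · subst hk
      rw [Function.update_self, Function.update_of_ne hj] at hne ⊢
      omega
    · rwa [Function.update_of_ne hj, Function.update_of_ne hk]

/-- The generator on functions of the form `A / Δ`, where `A` vanishes on tuples with equal
entries: the jumps that leave the set of strictly decreasing tuples do not contribute. -/
theorem sum_levelRates (ha : -1 / 2 ≤ a) (hb : -1 / 2 ≤ b) (u u' : ℂ) (lam : PosSignature N)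
    (A : (Fin N → ℕ) → ℝ) (hA : ∀ n, ¬ Function.Injective n → A n = 0) :
    ∑ nu ∈ levelNeighbors lam, levelRates a b u u' N lam nu *
        (A nu.shifted / vandermondeProd (nu.hat a b)) =
      (∑ i, ∑ y ∈ Finset.range (lam.shifted i + 2),
        birthDeathMatrix a b u u' (lam.shifted i) y * A (Function.update lam.shifted i y)) /
          vandermondeProd (lam.hat a b) -
        rateConst b u u' N * (A lam.shifted / vandermondeProd (lam.hat a b)) := by
  have hV := fun nu : PosSignature N => (vandermondeProd_hat_pos ha hb nu).ne'
  have h1 : ∀ nu : PosSignature N, levelRates a b u u' N lam nu *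
      (A nu.shifted / vandermondeProd (nu.hat a b)) =
      (∑ i, (if ∀ j, j ≠ i → lam.shifted j = nu.shifted j
        then birthDeathMatrix a b u u' (lam.shifted i) (nu.shifted i) else 0) * A nu.shifted) /
          vandermondeProd (lam.hat a b) -
        if lam = nu then rateConst b u u' N * (A nu.shifted / vandermondeProd (nu.hat a b))
          else 0 := by
    intro nu
    rw [levelRates, sub_mul, ite_mul, zero_mul, ← Finset.sum_mul]
    congr 1
    have := hV nu
    field_simp
  simp only [h1, Finset.sum_sub_distrib, Finset.sum_ite_eq, self_mem_levelNeighbors, if_true]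
  rw [← Finset.sum_div, Finset.sum_comm]
  congr 2
  refine Finset.sum_congr rfl fun i _ => ?_
  refine Finset.sum_bij_ne_zero (fun nu _ _ => nu.shifted i) ?_ ?_ ?_ ?_
  · intro nu _ h
    rw [Finset.mem_range]
    by_contra! hlt
    refine h ?_
    rw [birthDeathMatrix_eq_zero u u' (Or.inl (by omega))]
    simp
  · intro nu _ h nu' _ h' heq
    apply PosSignature.shifted_injective
    ext j
    by_cases hj : j = i
    · rw [hj, heq]
    · have e1 : ∀ j, j ≠ i → lam.shifted j = nu.shifted j := by
        by_contra hc; exact h (by rw [if_neg hc, zero_mul])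
      have e2 : ∀ j, j ≠ i → lam.shifted j = nu'.shifted j := by
        by_contra hc; exact h' (by rw [if_neg hc, zero_mul])
      rw [← e1 j hj, e2 j hj]
  · intro y _ h
    have hy : y ≤ lam.shifted i + 1 ∧ lam.shifted i ≤ y + 1 := by
      by_contra hc
      refine h ?_
      rw [birthDeathMatrix_eq_zero u u' (by omega), zero_mul]
    have hinj : Function.Injective (Function.update lam.shifted i y) := by
      by_contra hc
      exact h (by rw [hA _ hc, mul_zero])
    have hanti := strictAnti_update lam.shifted_strictAnti hy.1 hy.2 hinj
    have hcond : ∀ j, j ≠ i → lam.shifted j =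
        (PosSignature.ofStrictAnti _ hanti).shifted j := fun j hj => by
      rw [PosSignature.shifted_ofStrictAnti, Function.update_of_ne hj]
    refine ⟨PosSignature.ofStrictAnti _ hanti, ?_, ?_, ?_⟩
    · rw [levelNeighbors, PosSignature.mem_below]
      intro j
      have := shifted_le_sum lam j
      by_cases hj : j = i
      · subst hj
        rw [PosSignature.shifted_ofStrictAnti, Function.update_self]
        omega
      · rw [← hcond j hj]
        omega
    · rw [if_pos hcond, PosSignature.shifted_ofStrictAnti, Function.update_self]
      exact h
    · rw [PosSignature.shifted_ofStrictAnti, Function.update_self]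
  · intro nu _ h
    have e1 : ∀ j, j ≠ i → lam.shifted j = nu.shifted j := by
      by_contra hc; exact h (by rw [if_neg hc, zero_mul])
    rw [if_pos e1]
    congr 2
    ext j
    by_cases hj : j = i
    · rw [hj, Function.update_self]
    · rw [Function.update_of_ne hj, e1 j hj]

theorem sum_det_updateRow {n ι : Type*} [Fintype n] [DecidableEq n] (M : Matrix n n ℝ) (i : n)
    (s : Finset ι) (c : ι → ℝ) (v : ι → n → ℝ) :
    ∑ y ∈ s, c y * (M.updateRow i (v y)).det =
      (M.updateRow i (fun j => ∑ y ∈ s, c y * v y j)).det := by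
  have h : (fun j => ∑ y ∈ s, c y * v y j) = ∑ y ∈ s, c y • v y := by
    ext j
    simp [Finset.sum_apply]
  rw [h]
  simp only [← Matrix.cramer_transpose_apply]
  rw [map_sum, Finset.sum_apply]
  simp

theorem multiQuad_eq_zero {k : Fin N → ℕ} {i j : Fin N} (hij : i ≠ j) (h : k i = k j)
    (lam : PosSignature N) : multiQuad a b k lam = 0 := by
  rw [multiQuad, Matrix.det_zero_of_column_eq hij (fun m => by simp [h]), zero_div]

/-- The generator acts on the functions `multiQuad` by lowering one exponent at a time. -/
theorem sum_levelRates_multiQuad (ha : -1 / 2 ≤ a) (hb : -1 / 2 ≤ b) (u u' : ℂ)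
    (lam : PosSignature N) (k : Fin N → ℕ) :
    ∑ nu ∈ levelNeighbors lam, levelRates a b u u' N lam nu * multiQuad a b k nu =
      (∑ j, rateDiag b u u' (k j) - rateConst b u u' N) * multiQuad a b k lam +
        ∑ j, rateLower a u u' (k j) * multiQuad a b (Function.update k j (k j - 1)) lam := by
  set M : Matrix (Fin N) (Fin N) ℝ :=
    Matrix.of fun i j => quadValue (epsParam a b) (k j) (lam.shifted i) with hM
  have h1 := sum_levelRates ha hb u u' lam
    (fun n => (Matrix.of fun i j => quadValue (epsParam a b) (k j) (n i)).det) (fun n hn => by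
      simp only [Function.Injective, not_forall] at hn
      obtain ⟨i, j, hij, hne⟩ := hn
      exact Matrix.det_zero_of_row_eq hne (by ext m; simp [hij]))
  have h2 : ∀ i y, (Matrix.of fun i' j => quadValue (epsParam a b) (k j)
      (Function.update lam.shifted i y i')).det =
        (M.updateRow i fun j => quadValue (epsParam a b) (k j) y).det := by
    intro i y
    congr 1
    ext i' j
    by_cases h : i' = i
    · subst h; simp
    · simp [h, hM]
  simp only [h2, sum_det_updateRow, sum_birthDeathMatrix_quadValue ha hb] at h1
  have h3 := sum_det_updateRow_eq M (Matrix.of fun i j => rateDiag b u u' (k j) *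
    quadValue (epsParam a b) (k j) (lam.shifted i) + rateLower a u u' (k j) *
      quadValue (epsParam a b) (k j - 1) (lam.shifted i))
  have h4 : ∀ j, (M.updateCol j fun i => rateDiag b u u' (k j) *
      quadValue (epsParam a b) (k j) (lam.shifted i) + rateLower a u u' (k j) *
        quadValue (epsParam a b) (k j - 1) (lam.shifted i)).det =
      rateDiag b u u' (k j) * M.det + rateLower a u u' (k j) *
        (Matrix.of fun i j' => quadValue (epsParam a b) (Function.update k j (k j - 1) j')
          (lam.shifted i)).det := by
    intro j
    have e1 : (fun i => rateDiag b u u' (k j) *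
        quadValue (epsParam a b) (k j) (lam.shifted i) + rateLower a u u' (k j) *
          quadValue (epsParam a b) (k j - 1) (lam.shifted i)) =
        rateDiag b u u' (k j) • (fun i => M i j) + rateLower a u u' (k j) •
          (fun i => quadValue (epsParam a b) (k j - 1) (lam.shifted i)) := by
      ext i; simp [hM]
    rw [e1, Matrix.det_updateCol_add, Matrix.det_updateCol_smul, Matrix.det_updateCol_smul]
    have e2 : (M.updateCol j fun i => M i j) = M := Matrix.updateCol_eq_self M j
    have e3 : (M.updateCol j fun i => quadValue (epsParam a b) (k j - 1) (lam.shifted i)) =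
        Matrix.of fun i j' => quadValue (epsParam a b) (Function.update k j (k j - 1) j')
          (lam.shifted i) := by
      ext i j'
      by_cases h : j' = j
      · subst h; simp
      · simp [h, hM]
    rw [e2, e3]
  have h5 : ∀ i, (M.updateRow i fun j => rateDiag b u u' (k j) *
      quadValue (epsParam a b) (k j) (lam.shifted i) + rateLower a u u' (k j) *
        quadValue (epsParam a b) (k j - 1) (lam.shifted i)).det =
      (M.updateRow i ((Matrix.of fun i j => rateDiag b u u' (k j) *
    quadValue (epsParam a b) (k j) (lam.shifted i) + rateLower a u u' (k j) *
      quadValue (epsParam a b) (k j - 1) (lam.shifted i)) i)).det := fun i => rfl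
  simp only [h5, h3] at h1
  simp only [Matrix.of_apply, h4] at h1
  simp only [multiQuad]
  rw [h1, Finset.sum_add_distrib, ← Finset.sum_mul, add_div, Finset.sum_div]
  simp only [mul_div_assoc]
  ring

theorem sum_rateDiag (u u' : ℂ) :
    ∑ j : Fin N, rateDiag b u u' (N - 1 - (j : ℕ)) = rateConst b u u' N := by
  induction N with
  | zero => simp [rateConst]
  | succ N ih =>
    rw [Fin.sum_univ_succ]
    have h : ∀ j : Fin N, N + 1 - 1 - (j.succ : ℕ) = N - 1 - (j : ℕ) := fun j => by
      simp only [Fin.val_succ]; omega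
    simp only [h, ih]
    simp only [rateConst, rateDiag, Fin.val_zero, Nat.add_sub_cancel, Nat.sub_zero]
    push_cast
    ring

/-- The Vandermonde product on the quadratic lattice is an eigenfunction, with eigenvalue
`rateConst`, of the sum of the one-particle generators; hence the rows of `levelRates` sum to
zero. -/
theorem sum_levelRates_eq_zero (ha : -1 / 2 ≤ a) (hb : -1 / 2 ≤ b) (u u' : ℂ)
    (lam : PosSignature N) : ∑ nu ∈ levelNeighbors lam, levelRates a b u u' N lam nu = 0 := by
  have h := sum_levelRates_multiQuad ha hb u u' lam (fun j => N - 1 - (j : ℕ))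
  simp only [multiQuad_staircase ha hb, mul_one] at h
  rw [h, sum_rateDiag, sub_self, zero_add]
  refine Finset.sum_eq_zero fun j _ => ?_
  by_cases hj : N - 1 - (j : ℕ) = 0
  · simp [hj, rateLower]
  · have hj1 : (j : ℕ) + 1 < N := by omega
    rw [multiQuad_eq_zero (i := j) (j := ⟨j + 1, hj1⟩), mul_zero]
    · simp [Fin.ext_iff]
    · rw [Function.update_self, Function.update_of_ne (by simp [Fin.ext_iff])]
      simp only
      omega

/-- The exponents `(N, N - 2, …, 1, 0)` at level `N`, here `N = n + 1`. -/
def raisedStaircase (n : ℕ) : Fin (n + 1) → ℕ :=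
  Function.update (fun j => n + 1 - 1 - (j : ℕ)) 0 (n + 1)

open Polynomial in
/-- For the exponents `(N, N - 2, …, 0)` the function `multiQuad` is `∑ (l_i + ε)²` up to an
additive constant: modulo `∏ (X - (l_i + ε)²)`, the leading polynomial is a combination of those of
smaller degree. -/
theorem multiQuad_raisedStaircase (ha : -1 / 2 ≤ a) (hb : -1 / 2 ≤ b) (n : ℕ)
    (lam : PosSignature (n + 1)) : multiQuad a b (raisedStaircase n) lam =
      ∑ i, lam.hat a b i - ∑ j ∈ Finset.range (n + 1), ((j : ℝ) + epsParam a b) ^ 2 := by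
  set ε := epsParam a b with hε
  set q : ℝ[X] := quadFactorial ε (n + 1) - ∏ i, (X - C (lam.hat a b i)) with hq
  have hmon : (∏ i, (X - C (lam.hat a b i))).Monic :=
    monic_prod_of_monic _ _ fun _ _ => monic_X_sub_C _
  have hdegP : (∏ i, (X - C (lam.hat a b i))).degree = ((n + 1 : ℕ) : WithBot ℕ) := by
    rw [degree_prod]
    simp
  have hdegQ : (quadFactorial ε (n + 1)).degree = ((n + 1 : ℕ) : WithBot ℕ) := by
    rw [degree_eq_natDegree (quadFactorial_monic _ _).ne_zero, natDegree_quadFactorial]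
  have hlt : q.degree < ((n + 1 : ℕ) : WithBot ℕ) := by
    have := degree_sub_lt_left (p := quadFactorial ε (n + 1))
      (q := ∏ i, (X - C (lam.hat a b i))) (hdegQ.trans hdegP.symm) (quadFactorial_monic _ _).ne_zero
      (by rw [(quadFactorial_monic _ _).leadingCoeff, hmon.leadingCoeff])
    rwa [hdegQ] at this
  obtain ⟨d, hd, hdn⟩ := exists_eq_sum_of_monic (quadFactorial_monic ε)
    (natDegree_quadFactorial ε) (n + 1) q hlt
  have hdn' : d n = ∑ i, lam.hat a b i - ∑ j ∈ Finset.range (n + 1), ((j : ℝ) + ε) ^ 2 := by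
    rw [hdn n rfl, hq, coeff_sub]
    have e1 := prod_X_sub_C_coeff_card_pred (Finset.range (n + 1))
      (fun j : ℕ => ((j : ℝ) + ε) ^ 2) (by simp)
    have e2 := prod_X_sub_C_coeff_card_pred (Finset.univ : Finset (Fin (n + 1)))
      (lam.hat a b) (by simp)
    simp only [Finset.card_range, Finset.card_univ, Fintype.card_fin, Nat.add_sub_cancel] at e1 e2
    rw [e2, quadFactorial, e1]
    ring
  set M : Matrix (Fin (n + 1)) (Fin (n + 1)) ℝ :=
    Matrix.of fun i j => quadValue ε (n + 1 - 1 - (j : ℕ)) (lam.shifted i) with hM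
  have hval : ∀ i, quadValue ε (n + 1) (lam.shifted i) =
      ∑ j : Fin (n + 1), d (n - (j : ℕ)) * M i j := by
    intro i
    have e1 : quadValue ε (n + 1) (lam.shifted i) = q.eval (lam.hat a b i) := by
      rw [hq, eval_sub, eval_prod, Finset.prod_eq_zero (Finset.mem_univ i) (by simp), sub_zero]
      rfl
    rw [e1, hd, eval_finsetSum, ← Finset.sum_range_reflect, ← Fin.sum_univ_eq_sum_range
      (fun j => eval (lam.hat a b i) (C (d (n + 1 - 1 - j)) * quadFactorial ε (n + 1 - 1 - j)))]
    refine Finset.sum_congr rfl fun j _ => ?_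
    rw [eval_mul, eval_C]
    rfl
  have hdet : (Matrix.of fun i j => quadValue ε (raisedStaircase n j) (lam.shifted i)) =
      M.updateCol 0 (fun i => ∑ j : Fin (n + 1), d (n - (j : ℕ)) • M i j) := by
    ext i j
    by_cases hj : j = 0
    · subst hj
      simp only [raisedStaircase, Matrix.of_apply, Function.update_self, Matrix.updateCol_self,
        smul_eq_mul, hval]
    · simp only [raisedStaircase, Matrix.of_apply, Function.update_of_ne hj,
        Matrix.updateCol_ne hj, hM]
  have hone := multiQuad_staircase ha hb lam
  rw [multiQuad] at hone ⊢
  rw [hdet, Matrix.det_updateCol_sum, smul_eq_mul, mul_div_assoc, hone, mul_one]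
  simpa using hdn'

theorem birthDeathMatrix_nonneg {u u' : ℂ} (hβ : ∀ x, 0 ≤ birthRate a b u u' x)
    (hδ : ∀ x, 0 ≤ deathRate a b u u' x) {x y : ℕ} (hxy : x ≠ y) :
    0 ≤ birthDeathMatrix a b u u' x y := by
  rw [birthDeathMatrix]
  split_ifs with h1 h2 h3
  · exact hβ x
  · exact hδ x
  · exact absurd h3.symm hxy
  · exact le_rfl

theorem levelRates_eq_zero (u u' : ℂ) {lam nu : PosSignature N} (hnu : nu ∉ levelNeighbors lam) :
    levelRates a b u u' N lam nu = 0 := by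
  have hne : lam ≠ nu := fun h => hnu (h ▸ self_mem_levelNeighbors lam)
  rw [levelNeighbors, PosSignature.mem_below] at hnu
  push Not at hnu
  obtain ⟨i₀, hi₀⟩ := hnu
  have hle := shifted_le_sum lam i₀
  rw [levelRates, if_neg hne, sub_zero, Finset.sum_eq_zero, mul_zero]
  intro i _
  split_ifs with h
  · by_cases hi : i₀ = i
    · subst hi
      exact birthDeathMatrix_eq_zero u u' (Or.inl (by omega))
    · have := h i₀ hi
      omega
  · rfl

/-- The Lyapunov function is `1 + ∑ (l_i + ε)²`. -/
theorem isLyapunovQMatrix_levelRates (ha : -1 / 2 ≤ a) (hb : -1 / 2 ≤ b) {u u' : ℂ}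
    (hβ : ∀ x, 0 ≤ birthRate a b u u' x) (hδ : ∀ x, 0 ≤ deathRate a b u u' x) (hN : 1 ≤ N) :
    IsLyapunovQMatrix (levelRates a b u u' N) levelNeighbors where
  offdiag_nonneg lam nu hne := by
    rw [levelRates, if_neg hne, sub_zero]
    refine mul_nonneg (div_nonneg (vandermondeProd_hat_pos ha hb nu).le
      (vandermondeProd_hat_pos ha hb lam).le) (Finset.sum_nonneg fun i _ => ?_)
    split_ifs with h
    · refine birthDeathMatrix_nonneg hβ hδ fun hi => hne (PosSignature.shifted_injective ?_)
      ext j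
      by_cases hj : j = i
      · rw [hj, hi]
      · exact h j hj
    · exact le_rfl
  self_mem := self_mem_levelNeighbors
  eq_zero _ _ := levelRates_eq_zero u u'
  row_sum := sum_levelRates_eq_zero ha hb u u'
  lyapunov := by
    obtain ⟨n, rfl⟩ : ∃ n, N = n + 1 := ⟨N - 1, by omega⟩
    set ε := epsParam a b with hε
    have hε0 : 0 ≤ ε := epsParam_nonneg ha hb
    set s : ℝ := ∑ j ∈ Finset.range (n + 1), ((j : ℝ) + ε) ^ 2 with hs
    set V : PosSignature (n + 1) → ℝ := fun lam => 1 + ∑ i, lam.hat a b i with hV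
    set r : ℝ := ∑ j, rateDiag b u u' (raisedStaircase n j) - rateConst b u u' (n + 1) with hr
    set t : ℝ := rateLower a u u' (n + 1) with ht
    have hhat : ∀ (lam : PosSignature (n + 1)) i, 0 ≤ lam.hat a b i := fun lam i => sq_nonneg _
    have hV1 : ∀ lam, 1 ≤ V lam := fun lam =>
      le_add_of_nonneg_right (Finset.sum_nonneg fun i _ => hhat lam i)
    refine ⟨V, |r| + |r| * (1 + s) + |t|, fun lam => one_pos.trans_le (hV1 lam), fun B => ?_,
      fun lam => ?_⟩
    · refine (PosSignature.finite_shifted_lt (⌈B⌉₊ + 1)).subset fun lam hlam i => ?_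
      have h1 : (lam.shifted i : ℝ) ≤ lam.hat a b i := by
        have h2 : (lam.shifted i : ℝ) ≤ (lam.shifted i : ℝ) ^ 2 := by
          exact_mod_cast Nat.le_self_pow two_ne_zero (lam.shifted i)
        refine h2.trans (pow_le_pow_left₀ (Nat.cast_nonneg _) ?_ 2)
        exact le_add_of_nonneg_right hε0
      have h3 : lam.hat a b i ≤ ∑ j, lam.hat a b j :=
        Finset.single_le_sum (fun j _ => hhat lam j) (Finset.mem_univ i)
      have h4 : V lam ≤ B := hlam
      have h5 : (lam.shifted i : ℝ) ≤ ⌈B⌉₊ := by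
        refine le_trans ?_ (Nat.le_ceil B)
        simp only [hV] at h4
        linarith
      exact Nat.lt_succ_of_le (by exact_mod_cast h5)
    · have h1 := sum_levelRates_multiQuad ha hb u u' lam (raisedStaircase n)
      have h2 : ∑ j, rateLower a u u' (raisedStaircase n j) *
          multiQuad a b (Function.update (raisedStaircase n) j (raisedStaircase n j - 1)) lam =
          t := by
        rw [Fin.sum_univ_succ, Finset.sum_eq_zero, add_zero]
        · have e1 : Function.update (raisedStaircase n) 0 (raisedStaircase n 0 - 1) =
              fun j : Fin (n + 1) => n + 1 - 1 - (j : ℕ) := by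
            rw [raisedStaircase, Function.update_self, Function.update_idem]
            exact Function.update_eq_self_iff.2 (by simp)
          rw [e1, multiQuad_staircase ha hb, mul_one, raisedStaircase, Function.update_self]
        · intro j _
          have e2 : ∀ i : Fin n, raisedStaircase n i.succ = n - 1 - (i : ℕ) := fun i => by
            rw [raisedStaircase, Function.update_of_ne (Fin.succ_ne_zero i), Fin.val_succ]
            omega
          by_cases hj : n - 1 - (j : ℕ) = 0
          · simp [e2, hj, rateLower]
          · have hj1 : (j : ℕ) + 1 < n := by omega
            rw [multiQuad_eq_zero (i := j.succ) (j := Fin.succ ⟨j + 1, hj1⟩), mul_zero]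
            · simp [Fin.ext_iff]
            · rw [Function.update_self, Function.update_of_ne (by simp [Fin.ext_iff]), e2, e2]
              simp only
              omega
      rw [h2] at h1
      have h3 : ∀ nu, V nu = multiQuad a b (raisedStaircase n) nu + (1 + s) := fun nu => by
        rw [multiQuad_raisedStaircase ha hb]
        simp only [hV, hs]
        ring
      have h4 : ∑ nu ∈ levelNeighbors lam, levelRates a b u u' (n + 1) lam nu * V nu =
          r * (V lam - (1 + s)) + t := by
        have h6 : ∀ nu, levelRates a b u u' (n + 1) lam nu * V nu =
            levelRates a b u u' (n + 1) lam nu * multiQuad a b (raisedStaircase n) nu +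
              levelRates a b u u' (n + 1) lam nu * (1 + s) := fun nu => by rw [h3, mul_add]
        simp only [h6]
        rw [Finset.sum_add_distrib, h1, ← Finset.sum_mul, sum_levelRates_eq_zero ha hb, h3 lam]
        ring
      rw [h4]
      have h5 := hV1 lam
      have hs0 : 0 ≤ s := Finset.sum_nonneg fun j _ => sq_nonneg _
      have e1 : r * V lam ≤ |r| * V lam :=
        mul_le_mul_of_nonneg_right (le_abs_self r) (by linarith)
      have e2 : -r * (1 + s) ≤ |r| * (1 + s) * V lam :=
        (mul_le_mul_of_nonneg_right (neg_le_abs r) (by linarith)).trans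
          (le_mul_of_one_le_right (by positivity) h5)
      have e3 : t ≤ |t| * V lam := (le_abs_self t).trans
        (le_mul_of_one_le_right (abs_nonneg t) h5)
      linarith

end Levels

/-! ### Commutation of the generators with the links -/

section Commutation

variable {a b : ℝ} {N : ℕ}

/-- The factor relating `multiQuad` on level `N + 1` to the image of `multiQuad` under the link. -/
noncomputable def linkFactor (a : ℝ) (k : Fin N → ℕ) : ℝ :=
  jacobiCoeff a N * ∏ j, 2 * ((k j : ℝ) + 1) * (k j + 1 + a)

theorem linkFactor_pos (ha : -1 / 2 ≤ a) (k : Fin N → ℕ) : 0 < linkFactor a k := by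
  refine mul_pos (jacobiCoeff_pos ha N) (Finset.prod_pos fun j _ => mul_pos (by positivity) ?_)
  have : (0 : ℝ) ≤ k j := Nat.cast_nonneg _
  linarith

theorem linkFactor_mul_of_eq_succ {k : Fin N → ℕ} {j : Fin N} {m : ℕ} (h : k j = m + 1) :
    linkFactor a k * (((m : ℝ) + 1) * (m + 1 + a)) =
      linkFactor a (Function.update k j m) * (((m : ℝ) + 2) * (m + 2 + a)) := by
  have h1 : ∀ i ∈ Finset.univ.erase j,
      2 * ((Function.update k j m i : ℝ) + 1) * (Function.update k j m i + 1 + a) =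
        2 * ((k i : ℝ) + 1) * (k i + 1 + a) := fun i hi => by
    rw [Function.update_of_ne (Finset.ne_of_mem_erase hi)]
  rw [linkFactor, linkFactor, ← Finset.mul_prod_erase _ _ (Finset.mem_univ j),
    ← Finset.mul_prod_erase _ _ (Finset.mem_univ j), Finset.prod_congr rfl h1,
    Function.update_self, h]
  push_cast
  ring

theorem sum_rateDiag_snoc_sub_rateConst (u u' : ℂ) (k : Fin N → ℕ) :
    ∑ j, rateDiag b (u + 1) (u' + 1) ((Fin.snoc (fun j => k j + 1) 0 : Fin (N + 1) → ℕ) j) -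
        rateConst b (u + 1) (u' + 1) (N + 1) =
      ∑ j, rateDiag b u u' (k j) - rateConst b u u' N := by
  have h : ∀ j : Fin N, rateDiag b (u + 1) (u' + 1) (k j + 1) =
      rateDiag b u u' (k j) - ((u + u').re + b + 2) := fun j => by
    simp only [rateDiag, Complex.add_re, Complex.one_re]
    push_cast
    ring
  rw [Fin.sum_univ_castSucc]
  simp only [Fin.snoc_castSucc, Fin.snoc_last, h, Finset.sum_sub_distrib, Finset.sum_const,
    Finset.card_univ, Fintype.card_fin, nsmul_eq_mul]
  simp only [rateDiag, rateConst, Complex.add_re, Complex.one_re]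
  push_cast
  ring

/-- Shifting `(u, u')` by `1` on level `N + 1` matches the lower diagonal terms of the two
generators. -/
theorem rateLower_mul_multiQuad_snoc (ha : -1 / 2 ≤ a) (hb : -1 / 2 ≤ b) (u u' : ℂ)
    (lam : PosSignature (N + 1)) (k : Fin N → ℕ) (j : Fin N) :
    rateLower a (u + 1) (u' + 1) (k j + 1) * multiQuad a b (Function.update
        (Fin.snoc (fun j => k j + 1) 0 : Fin (N + 1) → ℕ) j.castSucc (k j)) lam =
      linkFactor a k * (rateLower a u u' (k j) * (branchingCoeff a b N lam).sum
        fun mu c => c * multiQuad a b (Function.update k j (k j - 1)) mu) := by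
  rcases hm : k j with _ | m
  · rw [multiQuad_eq_zero (i := j.castSucc) (j := Fin.last N) (Fin.castSucc_lt_last j).ne]
    · simp [rateLower]
    · rw [Function.update_self, Function.update_of_ne (Fin.castSucc_lt_last j).ne',
        Fin.snoc_last]
  · have e1 : Function.update (Fin.snoc (fun j => k j + 1) 0 : Fin (N + 1) → ℕ) j.castSucc
        (m + 1) = Fin.snoc (fun i => Function.update k j m i + 1) 0 := by
      ext i
      induction i using Fin.lastCases with
      | last => rw [Function.update_of_ne (Fin.castSucc_lt_last j).ne', Fin.snoc_last,
          Fin.snoc_last]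
      | cast i =>
        by_cases hi : i = j
        · subst hi; simp
        · rw [Function.update_of_ne fun h => hi (Fin.castSucc_injective _ h)]
          simp [hi]
    have e2 := branchingCoeff_sum_multiQuad ha hb lam (Function.update k j m)
    rw [← linkFactor] at e2
    have e3 := linkFactor_mul_of_eq_succ (a := a) hm
    rw [e1, e2, Nat.add_sub_cancel]
    have e4 : rateLower a (u + 1) (u' + 1) (m + 1 + 1) = (((m : ℝ) + 2) * (m + 2 + a)) *
        ((m : ℝ) ^ 2 - (u + u').re * m + (u * u').re) := by
      simp only [rateLower, Complex.add_re, Complex.mul_re, Complex.add_im, Complex.one_re,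
        Complex.one_im]
      push_cast
      ring
    have e5 : rateLower a u u' (m + 1) = (((m : ℝ) + 1) * (m + 1 + a)) *
        ((m : ℝ) ^ 2 - (u + u').re * m + (u * u').re) := by
      simp only [rateLower]
      push_cast
      ring
    rw [e4, e5]
    linear_combination -((m : ℝ) ^ 2 - (u + u').re * m + (u * u').re) *
      ((branchingCoeff a b N lam).sum fun mu c =>
        c * multiQuad a b (Function.update k j m) mu) * e3

/-- The generators commute with the links: both sides are signed measures on level `N` on which all
functions `multiQuad` have the same integrals. -/
theorem sum_levelRates_mul_branchingCoeff (ha : -1 / 2 ≤ a) (hb : -1 / 2 ≤ b) (u u' : ℂ)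
    (lam : PosSignature (N + 1)) (mu : PosSignature N) :
    ∑ kap ∈ levelNeighbors lam,
        levelRates a b (u + 1) (u' + 1) (N + 1) lam kap * branchingCoeff a b N kap mu =
      (branchingCoeff a b N lam).sum fun kap c => c * levelRates a b u u' N kap mu := by
  set E : (Fin N → ℕ) → (PosSignature N →₀ ℝ) →ₗ[ℝ] ℝ :=
    fun k => Finsupp.linearCombination ℝ (multiQuad a b k) with hE
  set row : PosSignature N → PosSignature N →₀ ℝ := fun kap =>
    ∑ nu ∈ levelNeighbors kap, Finsupp.single nu (levelRates a b u u' N kap nu) with hrow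
  have hrow_apply : ∀ kap, row kap mu = levelRates a b u u' N kap mu := fun kap => by
    classical
    rw [hrow, Finsupp.finsetSum_apply]
    simp only [Finsupp.single_apply, Finset.sum_ite_eq']
    split_ifs with h
    · rfl
    · exact (levelRates_eq_zero u u' h).symm
  have hErow : ∀ k kap, E k (row kap) =
      (∑ j, rateDiag b u u' (k j) - rateConst b u u' N) * multiQuad a b k kap +
        ∑ j, rateLower a u u' (k j) * multiQuad a b (Function.update k j (k j - 1)) kap := by
    intro k kap
    rw [← sum_levelRates_multiQuad ha hb, hrow, map_sum]
    simp [hE]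
  have hElink : ∀ k kap, multiQuad a b (Fin.snoc (fun j => k j + 1) 0 : Fin (N + 1) → ℕ) kap =
      linkFactor a k * E k (branchingCoeff a b N kap) :=
    fun k kap => branchingCoeff_sum_multiQuad ha hb kap k
  have key : ∑ kap ∈ levelNeighbors lam,
        levelRates a b (u + 1) (u' + 1) (N + 1) lam kap • branchingCoeff a b N kap -
      (branchingCoeff a b N lam).sum (fun kap c => c • row kap) = 0 := by
    refine eq_zero_of_multiQuad ha hb fun k => ?_
    change E k _ = 0
    rw [map_sub, sub_eq_zero]
    refine mul_left_cancel₀ (linkFactor_pos ha k).ne' ?_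
    have h1 := sum_levelRates_multiQuad ha hb (u + 1) (u' + 1) lam
      (Fin.snoc (fun j => k j + 1) 0 : Fin (N + 1) → ℕ)
    rw [sum_rateDiag_snoc_sub_rateConst, Fin.sum_univ_castSucc] at h1
    simp only [Fin.snoc_castSucc, Fin.snoc_last, Nat.add_sub_cancel,
      rateLower_mul_multiQuad_snoc ha hb] at h1
    have h2 : rateLower a (u + 1) (u' + 1) 0 = 0 := by simp [rateLower]
    rw [h2, zero_mul, add_zero, ← Finset.mul_sum] at h1
    simp only [hElink] at h1
    have h3 : linkFactor a k * E k (∑ kap ∈ levelNeighbors lam,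
        levelRates a b (u + 1) (u' + 1) (N + 1) lam kap • branchingCoeff a b N kap) =
        ∑ kap ∈ levelNeighbors lam, levelRates a b (u + 1) (u' + 1) (N + 1) lam kap *
          (linkFactor a k * E k (branchingCoeff a b N kap)) := by
      rw [map_sum, Finset.mul_sum]
      refine Finset.sum_congr rfl fun kap _ => ?_
      rw [map_smul, smul_eq_mul]
      ring
    have h4 : E k ((branchingCoeff a b N lam).sum fun kap c => c • row kap) =
        (∑ j, rateDiag b u u' (k j) - rateConst b u u' N) * E k (branchingCoeff a b N lam) +
          ∑ j, rateLower a u u' (k j) * (branchingCoeff a b N lam).sum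
            fun mu c => c * multiQuad a b (Function.update k j (k j - 1)) mu := by
      have h5 : E k (branchingCoeff a b N lam) =
        (branchingCoeff a b N lam).sum fun mu c => c * multiQuad a b k mu := rfl
      rw [h5]
      simp only [Finsupp.sum, map_sum, map_smul, smul_eq_mul, hErow, Finset.mul_sum, mul_add,
        Finset.sum_add_distrib]
      congr 1
      · exact Finset.sum_congr rfl fun _ _ => by ring
      · rw [Finset.sum_comm]
        exact Finset.sum_congr rfl fun _ _ => Finset.sum_congr rfl fun _ _ => by ring
    rw [h3, h1, h4]
    ring
  have h := DFunLike.congr_fun (sub_eq_zero.1 key) mu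
  simp only [Finsupp.sum, Finsupp.finsetSum_apply, Finsupp.smul_apply, smul_eq_mul,
    hrow_apply] at h
  exact h

end Commutation

/-! ### Positivity of the rates -/

section Admissible

variable {a b : ℝ} {z z' : ℂ} {N : ℕ}

theorem IsAdmissiblePair.birthRate_nonneg (hz : IsAdmissiblePair a b z z') (ha : -1 / 2 ≤ a)
    (hb : -1 / 2 ≤ b) (x : ℕ) : 0 ≤ birthRate a b (z + N - 1) (z' + N - 1) x := by
  have hε := epsParam_nonneg ha hb
  have hx : (0 : ℝ) ≤ x := Nat.cast_nonneg x
  have h := (Complex.pos_iff.1 (hz.pos_int ((x : ℤ) - N + 1))).1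
  have h1 : ((x : ℂ) - (z + N - 1)) * ((x : ℂ) - (z' + N - 1)) =
      (z - ((x : ℤ) - N + 1 : ℤ)) * (z' - ((x : ℤ) - N + 1 : ℤ)) := by
    push_cast
    ring
  rw [birthRate, h1]
  refine div_nonneg (mul_nonneg (mul_nonneg ?_ (by linarith)) h.le) (by linarith)
  split_ifs
  · exact zero_le_one
  · exact div_nonneg (by linarith) (by linarith)

theorem IsAdmissiblePair.deathRate_nonneg (hz : IsAdmissiblePair a b z z') (ha : -1 / 2 ≤ a)
    (hb : -1 / 2 ≤ b) (hN : 1 ≤ N) (x : ℕ) :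
    0 ≤ deathRate a b (z + N - 1) (z' + N - 1) x := by
  have hε := epsParam_nonneg ha hb
  rw [deathRate]
  split_ifs with h0
  · exact le_rfl
  have hx : (1 : ℝ) ≤ x := by exact_mod_cast Nat.one_le_iff_ne_zero.2 h0
  have h := (Complex.pos_iff.1 (hz.pos_shift (x + N - 1) (by omega))).1
  have h1 : (((x : ℂ) + (z + N - 1) + 2 * (epsParam a b : ℂ)) *
      ((x : ℂ) + (z' + N - 1) + 2 * (epsParam a b : ℂ))) =
      (z + (x + N - 1 : ℕ) + 2 * (epsParam a b : ℂ)) *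
        (z' + (x + N - 1 : ℕ) + 2 * (epsParam a b : ℂ)) := by
    rw [Nat.cast_sub (by omega)]
    push_cast
    ring
  rw [h1]
  exact div_nonneg (mul_nonneg (mul_nonneg (by linarith) (by linarith)) h.le)
    (mul_nonneg (by linarith) (by linarith))

theorem IsAdmissiblePair.isLyapunovQMatrix (hz : IsAdmissiblePair a b z z') (ha : -1 / 2 ≤ a)
    (hb : -1 / 2 ≤ b) (hN : 1 ≤ N) :
    IsLyapunovQMatrix (levelRates a b (z + N - 1) (z' + N - 1) N) levelNeighbors :=
  isLyapunovQMatrix_levelRates ha hb (hz.birthRate_nonneg ha hb)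
    (hz.deathRate_nonneg ha hb hN) hN

theorem IsAdmissiblePair.existsUnique_isLevelSemigroup (hz : IsAdmissiblePair a b z z')
    (ha : -1 / 2 ≤ a) (hb : -1 / 2 ≤ b) (hN : 1 ≤ N) :
    ∃! P, IsLevelSemigroup a b (z + N - 1) (z' + N - 1) N P :=
  existsUnique_isMarkovSemigroup (hz.isLyapunovQMatrix ha hb hN)

end Admissible

/-! ### The master relation -/

theorem mainTheorem2 (a b : ℝ) (hb : -1 / 2 ≤ b) (hab : b ≤ a) (z z' : ℂ)
    (hz : IsAdmissiblePair a b z z') :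
    -- the links and the semigroups are well defined
    (∀ N : ℕ, 1 ≤ N → ∃! L, IsBranchingMatrix a b N L) ∧
    (∀ N : ℕ, 1 ≤ N → ∃! P, IsLevelSemigroup a b (z + N - 1) (z' + N - 1) N P) ∧
    -- the master relation, entry by entry: `P_{N+1}(t) Λ = Λ P_N(t)`
    ∀ N : ℕ, 2 ≤ N → ∀ (t : ℝ≥0) (lam : PosSignature (N + 1)) (mu : PosSignature N),
      HasSum (fun kap => zSemigroup a b z z' (N + 1) t lam kap * link a b N kap mu)
        ((link a b N lam).sum fun kap c => c * zSemigroup a b z z' N t kap mu) := by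
  have ha : -1 / 2 ≤ a := hb.trans hab
  refine ⟨fun N _ => ⟨branchingCoeff a b N, isBranchingMatrix_branchingCoeff ha hb,
      fun L hL => IsBranchingMatrix.unique ha hb hL (isBranchingMatrix_branchingCoeff ha hb)⟩,
    fun N hN => hz.existsUnique_isLevelSemigroup ha hb hN, fun N hN t lam mu => ?_⟩
  have hspec : ∀ M : ℕ, 1 ≤ M →
      IsLevelSemigroup a b (z + M - 1) (z' + M - 1) M (zSemigroup a b z z' M) := fun M hM =>
    Classical.epsilon_spec (hz.existsUnique_isLevelSemigroup ha hb hM).exists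
  have hN1 : 1 ≤ N := by omega
  have hP := hspec (N + 1) (Nat.le_add_left 1 N)
  have hQ := hz.isLyapunovQMatrix (N := N + 1) ha hb (Nat.le_add_left 1 N)
  have hP' := hspec N hN1
  -- the parameters `(u, u')` increase by `1` from level `N` to level `N + 1`
  have hshift : ∀ w : ℂ, w + ((N + 1 : ℕ) : ℂ) - 1 = w + N - 1 + 1 := fun w => by
    push_cast
    ring
  rw [hshift, hshift] at hP hQ
  rw [link_eq ha hb]
  exact hP.1.hasSum_intertwining hP.2 hQ hP'.1 hP'.2 (hz.isLyapunovQMatrix ha hb hN1)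
    (branchingCoeff_nonneg ha hb) (branchingCoeff_sum ha hb)
    (sum_levelRates_mul_branchingCoeff ha hb _ _) t lam mu
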